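/- Let $U\subset\mathbb R^d$ be open (a coordinate domain of the manifold), let $g:U\to\mathbb R^{d\times d}$ be smooth with symmetric positive definite values, $G=g^{-1}$, and let $$H(x,y,p,q)=\tfrac12(g(x)q,q)-(G(x)y,p)+\tfrac12\Big(\tfrac{\partial}{\partial x}(G(x)y,y),q\Big),\qquad x\in U,\ y,p,q\in\mathbb R^d .$$ A characteristic on $[0,t]$ is a solution of $\dot x=H_p,\ \dot y=H_q,\ \dot p=-H_x,\ \dot q=-H_y$ on $[0,t]$ with $x(s)\in U$; $(X,Y)(t,x_0,y_0,p_0,q_0)$ denotes the $(x,y)$-components at time $t$ of the characteristic starting at $(x_0,y_0,p_0,q_0)$. For $r,t>0$ let $D=D_r=B_r(x_0)\times B_{r/t}(y_0)$ and, for $0<\varepsilon<r$, let $\Delta D_\varepsilon=D_r\setminus D_{r-\varepsilon}$. Let $K\subset U$ be compact. Then there are $\delta,r_0,c_0>0$ such that the following holds. (a) Let $x_0\in K$, $y_0\in\mathbb R^d$, $t>0$, $t|y_0|<c_0$. For every $(x,y)\in D_{r_0}$ there is exactly one $(p_0,q_0)$ with $|p_0|<\delta t^{-3}$, $|q_0|<\delta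 t^{-2}$ whose characteristic leads from $(x_0,y_0)$ to $(x,y)$ in time $t$. Let $S(t,x,y,x_0,y_0)=\int_0^t\big((p,H_p)+(q,H_q)-H\big)\,ds$ be the action along it and $J=\det\frac{\partial(X,Y)}{\partial(p_0,q_0)}$ the Jacobian at it. Then $J>0$, and $S$ and $\phi:=J^{-1/2}$ are smooth in $(t,x,y)$ on the set of all $(t,x,y)$ with $t>0$, $t|y_0|<c_0$ and $(x,y)\in D_{r_0}$. (b) For all $0<r<r_0$ and $0<\varepsilon<r$ there are $c\in(0,c_0]$ and $\Omega>0$ such that for all $t_0,h_0>0$ and $M$ there is a constant $A$ with the following property. Let $\chi_D=\chi_D(t,\cdot,\cdot)$, $t>0$, be smooth in all variables with values in $[0,1]$, zero outside $B_r(0)\times B_{r/t}(0)$, equal to $1$ on $B_{r-\varepsilon}(0)\times B_{(r-\varepsilon)/t}(0)$, and such that $|\partial_x\chi_D|,|\partial_y\chi_D|,|\partial_y^2\chi_D|\le M$ and $|\partial_t\chi_D|\le M/t$ for $0<t\le t_0$. Let $C(h)>0$ be any function of $h>0$, let $0<h\le h_0$, $x_0\in K$, $y_0\in\mathbb R^d$,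 and put $$u^D=C(h)\,\chi_D(t,x-x_0,y-y_0)\,\phi(t,x,y,x_0,y_0)\,e^{-S(t,x,y,x_0,y_0)/h}$$ (zero outside $D$). Then $u^D$ is smooth in $(t,x,y)\in\mathbb R\times\mathbb R^d\times\mathbb R^d$ for $t>0$, $t|y_0|<c$, and the inhomogeneity $F$ defined by $$h\frac{\partial u^D}{\partial t}-\frac{h^2}{2}\,\mathrm{tr}\Big(g(x)\frac{\partial^2u^D}{\partial y^2}\Big)-h\Big(G(x)y,\frac{\partial u^D}{\partial x}\Big)+\frac h2\Big(\frac{\partial}{\partial x}(G(x)y,y),\frac{\partial u^D}{\partial y}\Big)=-h^2\,C(h)\,F$$ satisfies, for all $0<t\le t_0$ with $t|y_0|<c$ and all $(x,y)\in\mathbb R^d\times\mathbb R^d$, $$|F|\le A\,t^2\,\frac{u^D}{C(h)}+A\,\exp\Big[-\frac{\Omega}{h\,t^3}\Big]\,\mathbf 1_{\Delta D_\varepsilon}(x,y).$$ (All terms of the equation are read as zero where $u^D$ vanishes identically near the point.) -/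

import Mathlib

open scoped ContDiff Matrix
open MeasureTheory

noncomputable section

namespace StochGeodesic

/-- Euclidean `d`-space: the range of local coordinates `x` and of covectors `y`. -/
abbrev E (d : ℕ) := EuclideanSpace ℝ (Fin d)

/-- Points `(x, y, p, q)` of the phase space of the Hamiltonian system. -/
abbrev Phase (d : ℕ) := E d × E d × E d × E d

variable {d : ℕ}

/-- The vector `A y`. -/
def matVec (A : Matrix (Fin d) (Fin d) ℝ) (y : E d) : E d :=
  WithLp.toLp 2 (fun i => ∑ j, A i j * y j)

/-- The quadratic form `(G(x) y, y)`, where `G = g⁻¹`. -/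
def energy (g : E d → Matrix (Fin d) (Fin d) ℝ) (y x : E d) : ℝ :=
  inner ℝ (matVec (g x)⁻¹ y) y

/-- `H(x,y,p,q) = ½ (g(x) q, q) - (G(x) y, p) + ½ (∂/∂x (G(x) y, y), q)`. -/
def hamiltonian (g : E d → Matrix (Fin d) (Fin d) ℝ) (x y p q : E d) : ℝ :=
  1 / 2 * inner ℝ (matVec (g x) q) q - inner ℝ (matVec (g x)⁻¹ y) p
    + 1 / 2 * inner ℝ (gradient (energy g y) x) q

/-- The Hamiltonian vector field `(∂H/∂p, ∂H/∂q, -∂H/∂x, -∂H/∂y)`. -/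
def hamiltonField (g : E d → Matrix (Fin d) (Fin d) ℝ) : Phase d → Phase d :=
  fun (x, y, p, q) =>
    (gradient (fun p' => hamiltonian g x y p' q) p,
      gradient (fun q' => hamiltonian g x y p q') q,
      -gradient (fun x' => hamiltonian g x' y p q) x,
      -gradient (fun y' => hamiltonian g x y' p q) y)

/-- `γ` solves the Hamiltonian system on `[0, t]`, starts at `z₀`, and its `x`-component stays in
the coordinate domain `U`. -/
def IsCharacteristic (g : E d → Matrix (Fin d) (Fin d) ℝ) (U : Set (E d)) (t : ℝ)
    (z₀ : Phase d) (γ : ℝ → Phase d) : Prop :=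
  γ 0 = z₀ ∧ ∀ s ∈ Set.Icc 0 t,
    (γ s).1 ∈ U ∧ HasDerivWithinAt γ (hamiltonField g (γ s)) (Set.Icc 0 t) s

/-- The characteristic on `[0, t]` starting at `z₀` (arbitrary if there is none). -/
def characteristic (g : E d → Matrix (Fin d) (Fin d) ℝ) (U : Set (E d)) (t : ℝ)
    (z₀ : Phase d) : ℝ → Phase d :=
  Classical.epsilon (IsCharacteristic g U t z₀)

/-- The end point `(X, Y)(t, x₀, y₀, p₀, q₀)` as a function of `ζ = (p₀, q₀)`. -/
def endpoint (g : E d → Matrix (Fin d) (Fin d) ℝ) (U : Set (E d)) (t : ℝ) (x₀ y₀ : E d)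
    (ζ : E d × E d) : E d × E d :=
  ((characteristic g U t (x₀, y₀, ζ) t).1, (characteristic g U t (x₀, y₀, ζ) t).2.1)

/-- `ζ = (p₀, q₀)` lies in the polydisc `|p₀| < δ/t³`, `|q₀| < δ/t²`, and the characteristic
with these initial momenta leads from `(x₀, y₀)` to `(x, y)` in time `t`. -/
def IsConnecting (g : E d → Matrix (Fin d) (Fin d) ℝ) (U : Set (E d)) (δ t : ℝ)
    (x y x₀ y₀ : E d) (ζ : E d × E d) : Prop :=
  ‖ζ.1‖ < δ / t ^ 3 ∧ ‖ζ.2‖ < δ / t ^ 2 ∧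
    ∃ γ, IsCharacteristic g U t (x₀, y₀, ζ) γ ∧ (γ t).1 = x ∧ (γ t).2.1 = y

/-- The initial momenta `(p₀, q₀)(t, x, y, x₀, y₀)` of the connecting characteristic. -/
def momenta (g : E d → Matrix (Fin d) (Fin d) ℝ) (U : Set (E d)) (δ t : ℝ)
    (x y x₀ y₀ : E d) : E d × E d :=
  Classical.epsilon (IsConnecting g U δ t x y x₀ y₀)

/-- The integrand `p · ∂H/∂p + q · ∂H/∂q - H` of the action. -/
def lagrangian (g : E d → Matrix (Fin d) (Fin d) ℝ) : Phase d → ℝ :=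
  fun (x, y, p, q) =>
    inner ℝ p (hamiltonField g (x, y, p, q)).1 + inner ℝ q (hamiltonField g (x, y, p, q)).2.1
      - hamiltonian g x y p q

/-- The two-point function `S(t, x, y, x₀, y₀)`: the action along the connecting
characteristic. -/
def phaseS (g : E d → Matrix (Fin d) (Fin d) ℝ) (U : Set (E d)) (δ t : ℝ)
    (x y x₀ y₀ : E d) : ℝ :=
  ∫ s in (0 : ℝ)..t,
    lagrangian g (characteristic g U t (x₀, y₀, momenta g U δ t x y x₀ y₀) s)

/-- The Jacobian `J = det ∂(X, Y)/∂(p₀, q₀)` at the connecting characteristic. -/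
def jacobian (g : E d → Matrix (Fin d) (Fin d) ℝ) (U : Set (E d)) (δ t : ℝ)
    (x y x₀ y₀ : E d) : ℝ :=
  (fderiv ℝ (endpoint g U t x₀ y₀) (momenta g U δ t x y x₀ y₀)).det

/-- The amplitude `φ = J^(-1/2)`. -/
def amplitude (g : E d → Matrix (Fin d) (Fin d) ℝ) (U : Set (E d)) (δ t : ℝ)
    (x y x₀ y₀ : E d) : ℝ :=
  (Real.sqrt (jacobian g U δ t x y x₀ y₀))⁻¹

/-- The polydisc `D = B_r(x₀) × B_{r/t}(y₀)`. -/
def polydisc (r t : ℝ) (x₀ y₀ : E d) : Set (E d × E d) :=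
  Metric.ball x₀ r ×ˢ Metric.ball y₀ (r / t)

/-- The boundary layer `ΔD_ε` of the polydisc `D`. -/
def boundaryLayer (r ε t : ℝ) (x₀ y₀ : E d) : Set (E d × E d) :=
  polydisc r t x₀ y₀ \ polydisc (r - ε) t x₀ y₀

/-- `χ t` is a cut-off function of the polydisc (centred at the origin) at time `t`: it is smooth,
has values in `[0,1]`, vanishes outside the polydisc and is `1` off the boundary layer; its first
derivatives in `x` and its first and second derivatives in `y` are bounded by `M` for `t ≤ t₀`.
As the polydisc moves with `t`, so does `χ t`, at most at the rate `M / t`. -/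
structure IsCutoff (r ε t₀ M : ℝ) (χ : ℝ → E d → E d → ℝ) : Prop where
  smooth : ContDiffOn ℝ ∞ (fun w : ℝ × E d × E d => χ w.1 w.2.1 w.2.2) {w | 0 < w.1}
  mem_Icc : ∀ t > 0, ∀ x y, χ t x y ∈ Set.Icc (0 : ℝ) 1
  eq_zero : ∀ t > 0, ∀ x y, (x, y) ∉ polydisc r t (0 : E d) 0 → χ t x y = 0
  eq_one : ∀ t > 0, ∀ x y, (x, y) ∈ polydisc (r - ε) t (0 : E d) 0 → χ t x y = 1
  bound_x : ∀ t ∈ Set.Ioc 0 t₀, ∀ x y, ‖fderiv ℝ (fun x' => χ t x' y) x‖ ≤ M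
  bound_y : ∀ t ∈ Set.Ioc 0 t₀, ∀ x y, ‖fderiv ℝ (χ t x) y‖ ≤ M
  bound_yy : ∀ t ∈ Set.Ioc 0 t₀, ∀ x y, ‖fderiv ℝ (fderiv ℝ (χ t x)) y‖ ≤ M
  bound_t : ∀ t ∈ Set.Ioc 0 t₀, ∀ x y, |deriv (fun s => χ s x y) t| ≤ M / t

/-- The cut-off WKB function
`u^D = C(h) χ_D(x - x₀, y - y₀) φ(t, x, y, x₀, y₀) exp(-S(t, x, y, x₀, y₀) / h)`. -/
def cutoffWKB (g : E d → Matrix (Fin d) (Fin d) ℝ) (U : Set (E d)) (δ : ℝ) (C : ℝ → ℝ)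
    (χ : ℝ → E d → E d → ℝ) (h : ℝ) (x₀ y₀ : E d) (t : ℝ) (x y : E d) : ℝ :=
  C h * χ t (x - x₀) (y - y₀) * amplitude g U δ t x y x₀ y₀
    * Real.exp (-phaseS g U δ t x y x₀ y₀ / h)

/-- `h ∂u/∂t - (h²/2) tr(g(x) ∂²u/∂y²) - h (G(x) y, ∂u/∂x) + (h/2) (∂/∂x (G(x) y, y), ∂u/∂y)`. -/
def parabolicOp (g : E d → Matrix (Fin d) (Fin d) ℝ) (h : ℝ) (u : ℝ → E d → E d → ℝ)
    (t : ℝ) (x y : E d) : ℝ :=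
  h * deriv (fun s => u s x y) t
    - h ^ 2 / 2 * ∑ i, ∑ j, g x i j *
        fderiv ℝ (fderiv ℝ (u t x)) y (EuclideanSpace.single i 1) (EuclideanSpace.single j 1)
    - h * fderiv ℝ (fun x' => u t x' y) x (matVec (g x)⁻¹ y)
    + h / 2 * fderiv ℝ (u t x) y (gradient (energy g y) x)

/-- The inhomogeneity `F`, defined by `parabolicOp u^D = -h² C(h) F`. -/
def inhomogeneity (g : E d → Matrix (Fin d) (Fin d) ℝ) (U : Set (E d)) (δ : ℝ) (C : ℝ → ℝ)
    (χ : ℝ → E d → E d → ℝ) (h : ℝ) (x₀ y₀ : E d) (t : ℝ) (x y : E d) : ℝ :=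
  -parabolicOp g h (cutoffWKB g U δ C χ h x₀ y₀) t x y / (h ^ 2 * C h)

end StochGeodesic

end

/-! The Hamiltonian is homogeneous of degree 4 when `(x, y, p, q)` carry the weights `(0, 1, 3, 2)`.
The conjugate pairs `(x, p)` and `(y, q)` both have total weight 3, so a dilation by `l` maps
characteristics to characteristics and divides time by `l` (`IsCharacteristic.dilate`). Hence
everything at time `t` is a rescaled quantity at time 1. With `a = (x₀, t y₀)` and `b = (x, t y)`
one has `S = t⁻³ S₁(a, b)`, `J = t^(4d) J₁(a, b)` and `φ = t^(-2d) φ₁(a, b)`, and the polydiscs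
become balls of fixed radius. Uniformity in `t` is thus a compactness statement over `K × {0}`.

At unit time the zero section consists of rest points. The linearised flow there is a cubic
polynomial in time, and the derivative of the end point with respect to the momenta has determinant
`12^(-d)` (`det_of_blocks`, `expDeriv_base`). The smooth dependence of solutions on initial values
(`exists_smooth_flow`) and a quantitative inverse function theorem then give the unique short
characteristic, `J > 0`, and smoothness (`exists_uniform_inverse`, `contDiffAt_inverse_family`);
`Chart` collects this.

The first variation of the action (`fderiv_action`) shows that the gradient of `S` consists of the
final momenta, which yields the Hamilton-Jacobi equation. Liouville's formula shows that `J` grows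
along characteristics at the rate given by the divergence of the velocity field. In this divergence
the two terms containing derivatives of `G` cancel and `tr(g S_yy)` remains
(`trace_fderiv_velocity`), so `φ = J^(-1/2)` solves the transport equation. In the equation for `χ φ
exp(-S/h)` the orders `h⁰` and `h¹` therefore cancel, except for terms with derivatives of `χ`
(`frozenOp_wkb`).

What remains is `½ χ tr(g φ_yy) exp(-S/h)` and the terms with derivatives of `χ`. In the first, each
`y`-derivative of a function of `t y` yields a factor `t`, and `φ₁` is bounded below, whence the
bound `A t² u^D / C(h)`. The others live on the boundary layer. The Lagrangian is `½ (g q, q)`, so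
the action is positive unless both initial momenta vanish; for small `t |y₀|` vanishing momenta do
not lead as far as the layer, and compactness gives `S ≥ Ω t⁻³` there (`exists_action_bound`). Half
of this exponent absorbs all negative powers of `h` and `t` (`exists_exp_absorb`). -/

noncomputable section

namespace StochGeodesic

variable {d : ℕ}

/-! ### Smooth dependence of solutions on initial values -/

section Flow

universe u

/-- Pointwise application of a continuous family of linear maps, as a bilinear map. -/
def pointwiseApply (X : Type*) [TopologicalSpace X] [CompactSpace X] (F G : Type*)
    [NormedAddCommGroup F] [NormedSpace ℝ F] [NormedAddCommGroup G] [NormedSpace ℝ G] :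
    C(X, F →L[ℝ] G) →L[ℝ] C(X, F) →L[ℝ] C(X, G) :=
  LinearMap.mkContinuous₂
    (LinearMap.mk₂ ℝ (fun (A : C(X, F →L[ℝ] G)) (γ : C(X, F)) =>
      (⟨fun s => A s (γ s), by fun_prop⟩ : C(X, G)))
      (fun _ _ _ => by ext; simp) (fun _ _ _ => by ext; simp) (fun _ _ _ => by ext; simp)
      (fun _ _ _ => by ext; simp)) 1 (fun A γ => by
        rw [one_mul, ContinuousMap.norm_le _ (by positivity)]
        intro s
        exact (A s).le_of_opNorm_le_of_le (A.norm_coe_le_norm s) (γ.norm_coe_le_norm s))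

/-! ### Superposition operators on spaces of continuous maps. -/

section Superposition

variable {X : Type*} [TopologicalSpace X] [CompactSpace X]
  {F G : Type u} [NormedAddCommGroup F] [NormedSpace ℝ F] [NormedAddCommGroup G] [NormedSpace ℝ G]

@[simp] theorem pointwiseApply_apply (A : C(X, F →L[ℝ] G)) (γ : C(X, F)) (s : X) :
    pointwiseApply X F G A γ s = A s (γ s) := rfl

/-- The mean value inequality is applied at each point of `X`. The remainder is uniform because `γ ↦
f' ∘ γ` is continuous for the sup norm, so local compactness of `F` plays no role. -/
theorem hasFDerivAt_comp_continuousMap {f : C(F, G)} {f' : C(F, F →L[ℝ] G)}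
    (hf : ∀ x, HasFDerivAt f (f' x) x) (γ : C(X, F)) :
    HasFDerivAt (fun γ : C(X, F) => f.comp γ) (pointwiseApply X F G (f'.comp γ)) γ := by
  rw [hasFDerivAt_iff_isLittleO_nhds_zero, Asymptotics.isLittleO_iff]
  intro c hc
  have hcont : ContinuousAt (fun δ : C(X, F) => f'.comp (γ + δ)) 0 :=
    ((ContinuousMap.continuous_postcomp f').comp (continuous_const.add continuous_id)).continuousAt
  obtain ⟨η, hη, hball⟩ := (Metric.continuousAt_iff (f := fun δ : C(X, F) => f'.comp (γ + δ))
    (a := 0)).1 hcont c hc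
  filter_upwards [Metric.ball_mem_nhds (0 : C(X, F)) hη] with δ hδ
  rw [ContinuousMap.norm_le _ (by positivity)]
  intro s
  have key := Convex.norm_image_sub_le_of_norm_hasFDerivWithin_le' (f := f) (f' := fun x => f' x)
    (φ := f' (γ s)) (s := Metric.closedBall (γ s) ‖δ‖) (x := γ s) (y := γ s + δ s) (C := c)
    (fun x _ => (hf x).hasFDerivWithinAt) (fun x hx => ?_) (convex_closedBall _ _)
    (Metric.mem_closedBall_self (norm_nonneg _))
    (by simpa [Metric.mem_closedBall, dist_eq_norm] using δ.norm_coe_le_norm s)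
  · have h2 : ‖γ s + δ s - γ s‖ ≤ ‖δ‖ := by simpa using δ.norm_coe_le_norm s
    simp only [ContinuousMap.sub_apply, ContinuousMap.comp_apply, ContinuousMap.add_apply,
      pointwiseApply_apply]
    refine (le_trans (le_of_eq ?_) key).trans (by gcongr)
    simp
  -- A point `x` near `γ s` is the value at `s` of `γ` plus a constant function, so the continuity
  -- of `γ ↦ f' ∘ γ` bounds `f' x - f' (γ s)`.
  · have h3 : dist (ContinuousMap.const X (x - γ s)) 0 < η := by
      refine lt_of_le_of_lt ?_ (mem_ball_iff_norm.1 hδ)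
      rw [dist_zero_right, sub_zero, ContinuousMap.norm_le _ (norm_nonneg _)]
      intro; simpa [dist_eq_norm] using hx
    have h4 := (hball h3).le
    have h5 := (ContinuousMap.dist_apply_le_dist s).trans h4
    simpa [dist_eq_norm] using h5

/-- The derivative is pointwise application of the superposition operator of `f'`, which is one
class less smooth. The induction runs over all pairs of spaces in one universe because the target
changes from `G` to `F →L[ℝ] G`. -/
theorem contDiff_nat_comp_continuousMap (n : ℕ) : ∀ {F G : Type u} [NormedAddCommGroup F]
    [NormedSpace ℝ F] [NormedAddCommGroup G] [NormedSpace ℝ G] (f : C(F, G)),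
    ContDiff ℝ n f → ContDiff ℝ n (fun γ : C(X, F) => f.comp γ) := by
  induction n with
  | zero =>
    intro F G _ _ _ _ f _
    exact contDiff_zero.2 (ContinuousMap.continuous_postcomp f)
  | succ n ih =>
    intro F G _ _ _ _ f hf
    obtain ⟨f', hf', hd⟩ := contDiff_succ_iff_hasFDerivAt.1 hf
    refine contDiff_succ_iff_hasFDerivAt.2
      ⟨_, ?_, fun γ => hasFDerivAt_comp_continuousMap (f' := ⟨f', hf'.continuous⟩) hd γ⟩
    exact (pointwiseApply X F G).contDiff.comp (ih ⟨f', hf'.continuous⟩ hf')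

/-- The superposition operator of a smooth function is smooth on continuous functions. -/
theorem contDiff_comp_continuousMap (f : C(F, G)) (hf : ContDiff ℝ ∞ f) :
    ContDiff ℝ ∞ (fun γ : C(X, F) => f.comp γ) :=
  contDiff_infty.2 fun n => contDiff_nat_comp_continuousMap n f (contDiff_infty.1 hf n)

end Superposition

/-! ### The integral equation and its solution map. -/

variable {F : Type u} [NormedAddCommGroup F]

theorem continuous_IccExtend (γ : C(unitInterval, F)) :
    Continuous (Set.IccExtend zero_le_one γ : ℝ → F) :=
  γ.continuous.Icc_extend'

theorem norm_IccExtend_le (γ : C(unitInterval, F)) (s : ℝ) :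
    ‖(Set.IccExtend zero_le_one γ : ℝ → F) s‖ ≤ ‖γ‖ := γ.norm_coe_le_norm _

variable [NormedSpace ℝ F]

/-- The primitive that vanishes at `0`. -/
def volterra [CompleteSpace F] : C(unitInterval, F) →L[ℝ] C(unitInterval, F) :=
  LinearMap.mkContinuous
    { toFun := fun γ => ⟨fun σ => ∫ s in (0 : ℝ)..σ, Set.IccExtend zero_le_one γ s,
        (intervalIntegral.continuous_primitive
          (fun _ _ => (continuous_IccExtend γ).intervalIntegrable _ _) 0).comp
            continuous_subtype_val⟩
      map_add' := fun γ δ => by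
        ext σ
        simp only [ContinuousMap.coe_mk, ContinuousMap.add_apply]
        rw [← intervalIntegral.integral_add ((continuous_IccExtend γ).intervalIntegrable _ _)
          ((continuous_IccExtend δ).intervalIntegrable _ _)]
        rfl
      map_smul' := fun c γ => by
        ext σ
        simp only [ContinuousMap.coe_mk, ContinuousMap.smul_apply, RingHom.id_apply]
        rw [← intervalIntegral.integral_smul]
        rfl } 1 (fun γ => by
      rw [one_mul, ContinuousMap.norm_le _ (norm_nonneg _)]
      intro σ
      refine (intervalIntegral.norm_integral_le_of_norm_le_const
        fun s _ => norm_IccExtend_le γ s).trans ?_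
      rw [sub_zero, abs_of_nonneg σ.2.1]
      exact mul_le_of_le_one_right (norm_nonneg _) σ.2.2)

theorem volterra_apply [CompleteSpace F] (γ : C(unitInterval, F)) (σ : unitInterval) :
    volterra γ σ = ∫ s in (0 : ℝ)..σ, Set.IccExtend zero_le_one γ s := rfl

theorem norm_volterra_le [CompleteSpace F] (γ : C(unitInterval, F)) : ‖volterra γ‖ ≤ ‖γ‖ := by
  have := (volterra (F := F)).le_of_opNorm_le (LinearMap.mkContinuous_norm_le _ zero_le_one _) γ
  simpa using this

theorem hasDerivAt_volterra [CompleteSpace F] (γ : C(unitInterval, F)) (σ : ℝ) :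
    HasDerivAt (fun σ : ℝ => ∫ s in (0 : ℝ)..σ, Set.IccExtend zero_le_one γ s)
      ((Set.IccExtend zero_le_one γ : ℝ → F) σ) σ :=
  intervalIntegral.integral_hasDerivAt_right ((continuous_IccExtend γ).intervalIntegrable _ _)
    (continuous_IccExtend γ).stronglyMeasurable.stronglyMeasurableAtFilter
    (continuous_IccExtend γ).continuousAt

/-- Solutions of `γ' = l V(γ)` on the unit interval, `l` small, depend smoothly on their initial
values. -/
theorem exists_smooth_flow [CompleteSpace F] (V : C(F, F)) (hV : ContDiff ℝ ∞ V) {L l : NNReal}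
    (hL : LipschitzWith L V) (hl : l * L < 1) :
    ∃ Γ : F → C(unitInterval, F), ContDiff ℝ ∞ Γ ∧
      (∀ z, Γ z = ContinuousMap.const _ z + (l : ℝ) • volterra (V.comp (Γ z))) ∧
      ∀ z γ, γ = ContinuousMap.const _ z + (l : ℝ) • volterra (V.comp γ) → γ = Γ z := by
  set P : C(unitInterval, F) → C(unitInterval, F) := fun γ => (l : ℝ) • volterra (V.comp γ) with hP
  have hPs : ContDiff ℝ ∞ P :=
    ((volterra (F := F)).contDiff.comp (contDiff_comp_continuousMap V hV)).const_smul (l : ℝ)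
  have hPl : LipschitzWith (l * L) P := by
    refine LipschitzWith.of_dist_le_mul fun γ δ => ?_
    rw [dist_eq_norm, hP]
    simp only
    rw [← smul_sub, ← map_sub, norm_smul, Real.norm_of_nonneg (NNReal.coe_nonneg l), NNReal.coe_mul, mul_assoc]
    refine mul_le_mul_of_nonneg_left ((norm_volterra_le _).trans ?_) l.2
    rw [ContinuousMap.norm_le _ (by positivity)]
    intro s
    simp only [ContinuousMap.sub_apply, ContinuousMap.comp_apply, ← dist_eq_norm]
    exact (hL.dist_le_mul _ _).trans (by gcongr; exact ContinuousMap.dist_apply_le_dist s)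
  -- The integral equation reads `T γ = const z`. As `T` differs from the identity by a contraction,
  -- it is a homeomorphism of the whole space, and the solution map is its inverse restricted to
  -- constants.
  set T : C(unitInterval, F) → C(unitInterval, F) := fun γ => γ - P γ with hT
  have hTs : ContDiff ℝ ∞ T := contDiff_id.sub hPs
  have happ : ApproximatesLinearOn T
      (ContinuousLinearEquiv.refl ℝ C(unitInterval, F) : C(unitInterval, F) →L[ℝ] _)
      Set.univ (l * L) := by
    intro γ _ δ _
    have h1 : T γ - T δ - (γ - δ) = -(P γ - P δ) := by simp only [hT]; abel
    have h2 := hPl.dist_le_mul γ δ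
    rw [dist_eq_norm, dist_eq_norm] at h2
    simpa [h1, norm_sub_rev] using h2
  -- The identity has norm 1 only on a nontrivial space, which is why the trivial one is a separate
  -- alternative.
  have hc : Subsingleton C(unitInterval, F) ∨
      l * L < ‖((ContinuousLinearEquiv.refl ℝ C(unitInterval, F)).symm :
        C(unitInterval, F) →L[ℝ] C(unitInterval, F))‖₊⁻¹ := by
    rcases subsingleton_or_nontrivial C(unitInterval, F) with h | h
    · exact Or.inl h
    · right
      have : ‖((ContinuousLinearEquiv.refl ℝ C(unitInterval, F)).symm :
        C(unitInterval, F) →L[ℝ] C(unitInterval, F))‖₊ = 1 := by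
        ext; exact ContinuousLinearMap.norm_id
      rw [this]; simpa using hl
  set Θ := happ.toHomeomorph T hc with hΘ
  have hΘT : ∀ γ, Θ γ = T γ := fun γ => rfl
  have hder : ∀ γ, ∃ e : C(unitInterval, F) ≃L[ℝ] C(unitInterval, F),
      HasFDerivAt Θ (e : C(unitInterval, F) →L[ℝ] C(unitInterval, F)) γ := by
    intro γ
    -- The derivative of a contraction has norm less than 1, so the Neumann series inverts the
    -- derivative of `T` and the inverse homeomorphism is smooth.
    have hn : ‖fderiv ℝ P γ‖ < 1 :=
      (norm_fderiv_le_of_lipschitz ℝ hPl).trans_lt (by exact_mod_cast hl)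
    refine ⟨ContinuousLinearEquiv.unitsEquiv ℝ _ (Units.oneSub (fderiv ℝ P γ) hn), ?_⟩
    have h1 : HasFDerivAt T (ContinuousLinearMap.id ℝ _ - fderiv ℝ P γ) γ :=
      (hasFDerivAt_id γ).sub ((hPs.differentiable (by simp)) γ).hasFDerivAt
    exact h1
  choose e he using hder
  have hsymm : ContDiff ℝ ∞ Θ.symm := Θ.contDiff_symm he hTs
  refine ⟨fun z => Θ.symm (ContinuousMap.const _ z), ?_, fun z => ?_, fun z γ hγ => ?_⟩
  · exact hsymm.comp (ContinuousLinearMap.contDiff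
      (ContinuousLinearMap.const ℝ unitInterval : F →L[ℝ] C(unitInterval, F)))
  · have := hΘT (Θ.symm (ContinuousMap.const _ z))
    rw [Homeomorph.apply_symm_apply] at this
    simp only [hT, hP] at this
    exact (sub_eq_iff_eq_add.1 this.symm)
  · rw [eq_comm, Homeomorph.symm_apply_eq, hΘT]
    simp only [hT, hP]
    exact (sub_eq_iff_eq_add.2 hγ).symm

/-- Two solutions of an autonomous equation with the same initial value agree. -/
theorem solution_unique {V : F → F} {Ω : Set F} (hΩ : IsOpen Ω) (hV : ContDiffOn ℝ 1 V Ω)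
    {t : ℝ} {γ δ : ℝ → F}
    (hγ : ∀ s ∈ Set.Icc 0 t, γ s ∈ Ω ∧ HasDerivWithinAt γ (V (γ s)) (Set.Icc 0 t) s)
    (hδ : ∀ s ∈ Set.Icc 0 t, δ s ∈ Ω ∧ HasDerivWithinAt δ (V (δ s)) (Set.Icc 0 t) s)
    (h0 : γ 0 = δ 0) : Set.EqOn γ δ (Set.Icc 0 t) := by
  have hγc : ContinuousOn γ (Set.Icc 0 t) := fun s hs => (hγ s hs).2.continuousWithinAt
  have hδc : ContinuousOn δ (Set.Icc 0 t) := fun s hs => (hδ s hs).2.continuousWithinAt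
  -- The field is only locally Lipschitz on `Ω`. On the compact union of the two traces it has one
  -- Lipschitz constant, and Gronwall's uniqueness theorem applies with this set.
  set C := γ '' Set.Icc 0 t ∪ δ '' Set.Icc 0 t with hC
  have hCc : IsCompact C := (isCompact_Icc.image_of_continuousOn hγc).union
    (isCompact_Icc.image_of_continuousOn hδc)
  have hCΩ : C ⊆ Ω := by
    rintro _ (⟨s, hs, rfl⟩ | ⟨s, hs, rfl⟩)
    exacts [(hγ s hs).1, (hδ s hs).1]
  have hll : LocallyLipschitzOn C V := by
    intro x hx
    obtain ⟨L, u, hu, hL⟩ := (hV.contDiffAt (hΩ.mem_nhds (hCΩ hx))).exists_lipschitzOnWith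
    exact ⟨L, u, mem_nhdsWithin_of_mem_nhds hu, hL⟩
  obtain ⟨L, hL⟩ := hll.exists_lipschitzOnWith_of_compact hCc
  have hIci : ∀ {f : ℝ → F} {f' : F} {s : ℝ}, s ∈ Set.Ico 0 t →
      HasDerivWithinAt f f' (Set.Icc 0 t) s → HasDerivWithinAt f f' (Set.Ici s) s := by
    intro f f' s hs h
    refine (h.mono_of_mem_nhdsWithin ?_)
    exact Filter.mem_of_superset (Icc_mem_nhdsGE hs.2) (Set.Icc_subset_Icc_left hs.1)
  exact ODE_solution_unique_of_mem_Icc_right (v := fun _ => V) (s := fun _ => C)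
    (fun _ _ => hL) hγc (fun s hs => hIci hs (hγ s (Set.Ico_subset_Icc_self hs)).2)
    (fun s hs => Or.inl ⟨s, Set.Ico_subset_Icc_self hs, rfl⟩) hδc
    (fun s hs => hIci hs (hδ s (Set.Ico_subset_Icc_self hs)).2)
    (fun s hs => Or.inr ⟨s, Set.Ico_subset_Icc_self hs, rfl⟩) h0

end Flow

/-! ### The Hamiltonian vector field -/

/-- `g` is a Riemannian metric (on covectors) in the coordinate domain `U`. -/
structure IsMetric (U : Set (E d)) (g : E d → Matrix (Fin d) (Fin d) ℝ) : Prop where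
  isOpen : IsOpen U
  smooth : ∀ i j, ContDiffOn ℝ ∞ (fun x => g x i j) U
  pos : ∀ x ∈ U, (g x).PosDef

theorem matVec_apply (A : Matrix (Fin d) (Fin d) ℝ) (y : E d) (i : Fin d) :
    matVec A y i = ∑ j, A i j * y j := rfl

/-- `matVec A` as a continuous linear map. -/
def matVecL (A : Matrix (Fin d) (Fin d) ℝ) : E d →L[ℝ] E d :=
  LinearMap.toContinuousLinearMap
    { toFun := matVec A
      map_add' := fun y z => by
        ext i; simp [matVec_apply, mul_add, Finset.sum_add_distrib]
      map_smul' := fun c y => by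
        ext i; simp [matVec_apply, Finset.mul_sum, mul_left_comm] }

theorem matVecL_apply (A : Matrix (Fin d) (Fin d) ℝ) (y : E d) : matVecL A y = matVec A y := rfl

@[simp] theorem matVec_zero (A : Matrix (Fin d) (Fin d) ℝ) : matVec A 0 = 0 := (matVecL A).map_zero

theorem matVec_smul (A : Matrix (Fin d) (Fin d) ℝ) (c : ℝ) (y : E d) :
    matVec A (c • y) = c • matVec A y := (matVecL A).map_smul c y

theorem matVec_matVec (A B : Matrix (Fin d) (Fin d) ℝ) (y : E d) :
    matVec A (matVec B y) = matVec (A * B) y := by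
  ext i
  simp only [matVec_apply, Matrix.mul_apply, Finset.mul_sum, Finset.sum_mul]
  rw [Finset.sum_comm]
  simp only [mul_assoc]

@[simp] theorem matVec_one (y : E d) : matVec 1 y = y := by
  ext i; simp [matVec_apply, Matrix.one_apply]

theorem inner_eq_sum (y z : E d) : inner ℝ y z = ∑ i, y i * z i := by
  simp [PiLp.inner_apply, mul_comm]

theorem inner_matVec (A : Matrix (Fin d) (Fin d) ℝ) (y z : E d) :
    inner ℝ (matVec A y) z = ∑ i, ∑ j, A i j * y j * z i := by
  simp [inner_eq_sum, matVec_apply, Finset.sum_mul]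

theorem inner_matVec_comm {A : Matrix (Fin d) (Fin d) ℝ} (hA : A.IsHermitian) (y z : E d) :
    inner ℝ (matVec A y) z = inner ℝ (matVec A z) y := by
  rw [inner_matVec, inner_matVec, Finset.sum_comm]
  refine Finset.sum_congr rfl fun i _ => Finset.sum_congr rfl fun j _ => ?_
  have := hA.apply i j
  simp only [star_trivial] at this
  rw [this]; ring

namespace IsMetric

variable {U : Set (E d)} {g : E d → Matrix (Fin d) (Fin d) ℝ}

theorem herm (hm : IsMetric U g) {x : E d} (hx : x ∈ U) : (g x).IsHermitian :=
  (hm.pos x hx).isHermitian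

theorem herm_inv (hm : IsMetric U g) {x : E d} (hx : x ∈ U) : (g x)⁻¹.IsHermitian :=
  (hm.pos x hx).inv.isHermitian

theorem inner_pos (hm : IsMetric U g) {x : E d} (hx : x ∈ U) {q : E d} (hq : q ≠ 0) :
    0 < inner ℝ (matVec (g x) q) q := by
  have h1 := (hm.pos x hx).dotProduct_mulVec_pos (x := fun i => q i)
    (by intro h; apply hq; ext i; exact congrFun h i)
  refine h1.trans_eq ?_
  simp [inner_matVec, dotProduct, Matrix.mulVec, Finset.mul_sum, mul_comm, mul_left_comm]

theorem inner_nonneg (hm : IsMetric U g) {x : E d} (hx : x ∈ U) (q : E d) :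
    0 ≤ inner ℝ (matVec (g x) q) q := by
  rcases eq_or_ne q 0 with rfl | hq
  · simp
  · exact (hm.inner_pos hx hq).le

theorem det_pos (hm : IsMetric U g) {x : E d} (hx : x ∈ U) : 0 < (g x).det := (hm.pos x hx).det_pos

theorem mul_inv (hm : IsMetric U g) {x : E d} (hx : x ∈ U) : g x * (g x)⁻¹ = 1 :=
  Matrix.mul_nonsing_inv _ (hm.det_pos hx).ne'.isUnit

/-- By Cramer's rule the entries of the inverse are quotients of polynomials in smooth entries, with
non-vanishing denominator. -/
theorem contDiffOn_inv (hm : IsMetric U g) (i j : Fin d) :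
    ContDiffOn ℝ ∞ (fun x => (g x)⁻¹ i j) U := by
  have hdet : ∀ A : E d → Matrix (Fin d) (Fin d) ℝ, (∀ i j, ContDiffOn ℝ ∞ (fun x => A x i j) U) →
      ContDiffOn ℝ ∞ (fun x => (A x).det) U := by
    intro A hA
    simp only [Matrix.det_apply]
    exact ContDiffOn.sum fun σ _ => (contDiffOn_prod fun i _ => hA _ _).const_smul _
  have h1 : ∀ x, (g x)⁻¹ i j = (g x).det⁻¹ * ((g x).updateRow j (Pi.single i 1)).det := by
    intro x
    rw [Matrix.inv_def, Matrix.smul_apply, Matrix.adjugate_apply, Ring.inverse_eq_inv', smul_eq_mul]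
  simp only [h1]
  refine ((hdet _ hm.smooth).inv fun x hx => (hm.det_pos hx).ne').mul (hdet _ fun k l => ?_)
  by_cases hk : k = j
  · subst hk; simpa using contDiffOn_const
  · simpa [Matrix.updateRow_apply, hk] using hm.smooth k l

/-- Smoothness of a quadratic form with smooth coefficients. -/
theorem _root_.StochGeodesic.contDiffOn_inner_matVec {P : Type*} [NormedAddCommGroup P]
    [NormedSpace ℝ P] {s : Set P} {A : P → Matrix (Fin d) (Fin d) ℝ} {y z : P → E d}
    (hA : ∀ i j, ContDiffOn ℝ ∞ (fun x => A x i j) s) (hy : ContDiffOn ℝ ∞ y s)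
    (hz : ContDiffOn ℝ ∞ z s) : ContDiffOn ℝ ∞ (fun w => inner ℝ (matVec (A w) (y w)) (z w)) s := by
  simp only [inner_matVec]
  refine ContDiffOn.sum fun i _ => ContDiffOn.sum fun j _ => ((hA i j).mul ?_).mul ?_
  · exact (EuclideanSpace.proj (𝕜 := ℝ) j).contDiff.comp_contDiffOn hy
  · exact (EuclideanSpace.proj (𝕜 := ℝ) i).contDiff.comp_contDiffOn hz

/-- The partial gradient of a function along a linear embedding. -/
def _root_.StochGeodesic.partialGradient {P : Type*} [NormedAddCommGroup P] [NormedSpace ℝ P]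
    (ι : E d →L[ℝ] P) (f : P → ℝ) (z : P) : E d :=
  (InnerProductSpace.toDual ℝ (E d)).symm ((fderiv ℝ f z).comp ι)

theorem _root_.StochGeodesic.contDiffOn_partialGradient {P : Type*} [NormedAddCommGroup P]
    [NormedSpace ℝ P] (ι : E d →L[ℝ] P) {f : P → ℝ} {s : Set P} (hs : IsOpen s)
    (hf : ContDiffOn ℝ ∞ f s) : ContDiffOn ℝ ∞ (partialGradient ι f) s := by
  have h1 : ContDiffOn ℝ ∞ (fderiv ℝ f) s := hf.fderiv_of_isOpen hs (by simp)
  have h2 := (((ContinuousLinearMap.compL ℝ (E d) P ℝ).flip ι).contDiff (n := ∞)).comp_contDiffOn h1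
  exact ((InnerProductSpace.toDual ℝ (E d)).symm.contDiff (n := ∞)).comp_contDiffOn h2

/-- The Hamiltonian system is defined by gradients of slices, the other variables being frozen. Read
as components of one total derivative, these gradients are jointly smooth. -/
theorem _root_.StochGeodesic.gradient_eq_partialGradient {P : Type*} [NormedAddCommGroup P]
    [NormedSpace ℝ P] (ι : E d →L[ℝ] P) {f : P → ℝ} {F : E d → P} {x : E d}
    (hF : HasFDerivAt F ι x) (hf : DifferentiableAt ℝ f (F x)) :
    gradient (fun x' => f (F x')) x = partialGradient ι f (F x) := by
  rw [gradient, partialGradient]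
  congr 1
  exact (hf.hasFDerivAt.comp x hF).fderiv

theorem contDiffOn_energy (hm : IsMetric U g) :
    ContDiffOn ℝ ∞ (fun w : E d × E d => energy g w.2 w.1) {w | w.1 ∈ U} :=
  contDiffOn_inner_matVec (fun i j => (hm.contDiffOn_inv i j).comp contDiffOn_fst fun _ h => h)
    contDiffOn_snd contDiffOn_snd

theorem isOpen_fst {P : Type*} [TopologicalSpace P] (hm : IsMetric U g) :
    IsOpen {w : E d × P | w.1 ∈ U} := hm.isOpen.preimage continuous_fst

theorem gradient_energy (hm : IsMetric U g) {w : E d × E d} (hw : w.1 ∈ U) :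
    gradient (energy g w.2) w.1 =
      partialGradient (ContinuousLinearMap.inl ℝ _ _) (fun w : E d × E d => energy g w.2 w.1) w := by
  have h1 : HasFDerivAt (fun x' : E d => (x', w.2)) (ContinuousLinearMap.inl ℝ (E d) (E d)) w.1 :=
    hasFDerivAt_prodMk_left _ _
  exact gradient_eq_partialGradient (F := fun x' => (x', w.2)) _ h1
    ((hm.contDiffOn_energy.contDiffAt (hm.isOpen_fst.mem_nhds hw)).differentiableAt (by simp))

theorem contDiffOn_gradient_energy (hm : IsMetric U g) :
    ContDiffOn ℝ ∞ (fun w : E d × E d => gradient (energy g w.2) w.1) {w | w.1 ∈ U} :=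
  (contDiffOn_partialGradient _ hm.isOpen_fst hm.contDiffOn_energy).congr
    fun _ hw => hm.gradient_energy hw

/-- The Hamiltonian as a function on phase space. -/
def _root_.StochGeodesic.hamiltonFun (g : E d → Matrix (Fin d) (Fin d) ℝ) (z : Phase d) : ℝ :=
  hamiltonian g z.1 z.2.1 z.2.2.1 z.2.2.2

theorem contDiffOn_hamiltonFun (hm : IsMetric U g) :
    ContDiffOn ℝ ∞ (hamiltonFun g) {z | z.1 ∈ U} := by
  have hx : Set.MapsTo (fun z : Phase d => z.1) {z | z.1 ∈ U} U := fun _ h => h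
  refine ((contDiffOn_const.mul (contDiffOn_inner_matVec (A := fun z : Phase d => g z.1)
    (fun i j => (hm.smooth i j).comp contDiffOn_fst hx) (by fun_prop) (by fun_prop))).sub
    (contDiffOn_inner_matVec (A := fun z : Phase d => (g z.1)⁻¹)
      (fun i j => (hm.contDiffOn_inv i j).comp contDiffOn_fst hx)
      (by fun_prop) (by fun_prop))).add (contDiffOn_const.mul (ContDiffOn.inner ℝ ?_ (by fun_prop)))
  exact hm.contDiffOn_gradient_energy.comp (g := fun w : E d × E d => gradient (energy g w.2) w.1)
    (f := fun z : Phase d => (z.1, z.2.1)) (by fun_prop) (fun _ h => h)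

theorem differentiableAt_hamiltonFun (hm : IsMetric U g) {z : Phase d} (hz : z.1 ∈ U) :
    DifferentiableAt ℝ (hamiltonFun g) z :=
  (hm.contDiffOn_hamiltonFun.contDiffAt (hm.isOpen_fst.mem_nhds hz)).differentiableAt (by simp)

/-- The embeddings of the four factors of phase space. -/
def _root_.StochGeodesic.embX : E d →L[ℝ] Phase d := ContinuousLinearMap.inl ℝ _ _
def _root_.StochGeodesic.embY : E d →L[ℝ] Phase d :=
  (ContinuousLinearMap.inr ℝ (E d) _).comp (ContinuousLinearMap.inl ℝ _ _)
def _root_.StochGeodesic.embP : E d →L[ℝ] Phase d :=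
  (ContinuousLinearMap.inr ℝ (E d) _).comp
    ((ContinuousLinearMap.inr ℝ (E d) _).comp (ContinuousLinearMap.inl ℝ _ _))
def _root_.StochGeodesic.embQ : E d →L[ℝ] Phase d :=
  (ContinuousLinearMap.inr ℝ (E d) _).comp
    ((ContinuousLinearMap.inr ℝ (E d) _).comp (ContinuousLinearMap.inr ℝ _ _))

/-- The projections to the four factors of phase space. -/
def _root_.StochGeodesic.prX : Phase d →L[ℝ] E d := ContinuousLinearMap.fst ℝ _ _
def _root_.StochGeodesic.prY : Phase d →L[ℝ] E d :=
  (ContinuousLinearMap.fst ℝ _ _).comp (ContinuousLinearMap.snd ℝ _ _)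
def _root_.StochGeodesic.prP : Phase d →L[ℝ] E d :=
  ((ContinuousLinearMap.fst ℝ _ _).comp (ContinuousLinearMap.snd ℝ _ _)).comp
    (ContinuousLinearMap.snd ℝ _ _)
def _root_.StochGeodesic.prQ : Phase d →L[ℝ] E d :=
  ((ContinuousLinearMap.snd ℝ _ _).comp (ContinuousLinearMap.snd ℝ _ _)).comp
    (ContinuousLinearMap.snd ℝ _ _)

@[simp] theorem _root_.StochGeodesic.prX_apply (z : Phase d) : prX z = z.1 := rfl
@[simp] theorem _root_.StochGeodesic.prY_apply (z : Phase d) : prY z = z.2.1 := rfl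
@[simp] theorem _root_.StochGeodesic.prP_apply (z : Phase d) : prP z = z.2.2.1 := rfl
@[simp] theorem _root_.StochGeodesic.prQ_apply (z : Phase d) : prQ z = z.2.2.2 := rfl

theorem _root_.StochGeodesic.phase_eq_add (w : Phase d) :
    w = embX w.1 + embY w.2.1 + embP w.2.2.1 + embQ w.2.2.2 := by
  simp [embX, embY, embP, embQ]

theorem hamiltonField_eq (hm : IsMetric U g) {z : Phase d} (hz : z.1 ∈ U) :
    hamiltonField g z = (partialGradient embP (hamiltonFun g) z,
      partialGradient embQ (hamiltonFun g) z, -partialGradient embX (hamiltonFun g) z,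
      -partialGradient embY (hamiltonFun g) z) := by
  have hd := hm.differentiableAt_hamiltonFun hz
  obtain ⟨x, y, p, q⟩ := z
  have hX : HasFDerivAt (fun x' : E d => ((x', y, p, q) : Phase d)) embX x :=
    hasFDerivAt_prodMk_left _ _
  have hY : HasFDerivAt (fun y' : E d => ((x, y', p, q) : Phase d)) embY y :=
    (hasFDerivAt_prodMk_right x (y, p, q)).comp y (hasFDerivAt_prodMk_left y (p, q))
  have hP : HasFDerivAt (fun p' : E d => ((x, y, p', q) : Phase d)) embP p :=
    (hasFDerivAt_prodMk_right x (y, p, q)).comp p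
      ((hasFDerivAt_prodMk_right y (p, q)).comp p (hasFDerivAt_prodMk_left p q))
  have hQ : HasFDerivAt (fun q' : E d => ((x, y, p, q') : Phase d)) embQ q :=
    (hasFDerivAt_prodMk_right x (y, p, q)).comp q
      ((hasFDerivAt_prodMk_right y (p, q)).comp q (hasFDerivAt_prodMk_right p q))
  simp only [hamiltonField]
  rw [← gradient_eq_partialGradient (f := hamiltonFun g) _ hP hd,
    ← gradient_eq_partialGradient (f := hamiltonFun g) _ hQ hd,
    ← gradient_eq_partialGradient (f := hamiltonFun g) _ hX hd,
    ← gradient_eq_partialGradient (f := hamiltonFun g) _ hY hd]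
  rfl

theorem contDiffOn_hamiltonField (hm : IsMetric U g) :
    ContDiffOn ℝ ∞ (hamiltonField g) {z | z.1 ∈ U} := by
  have h := fun ι : E d →L[ℝ] Phase d => contDiffOn_partialGradient ι hm.isOpen_fst hm.contDiffOn_hamiltonFun
  exact ((h embP).prodMk ((h embQ).prodMk ((h embX).neg.prodMk (h embY).neg))).congr
    fun z hz => hm.hamiltonField_eq hz

theorem fderiv_hamiltonFun (hm : IsMetric U g) {z : Phase d} (hz : z.1 ∈ U) (w : Phase d) :
    fderiv ℝ (hamiltonFun g) z w =
      inner ℝ (hamiltonField g z).1 w.2.2.1 + inner ℝ (hamiltonField g z).2.1 w.2.2.2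
        - inner ℝ (hamiltonField g z).2.2.1 w.1 - inner ℝ (hamiltonField g z).2.2.2 w.2.1 := by
  rw [hm.hamiltonField_eq hz]
  simp only [partialGradient, inner_neg_left, InnerProductSpace.toDual_symm_apply,
    ContinuousLinearMap.comp_apply, sub_neg_eq_add]
  conv_lhs => rw [phase_eq_add w]
  simp only [map_add]; ring

/-- The Hamiltonian is affine in `p`, so this holds at every point, inside `U` or not. -/
theorem _root_.StochGeodesic.hamiltonField_fst (g : E d → Matrix (Fin d) (Fin d) ℝ)
    (z : Phase d) : (hamiltonField g z).1 = -matVec (g z.1)⁻¹ z.2.1 := by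
  obtain ⟨x, y, p, q⟩ := z
  refine HasGradientAt.gradient ?_
  rw [hasGradientAt_iff_hasFDerivAt]
  have h1 : HasFDerivAt (fun p' : E d => inner ℝ (matVec (g x)⁻¹ y) p')
      (InnerProductSpace.toDual ℝ (E d) (matVec (g x)⁻¹ y)) p :=
    ((InnerProductSpace.toDual ℝ (E d) (matVec (g x)⁻¹ y))).hasFDerivAt
  rw [map_neg]
  exact ((h1.const_sub (1 / 2 * inner ℝ (matVec (g x) q) q)).add_const
    (1 / 2 * inner ℝ (gradient (energy g y) x) q))

theorem hamiltonField_snd (hm : IsMetric U g) {z : Phase d} (hz : z.1 ∈ U) :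
    (hamiltonField g z).2.1 =
      matVec (g z.1) z.2.2.2 + (1 / 2 : ℝ) • gradient (energy g z.2.1) z.1 := by
  obtain ⟨x, y, p, q⟩ := z
  refine HasGradientAt.gradient ?_
  rw [hasGradientAt_iff_hasFDerivAt]
  have h1 : HasFDerivAt (fun q' : E d => inner ℝ (gradient (energy g y) x) q')
      (InnerProductSpace.toDual ℝ (E d) (gradient (energy g y) x)) q :=
    ((InnerProductSpace.toDual ℝ (E d) (gradient (energy g y) x))).hasFDerivAt
  have h2 := ((matVecL (g x)).hasFDerivAt (x := q)).inner ℝ (hasFDerivAt_id (𝕜 := ℝ) q)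
  have h3 := ((h2.const_mul (1 / 2 : ℝ)).sub_const (inner ℝ (matVec (g x)⁻¹ y) p)).add
    (h1.const_mul (1 / 2 : ℝ))
  refine h3.congr_fderiv ?_
  ext w
  have h4 := inner_matVec_comm (hm.herm hz) w q
  simp only [matVecL_apply, id_eq, add_apply, smul_apply,
    ContinuousLinearMap.comp_apply, ContinuousLinearMap.prod_apply, fderivInnerCLM_apply,
    ContinuousLinearMap.id_apply, InnerProductSpace.toDual_apply_apply, smul_eq_mul, map_add, map_smul]
  simp only [matVecL_apply] at *
  simp [h4]
  ring

/-- Terms of `H` that are linear in the momenta drop out of `p H_p + q H_q - H`, and only the part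
quadratic in `q` survives. In particular the action is never negative. -/
theorem lagrangian_eq (hm : IsMetric U g) {z : Phase d} (hz : z.1 ∈ U) :
    lagrangian g z = 1 / 2 * inner ℝ (matVec (g z.1) z.2.2.2) z.2.2.2 := by
  have h1 := hamiltonField_fst g z
  have h2 := hm.hamiltonField_snd hz
  obtain ⟨x, y, p, q⟩ := z
  simp only [lagrangian, hamiltonian]
  rw [h1, h2]
  simp only [inner_neg_right, inner_add_right, inner_smul_right]
  rw [real_inner_comm p, real_inner_comm q, real_inner_comm q]
  ring

theorem contDiffOn_lagrangian (hm : IsMetric U g) :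
    ContDiffOn ℝ ∞ (lagrangian g) {z | z.1 ∈ U} :=
  (contDiffOn_const.mul (contDiffOn_inner_matVec (A := fun z : Phase d => g z.1)
    (fun i j => (hm.smooth i j).comp contDiffOn_fst fun _ h => h)
      (by fun_prop) (by fun_prop))).congr fun _ hz => hm.lagrangian_eq hz

theorem lagrangian_eq_sub (g : E d → Matrix (Fin d) (Fin d) ℝ) (z : Phase d) :
    lagrangian g z = inner ℝ z.2.2.1 (hamiltonField g z).1 + inner ℝ z.2.2.2 (hamiltonField g z).2.1
      - hamiltonFun g z := rfl

end IsMetric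

/-! ### Homogeneity -/

/-- The weighted dilations of phase space under which the Hamiltonian is homogeneous. -/
def dilation (l : ℝ) : Phase d →L[ℝ] Phase d :=
  (ContinuousLinearMap.id ℝ (E d)).prodMap ((l • ContinuousLinearMap.id ℝ (E d)).prodMap
    ((l ^ 3 • ContinuousLinearMap.id ℝ (E d)).prodMap (l ^ 2 • ContinuousLinearMap.id ℝ (E d))))

@[simp] theorem dilation_apply (l : ℝ) (z : Phase d) :
    dilation l z = (z.1, l • z.2.1, l ^ 3 • z.2.2.1, l ^ 2 • z.2.2.2) := rfl

theorem dilation_dilation (l m : ℝ) (z : Phase d) :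
    dilation l (dilation m z) = dilation (l * m) z := by
  simp [smul_smul, mul_pow]

theorem dilation_one (z : Phase d) : dilation 1 z = z := by simp

theorem dilation_inv_dilation {l : ℝ} (hl : l ≠ 0) (z : Phase d) :
    dilation l⁻¹ (dilation l z) = z := by
  rw [dilation_dilation, inv_mul_cancel₀ hl, dilation_one]

theorem dilation_dilation_inv {l : ℝ} (hl : l ≠ 0) (z : Phase d) :
    dilation l (dilation l⁻¹ z) = z := by
  rw [dilation_dilation, mul_inv_cancel₀ hl, dilation_one]

variable (g : E d → Matrix (Fin d) (Fin d) ℝ)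

theorem gradient_const_smul (c : ℝ) (f : E d → ℝ) (x : E d) :
    gradient (fun x' => c * f x') x = c • gradient f x := by
  have : (fun x' => c * f x') = c • f := rfl
  rw [gradient, gradient, this, fderiv_const_smul_field]
  simp

theorem gradient_comp_smul (c : ℝ) (f : E d → ℝ) (x : E d) :
    gradient (fun x' => f (c • x')) x = c • gradient f (c • x) := by
  rw [gradient, gradient, fderiv_comp_smul]
  simp

theorem energy_smul (l : ℝ) (y x : E d) : energy g (l • y) x = l ^ 2 * energy g y x := by
  simp only [energy, matVec_smul, inner_smul_left, inner_smul_right]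
  simp; ring

/-- The three terms of `H` have degrees `2 + 2`, `1 + 3` and `2 + 2`. -/
theorem hamiltonian_dilation (l : ℝ) (x y p q : E d) :
    hamiltonian g x (l • y) (l ^ 3 • p) (l ^ 2 • q) = l ^ 4 * hamiltonian g x y p q := by
  have h : energy g (l • y) = fun x' => l ^ 2 * energy g y x' := funext fun x' => energy_smul g l y x'
  simp only [hamiltonian, h, gradient_const_smul, matVec_smul, inner_smul_left, inner_smul_right]
  simp; ring

theorem gradient_of_homogeneous {f k : E d → ℝ} {l : ℝ} (hl : l ≠ 0) {m n : ℕ} (x : E d)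
    (h : ∀ x', f (l ^ m • x') = l ^ (m + n) * k x') :
    gradient f (l ^ m • x) = l ^ n • gradient k x := by
  have h1 := gradient_comp_smul (l ^ m) f x
  simp only [h] at h1
  rw [gradient_const_smul, pow_add, mul_smul] at h1
  exact (smul_right_injective _ (pow_ne_zero m hl) h1).symm

/-- A derivative of `H` in a variable of weight `m` has weight `4 - m`, while the conjugate variable
has weight `3 - m`. The excess of 1 is the extra factor `l`, that is, the change of the time scale.
-/
theorem hamiltonField_dilation {l : ℝ} (hl : l ≠ 0) (z : Phase d) :
    hamiltonField g (dilation l z) = l • dilation l (hamiltonField g z) := by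
  obtain ⟨x, y, p, q⟩ := z
  have h := fun x y p q => hamiltonian_dilation g l x y p q
  simp only [dilation_apply, hamiltonField, Prod.smul_mk, smul_smul]
  refine Prod.ext ?_ (Prod.ext ?_ (Prod.ext ?_ ?_))
  · have := gradient_of_homogeneous
      (f := fun p' => hamiltonian g x (l • y) p' (l ^ 2 • q)) (k := fun p' => hamiltonian g x y p' q)
      (m := 3) (n := 1) hl p fun p' => h x y p' q
    simpa using this
  · have := gradient_of_homogeneous
      (f := fun q' => hamiltonian g x (l • y) (l ^ 3 • p) q') (k := fun q' => hamiltonian g x y p q')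
      (m := 2) (n := 2) hl q fun q' => h x y p q'
    simpa [pow_succ] using this
  · simp only [h, gradient_const_smul, smul_neg]
    congr 2; ring
  · have := gradient_of_homogeneous
      (f := fun y' => hamiltonian g x y' (l ^ 3 • p) (l ^ 2 • q))
      (k := fun y' => hamiltonian g x y' p q) (m := 1) (n := 3) (l := l) hl y fun y' => by
      simpa using h x y' p q
    simp only [pow_one] at this
    simp only [this, smul_neg]
    congr 2; ring

variable {g}

theorem IsMetric.lagrangian_dilation {U : Set (E d)} (hm : IsMetric U g) (l : ℝ) {z : Phase d}
    (hz : z.1 ∈ U) : lagrangian g (dilation l z) = l ^ 4 * lagrangian g z := by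
  rw [hm.lagrangian_eq hz, hm.lagrangian_eq (z := dilation l z) hz]
  simp only [dilation_apply, matVec_smul, inner_smul_left, inner_smul_right]
  simp; ring

theorem eq_zero_of_pow_smul {l : ℝ} (h1 : l ≠ 1) {v : E d} (h : l • v = v) : v = 0 := by
  have : (l - 1) • v = 0 := by rw [sub_smul, h, one_smul, sub_self]
  exact (smul_eq_zero.1 this).resolve_left (sub_ne_zero.2 h1)

/-- The point is fixed by dilations, so the components of the field there are invariant under
multiplication by 2, 4, 16 and 8 respectively. -/
theorem hamiltonField_zero (x : E d) : hamiltonField g (x, 0, 0, 0) = 0 := by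
  have h := hamiltonField_dilation g (l := 2) two_ne_zero (x, 0, 0, 0)
  have h0 : dilation 2 ((x, 0, 0, 0) : Phase d) = (x, 0, 0, 0) := by simp
  rw [h0] at h
  generalize hamiltonField g (x, 0, 0, 0) = v at *
  obtain ⟨a, b, c, e⟩ := v
  simp only [dilation_apply, Prod.smul_mk, smul_smul, Prod.mk.injEq] at h
  obtain ⟨h1, h2, h3, h4⟩ := h
  simp [eq_zero_of_pow_smul (by norm_num) h1.symm, eq_zero_of_pow_smul (by norm_num) h2.symm,
    eq_zero_of_pow_smul (by norm_num) h3.symm, eq_zero_of_pow_smul (by norm_num) h4.symm]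

/-- Homogeneity spares a computation of second derivatives of `H`: it leaves only the blocks from a
variable of weight `k` to one of weight `k - 1`, namely `y` to `x`, `q` to `y` and `p` to `q`. These
three are read off along lines on which the field is linear. -/
theorem IsMetric.fderiv_hamiltonField_zero {U : Set (E d)} (hm : IsMetric U g) {x : E d}
    (hx : x ∈ U) (w : Phase d) : fderiv ℝ (hamiltonField g) (x, 0, 0, 0) w =
      (-matVec (g x)⁻¹ w.2.1, matVec (g x) w.2.2.2, 0, matVec (g x)⁻¹ w.2.2.1) := by
  set z : Phase d := (x, 0, 0, 0) with hz
  have hd : HasFDerivAt (hamiltonField g) (fderiv ℝ (hamiltonField g) z) z :=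
    ((hm.contDiffOn_hamiltonField.contDiffAt
      (hm.isOpen_fst.mem_nhds (show z.1 ∈ U from hx))).differentiableAt (by simp)).hasFDerivAt
  set D := fderiv ℝ (hamiltonField g) z with hD
  -- On a vector of weight `k` and in a component of weight `m` this says `2^k v = 2^(m+1) v`, so `v
  -- = 0` unless `k = m + 1`.
  have hhom : ∀ w, D (dilation 2 w) = (2 : ℝ) • dilation 2 (D w) := by
    intro w
    have h1 : HasFDerivAt (fun z => hamiltonField g (dilation 2 z)) (D.comp (dilation 2)) z := by
      have h0 : dilation 2 z = z := by simp [hz]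
      exact HasFDerivAt.comp (g := hamiltonField g) z (by rwa [h0]) (dilation 2).hasFDerivAt
    have h2 : HasFDerivAt (fun z => hamiltonField g (dilation 2 z))
        ((2 : ℝ) • (dilation 2).comp D) z := by
      simp only [hamiltonField_dilation g (two_ne_zero (α := ℝ))]
      exact ((dilation 2).hasFDerivAt.comp z hd).const_smul (2 : ℝ)
    exact congrArg (fun T : Phase d →L[ℝ] Phase d => T w) (h1.unique h2)
  have hline : ∀ w, HasDerivAt (fun s : ℝ => hamiltonField g (z + s • w)) (D w) 0 := by
    intro w
    have h1 : HasDerivAt (fun s : ℝ => z + s • w) w 0 := by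
      simpa using ((hasDerivAt_id (0 : ℝ)).smul_const w).const_add z
    exact HasFDerivAt.comp_hasDerivAt (0 : ℝ) (by simpa using hd) h1
  have hlin : ∀ v : E d, HasDerivAt (fun s : ℝ => s • v) v 0 := fun v => by
    simpa using (hasDerivAt_id (0 : ℝ)).smul_const v
  have hX : D (embX w.1) = 0 := by
    have h := hhom (embX w.1)
    have h0 : dilation 2 (embX w.1) = embX w.1 := by simp [embX]
    rw [h0] at h
    generalize D (embX w.1) = v at *
    obtain ⟨a, b, c, e⟩ := v
    simp only [dilation_apply, Prod.smul_mk, smul_smul, Prod.mk.injEq] at h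
    obtain ⟨h1, h2, h3, h4⟩ := h
    simp [eq_zero_of_pow_smul (by norm_num) h1.symm, eq_zero_of_pow_smul (by norm_num) h2.symm,
      eq_zero_of_pow_smul (by norm_num) h3.symm, eq_zero_of_pow_smul (by norm_num) h4.symm]
  have hY : D (embY w.2.1) = (-matVec (g x)⁻¹ w.2.1, 0, 0, 0) := by
    have h := hhom (embY w.2.1)
    have h0 : dilation 2 (embY w.2.1) = (2 : ℝ) • embY w.2.1 := by simp [embY]
    rw [h0, map_smul] at h
    replace h := smul_right_injective _ two_ne_zero h
    have h5 : (D (embY w.2.1)).1 = -matVec (g x)⁻¹ w.2.1 := by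
      refine (prX.hasFDerivAt.comp_hasDerivAt (0 : ℝ) (hline (embY w.2.1))).unique ?_
      simp only [Function.comp_def, prX_apply, hamiltonField_fst]
      simpa [embY, hz, matVec_smul] using (hlin (matVec (g x)⁻¹ w.2.1)).fun_neg
    generalize D (embY w.2.1) = v at *
    obtain ⟨a, b, c, e⟩ := v
    simp only [dilation_apply, Prod.mk.injEq] at h h5
    obtain ⟨h1, h2, h3, h4⟩ := h
    simp [h5, eq_zero_of_pow_smul (by norm_num) h2.symm,
      eq_zero_of_pow_smul (by norm_num) h3.symm, eq_zero_of_pow_smul (by norm_num) h4.symm]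
  have hQ : D (embQ w.2.2.2) = (0, matVec (g x) w.2.2.2, 0, 0) := by
    have h := hhom (embQ w.2.2.2)
    have h0 : dilation 2 (embQ w.2.2.2) = (2 : ℝ) • (2 : ℝ) • embQ w.2.2.2 := by
      simp [embQ, smul_smul]; norm_num
    rw [h0, map_smul] at h
    replace h := smul_right_injective _ two_ne_zero h
    rw [map_smul] at h
    have h5 : (D (embQ w.2.2.2)).2.1 = matVec (g x) w.2.2.2 := by
      refine (prY.hasFDerivAt.comp_hasDerivAt (0 : ℝ) (hline (embQ w.2.2.2))).unique ?_
      have h6 : ∀ s : ℝ, (hamiltonField g (z + s • embQ w.2.2.2)).2.1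
          = s • matVec (g x) w.2.2.2 := by
        intro s
        rw [hm.hamiltonField_snd (by simpa [hz, embQ] using hx)]
        have h7 : energy g 0 = fun x => 0 * energy g 0 x := by
          funext x; simp [energy]
        have h8 : gradient (energy g 0) x = 0 := by
          rw [h7, gradient_const_smul, zero_smul]
        simp [hz, embQ, matVec_smul, h8]
      simp only [Function.comp_def, prY_apply, h6]
      exact hlin _
    generalize D (embQ w.2.2.2) = v at *
    obtain ⟨a, b, c, e⟩ := v
    simp only [dilation_apply, Prod.smul_mk, Prod.mk.injEq] at h h5
    obtain ⟨h1, h2, h3, h4⟩ := h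
    have h3' : (4 : ℝ) • c = c := by
      have := congrArg (fun v => (2⁻¹ : ℝ) • v) h3
      simp only [smul_smul] at this
      norm_num at this; exact this.symm
    have h4' : (2 : ℝ) • e = e := by
      have := congrArg (fun v => (2⁻¹ : ℝ) • v) h4
      simp only [smul_smul] at this
      norm_num at this; exact this.symm
    simp [h5, eq_zero_of_pow_smul (by norm_num) h1,
      eq_zero_of_pow_smul (by norm_num) h3', eq_zero_of_pow_smul (by norm_num) h4']
  have hP : D (embP w.2.2.1) = (0, 0, 0, matVec (g x)⁻¹ w.2.2.1) := by
    have h := hhom (embP w.2.2.1)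
    have h0 : dilation 2 (embP w.2.2.1) = (2 : ℝ) • (4 : ℝ) • embP w.2.2.1 := by
      simp [embP, smul_smul]; norm_num
    rw [h0, map_smul] at h
    replace h := smul_right_injective _ two_ne_zero h
    rw [map_smul] at h
    have h5 : (D (embP w.2.2.1)).2.2.2 = matVec (g x)⁻¹ w.2.2.1 := by
      refine (prQ.hasFDerivAt.comp_hasDerivAt (0 : ℝ) (hline (embP w.2.2.1))).unique ?_
      have h6 : ∀ s : ℝ, (hamiltonField g (z + s • embP w.2.2.1)).2.2.2
          = s • matVec (g x)⁻¹ w.2.2.1 := by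
        intro s
        have h7 : z + s • embP w.2.2.1 = (x, 0, s • w.2.2.1, 0) := by simp [hz, embP]
        rw [h7]
        simp only [hamiltonField]
        rw [neg_eq_iff_eq_neg]
        refine HasGradientAt.gradient ?_
        rw [hasGradientAt_iff_hasFDerivAt]
        have h8 : HasFDerivAt (fun y' : E d => inner ℝ (matVec (g x)⁻¹ (s • w.2.2.1)) y')
            (InnerProductSpace.toDual ℝ (E d) (matVec (g x)⁻¹ (s • w.2.2.1))) 0 :=
          ((InnerProductSpace.toDual ℝ (E d) (matVec (g x)⁻¹ (s • w.2.2.1)))).hasFDerivAt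
        rw [← matVec_smul]
        have h9 : (fun y' => hamiltonian g x y' (s • w.2.2.1) 0) =
            fun y' => -inner ℝ (matVec (g x)⁻¹ (s • w.2.2.1)) y' := by
          funext y'
          rw [inner_matVec_comm (hm.herm_inv hx)]
          simp [hamiltonian]
        rw [h9, map_neg]
        exact h8.neg
      simp only [Function.comp_def, prQ_apply, h6]
      exact hlin _
    generalize D (embP w.2.2.1) = v at *
    obtain ⟨a, b, c, e⟩ := v
    simp only [dilation_apply, Prod.smul_mk, Prod.mk.injEq] at h h5
    obtain ⟨h1, h2, h3, h4⟩ := h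
    have h2' : (2 : ℝ) • b = b := by
      have := congrArg (fun v => (2⁻¹ : ℝ) • v) h2
      simp only [smul_smul] at this
      norm_num at this; exact this
    have h3' : (2 : ℝ) • c = c := by
      have := congrArg (fun v => (4⁻¹ : ℝ) • v) h3
      simp only [smul_smul] at this
      norm_num at this; exact this.symm
    simp [h5, eq_zero_of_pow_smul (by norm_num) h1,
      eq_zero_of_pow_smul (by norm_num) h2', eq_zero_of_pow_smul (by norm_num) h3']
  conv_lhs => rw [phase_eq_add w]
  rw [map_add, map_add, map_add, hX, hY, hP, hQ]
  simp

/-! ### Characteristics -/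

section Characteristics

variable {U : Set (E d)} {g : E d → Matrix (Fin d) (Fin d) ℝ} {t : ℝ} {z : Phase d}
  {γ δ : ℝ → Phase d}

theorem IsCharacteristic.eqOn (hm : IsMetric U g) (hγ : IsCharacteristic g U t z γ)
    (hδ : IsCharacteristic g U t z δ) : Set.EqOn γ δ (Set.Icc 0 t) :=
  solution_unique hm.isOpen_fst (hm.contDiffOn_hamiltonField.of_le (by simp)) hγ.2 hδ.2
    (hγ.1.trans hδ.1.symm)

theorem IsCharacteristic.mono (hγ : IsCharacteristic g U t z γ) {s : ℝ} (hs : s ≤ t) :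
    IsCharacteristic g U s z γ :=
  ⟨hγ.1, fun r hr => ⟨(hγ.2 r ⟨hr.1, hr.2.trans hs⟩).1,
    (hγ.2 r ⟨hr.1, hr.2.trans hs⟩).2.mono (Set.Icc_subset_Icc_right hs)⟩⟩

theorem IsCharacteristic.dilate (hγ : IsCharacteristic g U t z γ) {l : ℝ} (hl : 0 < l) :
    IsCharacteristic g U (t / l) (dilation l z) (fun s => dilation l (γ (l * s))) := by
  refine ⟨by simp [hγ.1], fun s hs => ?_⟩
  have hmem : ∀ r ∈ Set.Icc 0 (t / l), l * r ∈ Set.Icc 0 t := fun r hr =>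
    ⟨mul_nonneg hl.le hr.1, by rw [mul_comm]; exact (le_div_iff₀ hl).1 hr.2⟩
  obtain ⟨h1, h2⟩ := hγ.2 (l * s) (hmem s hs)
  refine ⟨h1, ?_⟩
  have h3 : HasDerivWithinAt (fun r : ℝ => l * r) l (Set.Icc 0 (t / l)) s := by
    simpa using ((hasDerivAt_id s).const_mul l).hasDerivWithinAt
  have h4 := h2.scomp s h3 hmem
  have h5 := (dilation l).hasFDerivAt.comp_hasDerivWithinAt s h4
  rw [hamiltonField_dilation g hl.ne', ← map_smul]
  exact h5

theorem isCharacteristic_characteristic (hγ : IsCharacteristic g U t z γ) :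
    IsCharacteristic g U t z (characteristic g U t z) :=
  Classical.epsilon_spec (p := IsCharacteristic g U t z) ⟨γ, hγ⟩

/-- Uniqueness makes the arbitrary choice in `characteristic` harmless on the time interval, the
only place where it is evaluated. -/
theorem IsCharacteristic.characteristic_eqOn (hm : IsMetric U g)
    (hγ : IsCharacteristic g U t z γ) : Set.EqOn (characteristic g U t z) γ (Set.Icc 0 t) :=
  (isCharacteristic_characteristic hγ).eqOn hm hγ

end Characteristics

/-! ### The flow over the unit time interval -/

/-- A smooth function of compact support that is `1` near a compact set. -/
theorem exists_cutoff {F : Type*} [NormedAddCommGroup F] [NormedSpace ℝ F] [FiniteDimensional ℝ F]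
    {C Ω : Set F} (hC : IsCompact C) (hΩ : IsOpen Ω) (hCΩ : C ⊆ Ω) :
    ∃ ψ : F → ℝ, ContDiff ℝ ∞ ψ ∧ HasCompactSupport ψ ∧ tsupport ψ ⊆ Ω ∧
      ∃ O, IsOpen O ∧ C ⊆ O ∧ O ⊆ Ω ∧ ∀ z ∈ O, ψ z = 1 := by
  obtain ⟨C₁, hC₁, hCC₁, hC₁Ω⟩ := exists_compact_between hC hΩ hCΩ
  obtain ⟨C₂, hC₂, hC₁C₂, hC₂Ω⟩ := exists_compact_between hC₁ hΩ hC₁Ω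
  obtain ⟨ψ, h1, h2, -⟩ := exists_contMDiffMap_one_nhds_of_subset_interior (n := ⊤)
    (modelWithCornersSelf ℝ F) hC₁.isClosed hC₁C₂
  have hsupp : Function.support ψ ⊆ C₂ := fun z hz => by
    by_contra h; exact hz (h2 z h)
  have hts : tsupport ψ ⊆ C₂ := closure_minimal hsupp hC₂.isClosed
  refine ⟨ψ, ψ.contMDiff.contDiff, hC₂.of_isClosed_subset (isClosed_tsupport _) hts,
    hts.trans hC₂Ω, interior C₁, isOpen_interior, hCC₁, interior_subset.trans hC₁Ω, fun z hz => ?_⟩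
  exact (Filter.Eventually.self_of_nhdsSet h1) z (interior_subset hz)

theorem contDiff_smul_of_tsupport_subset {F G : Type*} [NormedAddCommGroup F] [NormedSpace ℝ F]
    [NormedAddCommGroup G] [NormedSpace ℝ G] {Ω : Set F} {ψ : F → ℝ} {f : F → G}
    (hΩ : IsOpen Ω) (hψ : ContDiff ℝ ∞ ψ) (hs : tsupport ψ ⊆ Ω) (hf : ContDiffOn ℝ ∞ f Ω) :
    ContDiff ℝ ∞ (fun z => ψ z • f z) := by
  rw [contDiff_iff_contDiffAt]
  intro z
  by_cases hz : z ∈ tsupport ψ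
  · exact hψ.contDiffAt.smul (hf.contDiffAt (hΩ.mem_nhds (hs hz)))
  · refine (contDiffAt_const (c := (0 : G))).congr_of_eventuallyEq ?_
    filter_upwards [notMem_tsupport_iff_eventuallyEq.1 hz] with w hw
    simp [hw]

/-- A smooth family of curves on the unit interval that solves the Hamiltonian system as long as
it stays in a neighbourhood `dom` of the zero section over `K`. -/
structure UnitFlow (U : Set (E d)) (g : E d → Matrix (Fin d) (Fin d) ℝ) (K : Set (E d)) where
  field : C(Phase d, Phase d)
  lagr : C(Phase d, ℝ)
  dom : Set (Phase d)
  flow : Phase d → C(unitInterval, Phase d)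
  field_smooth : ContDiff ℝ ∞ field
  lagr_smooth : ContDiff ℝ ∞ lagr
  flow_smooth : ContDiff ℝ ∞ flow
  dom_open : IsOpen dom
  dom_subset : ∀ z ∈ dom, z.1 ∈ U
  field_eq : ∀ z ∈ dom, field z = hamiltonField g z
  lagr_eq : ∀ z ∈ dom, lagr z = lagrangian g z
  base_mem : ∀ x ∈ K, (x, 0, 0, 0) ∈ dom
  flow_base : ∀ x ∈ K, flow (x, 0, 0, 0) = ContinuousMap.const _ (x, 0, 0, 0)
  flow_eq : ∀ z, flow z = ContinuousMap.const _ z + volterra (field.comp (flow z))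

theorem comp_volterra {F G : Type*} [NormedAddCommGroup F] [NormedSpace ℝ F] [CompleteSpace F]
    [NormedAddCommGroup G] [NormedSpace ℝ G] [CompleteSpace G] (A : F →L[ℝ] G)
    (γ : C(unitInterval, F)) :
    (A : C(F, G)).comp (volterra γ) = volterra ((A : C(F, G)).comp γ) := by
  ext σ
  simp only [ContinuousMap.comp_apply, volterra_apply]
  exact (A.intervalIntegral_comp_comm ((continuous_IccExtend γ).intervalIntegrable _ _)).symm

/-- After multiplication by a cut-off function near the zero section over `K` the field is globally
Lipschitz, and the contraction argument solves it up to a short time `l`. The dilation by `l` turns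
this time into the unit of time, at the price of a smaller domain in phase space. -/
theorem IsMetric.nonempty_unitFlow {U : Set (E d)} {g : E d → Matrix (Fin d) (Fin d) ℝ}
    (hm : IsMetric U g) {K : Set (E d)} (hK : IsCompact K) (hKU : K ⊆ U) :
    Nonempty (UnitFlow U g K) := by
  have hC : IsCompact ((embX : E d →L[ℝ] Phase d) '' K) := hK.image embX.continuous
  obtain ⟨ψ, hψ, hψc, hψs, O, hO, hKO, hOU, hψ1⟩ := exists_cutoff hC
    (hm.isOpen_fst (P := E d × E d × E d)) (by rintro _ ⟨x, hx, rfl⟩; exact hKU hx)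
  have hV := contDiff_smul_of_tsupport_subset hm.isOpen_fst hψ hψs hm.contDiffOn_hamiltonField
  have hVc : HasCompactSupport (fun z => ψ z • hamiltonField g z) := hψc.smul_right
  obtain ⟨L, hL⟩ := ContDiff.lipschitzWith_of_hasCompactSupport hVc hV (by simp)
  obtain ⟨l, hl, hlL⟩ : ∃ l : NNReal, 0 < l ∧ l * L < 1 := by
    refine ⟨(L + 1)⁻¹, by positivity, ?_⟩
    rw [inv_mul_lt_iff₀ (by positivity), mul_one]
    exact lt_add_one L
  have hl' : (l : ℝ) ≠ 0 := by exact_mod_cast hl.ne'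
  set V : C(Phase d, Phase d) := ⟨fun z => ψ z • hamiltonField g z, hV.continuous⟩ with hVdef
  obtain ⟨Γ, hΓ, hΓeq, hΓu⟩ := exists_smooth_flow V hV hL hlL
  set Dl : Phase d →L[ℝ] Phase d := dilation (l : ℝ) with hDl
  set Di : Phase d →L[ℝ] Phase d := dilation (l : ℝ)⁻¹ with hDi
  have hDlDi : ∀ z, Dl (Di z) = z := dilation_dilation_inv hl'
  have hDiDl : ∀ z, Di (Dl z) = z := dilation_inv_dilation hl'
  have hLag := (contDiff_smul_of_tsupport_subset hm.isOpen_fst hψ hψs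
    hm.contDiffOn_lagrangian).const_smul ((l : ℝ) ^ 4) |>.comp Di.contDiff
  -- Where the cut-off function is 1, the homogeneity of the field identifies this conjugated field
  -- with the Hamiltonian field itself.
  set W : C(Phase d, Phase d) := ⟨fun z => (l : ℝ) • Dl (V (Di z)), by fun_prop⟩ with hW
  have hbase : ∀ x : E d, Di (x, 0, 0, 0) = (x, 0, 0, 0) := by intro x; simp [hDi]
  refine ⟨⟨W, ⟨_, hLag.continuous⟩, Di ⁻¹' O, fun z => (Dl : C(Phase d, Phase d)).comp (Γ (Di z)),
    ?_, hLag, ?_, hO.preimage Di.continuous, ?_, ?_, ?_, ?_, ?_, ?_⟩⟩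
  · exact (Dl.contDiff.comp (hV.comp Di.contDiff)).const_smul (l : ℝ)
  · exact (contDiff_comp_continuousMap (Dl : C(Phase d, Phase d)) Dl.contDiff).comp
      (hΓ.comp Di.contDiff)
  · intro z hz; exact (hOU (show Di z ∈ O from hz) : (Di z).1 ∈ U)
  · intro z hz
    simp only [hW, hVdef, ContinuousMap.coe_mk, hψ1 _ hz, one_smul]
    rw [← hamiltonField_dilation g hl', ← hDl, hDlDi]
  · intro z hz
    simp only [Function.comp_apply, ContinuousMap.coe_mk, hψ1 _ hz, one_mul, smul_eq_mul]
    rw [← hm.lagrangian_dilation _ (hOU (show Di z ∈ O from hz)), ← hDl, hDlDi]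
  · intro x hx
    rw [Set.mem_preimage, hbase]
    exact hKO ⟨x, hx, rfl⟩
  · intro x hx
    -- The field vanishes on the zero section, so the constant curve solves the integral equation,
    -- and solutions are unique.
    have h1 : Γ (x, 0, 0, 0) = ContinuousMap.const _ (x, 0, 0, 0) := by
      refine (hΓu _ _ ?_).symm
      have h2 : V.comp (ContinuousMap.const unitInterval ((x, 0, 0, 0) : Phase d)) = 0 := by
        ext1 s
        change ψ (x, 0, 0, 0) • hamiltonField g (x, 0, 0, 0) = 0
        rw [hamiltonField_zero, smul_zero]
      rw [h2, map_zero, smul_zero, add_zero]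
    rw [hbase, h1]
    ext1 s
    change Dl (x, 0, 0, 0) = _
    simp [hDl]
  · intro z
    have h1 : W.comp ((Dl : C(Phase d, Phase d)).comp (Γ (Di z))) =
        (Dl : C(Phase d, Phase d)).comp ((l : ℝ) • V.comp (Γ (Di z))) := by
      ext1 s
      change (l : ℝ) • Dl (V (Di (Dl (Γ (Di z) s)))) = Dl ((l : ℝ) • V (Γ (Di z) s))
      rw [hDiDl, map_smul]
    rw [h1, ← comp_volterra, map_smul]
    ext1 s
    have h2 := congrArg (fun γ : C(unitInterval, Phase d) => Dl (γ s)) (hΓeq (Di z))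
    simp only [ContinuousMap.add_apply, ContinuousMap.const_apply, map_add, hDlDi] at h2
    exact h2

namespace UnitFlow

variable {U : Set (E d)} {g : E d → Matrix (Fin d) (Fin d) ℝ} {K : Set (E d)} (Φ : UnitFlow U g K)

/-- The initial values whose curves stay in the domain. -/
def good : Set (Phase d) := {z | ∀ σ, Φ.flow z σ ∈ Φ.dom}

theorem isOpen_good : IsOpen Φ.good := by
  have h : IsOpen {γ : C(unitInterval, Phase d) | Set.MapsTo γ Set.univ Φ.dom} :=
    ContinuousMap.isOpen_setOfPred_mapsTo isCompact_univ Φ.dom_open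
  have h2 : Φ.good = Φ.flow ⁻¹' {γ : C(unitInterval, Phase d) | Set.MapsTo γ Set.univ Φ.dom} :=
    Set.ext fun z => ⟨fun h s _ => h s, fun h s => h (Set.mem_univ s)⟩
  rw [h2]
  exact h.preimage Φ.flow_smooth.continuous

theorem base_mem_good {x : E d} (hx : x ∈ K) : (x, 0, 0, 0) ∈ Φ.good := by
  intro σ; rw [Φ.flow_base x hx]; exact Φ.base_mem x hx

/-- The curve starting at `z`. -/
def curve (z : Phase d) : ℝ → Phase d := Set.IccExtend zero_le_one (Φ.flow z)

/-- The end of the curve starting at `z`. -/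
def endVal (z : Phase d) : Phase d := Φ.flow z 1

/-- The action of the curve starting at `z`. -/
def action (z : Phase d) : ℝ := volterra (Φ.lagr.comp (Φ.flow z)) 1

/-- The derivative of the curve in the direction `w` of initial values. -/
def variation (z w : Phase d) : C(unitInterval, Phase d) := fderiv ℝ Φ.flow z w

theorem _root_.StochGeodesic.hasDerivWithinAt_IccExtend {F : Type*} [NormedAddCommGroup F]
    [NormedSpace ℝ F] [CompleteSpace F] {γ δ : C(unitInterval, F)} {z : F}
    (h : γ = ContinuousMap.const _ z + volterra δ) {s : ℝ} (hs : s ∈ Set.Icc (0 : ℝ) 1) :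
    HasDerivWithinAt (Set.IccExtend zero_le_one γ : ℝ → F)
      ((Set.IccExtend zero_le_one δ : ℝ → F) s) (Set.Icc 0 1) s := by
  have h1 := ((hasDerivAt_volterra δ s).const_add z).hasDerivWithinAt (s := Set.Icc 0 1)
  have h2 : ∀ r ∈ Set.Icc (0 : ℝ) 1, (Set.IccExtend zero_le_one γ : ℝ → F) r =
      z + ∫ s in (0 : ℝ)..r, Set.IccExtend zero_le_one δ s := by
    intro r hr
    rw [Set.IccExtend_of_mem _ _ hr, h]
    rfl
  exact h1.congr h2 (h2 s hs)

theorem curve_zero (z : Phase d) : Φ.curve z 0 = z := by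
  rw [curve, Set.IccExtend_of_mem _ _ (by simp : (0 : ℝ) ∈ Set.Icc (0 : ℝ) 1), Φ.flow_eq]
  simp [volterra_apply]

theorem curve_one (z : Phase d) : Φ.curve z 1 = Φ.endVal z := by
  rw [curve, Set.IccExtend_of_mem _ _ (by simp : (1 : ℝ) ∈ Set.Icc (0 : ℝ) 1)]
  rfl

variable {Φ}

theorem curve_mem_dom {z : Phase d} (hz : z ∈ Φ.good) (s : ℝ) : Φ.curve z s ∈ Φ.dom := hz _

theorem isCharacteristic_curve {z : Phase d} (hz : z ∈ Φ.good) :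
    IsCharacteristic g U 1 z (Φ.curve z) := by
  refine ⟨Φ.curve_zero z, fun s hs => ⟨Φ.dom_subset _ (curve_mem_dom hz s), ?_⟩⟩
  have h := hasDerivWithinAt_IccExtend (Φ.flow_eq z) hs
  rw [← Φ.field_eq _ (curve_mem_dom hz s)]
  exact h

theorem contDiff_endVal : ContDiff ℝ ∞ Φ.endVal :=
  ((ContinuousMap.evalCLM ℝ (1 : unitInterval) :
    C(unitInterval, Phase d) →L[ℝ] Phase d).contDiff (n := ∞)).comp Φ.flow_smooth

theorem contDiff_action : ContDiff ℝ ∞ Φ.action :=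
  ((ContinuousMap.evalCLM ℝ (1 : unitInterval) :
    C(unitInterval, ℝ) →L[ℝ] ℝ).contDiff (n := ∞)).comp
    ((volterra (F := ℝ)).contDiff.comp
      ((contDiff_comp_continuousMap Φ.lagr Φ.lagr_smooth).comp Φ.flow_smooth))

theorem action_eq {z : Phase d} (hz : z ∈ Φ.good) :
    Φ.action z = ∫ s in (0 : ℝ)..1, lagrangian g (Φ.curve z s) := by
  rw [action, volterra_apply]
  exact intervalIntegral.integral_congr fun s _ => Φ.lagr_eq _ (curve_mem_dom hz s)

theorem fderiv_endVal (z w : Phase d) : fderiv ℝ Φ.endVal z w = Φ.variation z w 1 := by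
  have h := ((ContinuousMap.evalCLM ℝ (1 : unitInterval) :
    C(unitInterval, Phase d) →L[ℝ] Phase d).hasFDerivAt (x := Φ.flow z)).comp z
      ((Φ.flow_smooth.differentiable (by simp)) z).hasFDerivAt
  have h2 : fderiv ℝ Φ.endVal z = _ := h.fderiv
  rw [h2]; rfl

theorem hasFDerivAt_comp_flow {G : Type} [NormedAddCommGroup G] [NormedSpace ℝ G]
    (f : C(Phase d, G)) (hf : ContDiff ℝ ∞ f) (z : Phase d) :
    HasFDerivAt (fun z => f.comp (Φ.flow z))
      ((pointwiseApply unitInterval (Phase d) G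
        ((⟨fderiv ℝ f, hf.continuous_fderiv (by simp)⟩ : C(Phase d, Phase d →L[ℝ] G)).comp
          (Φ.flow z))).comp (fderiv ℝ Φ.flow z)) z :=
  (hasFDerivAt_comp_continuousMap (f := f)
    (f' := ⟨fderiv ℝ f, hf.continuous_fderiv (by simp)⟩)
    (fun x => ((hf.differentiable (by simp)) x).hasFDerivAt) (Φ.flow z)).comp z
      ((Φ.flow_smooth.differentiable (by simp)) z).hasFDerivAt

/-- Differentiating the integral equation, an identity between smooth maps into the space of curves,
gives the integrated variational equation directly. -/
theorem variation_eq (z w : Phase d) : Φ.variation z w = ContinuousMap.const _ w +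
    volterra (pointwiseApply unitInterval (Phase d) (Phase d)
      ((⟨fderiv ℝ Φ.field, Φ.field_smooth.continuous_fderiv (by simp)⟩ :
        C(Phase d, Phase d →L[ℝ] Phase d)).comp (Φ.flow z)) (Φ.variation z w)) := by
  have h1 : HasFDerivAt Φ.flow ((ContinuousLinearMap.const ℝ unitInterval :
      Phase d →L[ℝ] C(unitInterval, Phase d)) + _) z :=
    (((ContinuousLinearMap.const ℝ unitInterval :
      Phase d →L[ℝ] C(unitInterval, Phase d)).hasFDerivAt (x := z)).add
      ((volterra (F := Phase d)).hasFDerivAt.comp z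
        (hasFDerivAt_comp_flow (Φ := Φ) Φ.field Φ.field_smooth z))).congr_of_eventuallyEq
          (Filter.Eventually.of_forall Φ.flow_eq)
  have h2 := congrArg (fun T => T w) h1.fderiv
  exact h2

/-- The derivative of the curve, as a curve. -/
def variationCurve (Φ : UnitFlow U g K) (z w : Phase d) : ℝ → Phase d :=
  Set.IccExtend zero_le_one (Φ.variation z w)

theorem variationCurve_zero (z w : Phase d) : Φ.variationCurve z w 0 = w := by
  rw [variationCurve, Set.IccExtend_of_mem _ _ (by simp : (0 : ℝ) ∈ Set.Icc (0 : ℝ) 1),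
    variation_eq]
  simp [volterra_apply]

theorem variationCurve_one (z w : Phase d) :
    Φ.variationCurve z w 1 = fderiv ℝ Φ.endVal z w := by
  rw [variationCurve, Set.IccExtend_of_mem _ _ (by simp : (1 : ℝ) ∈ Set.Icc (0 : ℝ) 1),
    fderiv_endVal]
  rfl

theorem hasDerivWithinAt_variationCurve {z : Phase d} (hz : z ∈ Φ.good) (w : Phase d) {s : ℝ}
    (hs : s ∈ Set.Icc (0 : ℝ) 1) : HasDerivWithinAt (Φ.variationCurve z w)
      (fderiv ℝ (hamiltonField g) (Φ.curve z s) (Φ.variationCurve z w s)) (Set.Icc 0 1) s := by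
  have h := hasDerivWithinAt_IccExtend (variation_eq (Φ := Φ) z w) hs
  have h2 : fderiv ℝ (hamiltonField g) (Φ.curve z s) = fderiv ℝ Φ.field (Φ.curve z s) := by
    refine Filter.EventuallyEq.fderiv_eq ?_
    filter_upwards [Φ.dom_open.mem_nhds (curve_mem_dom hz s)] with z hz
    exact (Φ.field_eq z hz).symm
  rw [h2]
  exact h

/-- The first variation of the action. -/
theorem fderiv_action (hm : IsMetric U g) {z : Phase d} (hz : z ∈ Φ.good) (w : Phase d) :
    fderiv ℝ Φ.action z w =
      inner ℝ (Φ.endVal z).2.2.1 (fderiv ℝ Φ.endVal z w).1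
        + inner ℝ (Φ.endVal z).2.2.2 (fderiv ℝ Φ.endVal z w).2.1
        - (inner ℝ z.2.2.1 w.1 + inner ℝ z.2.2.2 w.2.1) := by
  have h1 : fderiv ℝ Φ.action z = _ := (((ContinuousMap.evalCLM ℝ (1 : unitInterval) :
    C(unitInterval, ℝ) →L[ℝ] ℝ).hasFDerivAt).comp z ((volterra (F := ℝ)).hasFDerivAt.comp z
        (hasFDerivAt_comp_flow (Φ := Φ) Φ.lagr Φ.lagr_smooth z))).fderiv
  have h2 : fderiv ℝ Φ.action z w = ∫ s in (0 : ℝ)..1,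
      fderiv ℝ Φ.lagr (Φ.curve z s) (Φ.variationCurve z w s) := by
    rw [h1]; rfl
  have hc : Continuous fun s : ℝ => fderiv ℝ Φ.lagr (Φ.curve z s) (Φ.variationCurve z w s) :=
    ((Φ.lagr_smooth.continuous_fderiv (by simp)).comp (continuous_IccExtend _)).clm_apply
      (continuous_IccExtend _)
  have hlag : ∀ s, fderiv ℝ Φ.lagr (Φ.curve z s) = fderiv ℝ (lagrangian g) (Φ.curve z s) := by
    intro s
    refine Filter.EventuallyEq.fderiv_eq ?_
    filter_upwards [Φ.dom_open.mem_nhds (curve_mem_dom hz s)] with z hz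
    exact Φ.lagr_eq z hz
  -- This is the pairing `p·δx + q·δy`. By Hamilton's equations its time derivative is the variation
  -- of the Lagrangian, so the variation of the action is the difference of its boundary values.
  set ψ : ℝ → ℝ := fun s => inner ℝ (Φ.curve z s).2.2.1 (Φ.variationCurve z w s).1
    + inner ℝ (Φ.curve z s).2.2.2 (Φ.variationCurve z w s).2.1 with hψ
  have hψc : Continuous ψ := by
    have h1 : Continuous (Φ.curve z) := continuous_IccExtend _
    have h2 : Continuous (Φ.variationCurve z w) := continuous_IccExtend _
    exact ((h1.snd.snd.fst).inner h2.fst).add ((h1.snd.snd.snd).inner h2.snd.fst)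
  have hder : ∀ s ∈ Set.Ioo (0 : ℝ) 1, HasDerivAt ψ
      (fderiv ℝ Φ.lagr (Φ.curve z s) (Φ.variationCurve z w s)) s := by
    intro s hs
    have hs' := Set.Ioo_subset_Icc_self hs
    have hγ := ((isCharacteristic_curve hz).2 s hs').2.hasDerivAt (Icc_mem_nhds hs.1 hs.2)
    have hδ := (hasDerivWithinAt_variationCurve hz w hs').hasDerivAt (Icc_mem_nhds hs.1 hs.2)
    have hU := Φ.dom_subset _ (curve_mem_dom hz s)
    have hV : HasFDerivAt (hamiltonField g) (fderiv ℝ (hamiltonField g) (Φ.curve z s))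
        (Φ.curve z s) := ((hm.contDiffOn_hamiltonField.contDiffAt
          (hm.isOpen_fst.mem_nhds hU)).differentiableAt (by simp)).hasFDerivAt
    set ζ := Φ.curve z s with hζ
    set v := Φ.variationCurve z w s with hv
    have hL : fderiv ℝ (lagrangian g) ζ v =
        inner ℝ v.2.2.1 (hamiltonField g ζ).1 + inner ℝ ζ.2.2.1 (fderiv ℝ (hamiltonField g) ζ v).1
        + (inner ℝ v.2.2.2 (hamiltonField g ζ).2.1
          + inner ℝ ζ.2.2.2 (fderiv ℝ (hamiltonField g) ζ v).2.1)
        - fderiv ℝ (hamiltonFun g) ζ v := by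
      have a1 := (prP.hasFDerivAt (x := ζ)).inner ℝ (prX.hasFDerivAt.comp ζ hV)
      have a2 := (prQ.hasFDerivAt (x := ζ)).inner ℝ (prY.hasFDerivAt.comp ζ hV)
      have a3 := (a1.add a2).sub (hm.differentiableAt_hamiltonFun hU).hasFDerivAt
      have a4 : fderiv ℝ (lagrangian g) ζ = _ := a3.fderiv
      rw [a4]
      simp only [sub_apply, add_apply, ContinuousLinearMap.comp_apply,
        ContinuousLinearMap.prod_apply, fderivInnerCLM_apply, prP_apply, prX_apply, prQ_apply,
        prY_apply, Function.comp_apply]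
      ring
    rw [hlag, hL, hm.fderiv_hamiltonFun hU]
    have b1 := (prP.hasFDerivAt.comp_hasDerivAt s hγ).inner ℝ
      (prX.hasFDerivAt.comp_hasDerivAt s hδ)
    have b2 := (prQ.hasFDerivAt.comp_hasDerivAt s hγ).inner ℝ
      (prY.hasFDerivAt.comp_hasDerivAt s hδ)
    have b3 := b1.add b2
    refine HasDerivAt.congr_deriv (f := ψ) b3 ?_
    simp only [prP_apply, prX_apply, prQ_apply, prY_apply, Function.comp_apply]
    rw [real_inner_comm v.2.2.1, real_inner_comm v.2.2.2]
    ring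
  rw [h2, intervalIntegral.integral_eq_sub_of_hasDerivAt_of_le zero_le_one hψc.continuousOn hder
    (hc.intervalIntegrable _ _)]
  simp only [hψ, variationCurve_zero, variationCurve_one, curve_zero, curve_one]

end UnitFlow

/-! ### Families of local diffeomorphisms -/

section Inverse

variable {A F : Type*} [NormedAddCommGroup A] [NormedSpace ℝ A]
  [NormedAddCommGroup F] [NormedSpace ℝ F]

theorem hasFDerivAt_slice {f : A × F → F} {a : A} {ζ : F} (hf : DifferentiableAt ℝ f (a, ζ)) :
    HasFDerivAt (fun ζ => f (a, ζ)) ((fderiv ℝ f (a, ζ)).comp (ContinuousLinearMap.inr ℝ A F)) ζ :=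
  HasFDerivAt.comp ζ hf.hasFDerivAt (hasFDerivAt_prodMk_right a ζ)

/-- The maps `f (a, ·)` are uniformly invertible near `0` for all parameters `a` near `a₀`. -/
theorem eventually_injOn_and_ball_subset [CompleteSpace F] {f : A × F → F} (hf : ContDiff ℝ 1 f)
    {a₀ : A} {e : F ≃L[ℝ] F}
    (he : (fderiv ℝ f (a₀, 0)).comp (ContinuousLinearMap.inr ℝ A F) = e) :
    ∃ m > 0, ∀ᶠ a in nhds a₀, Set.InjOn (fun ζ => f (a, ζ)) (Metric.ball 0 m) ∧
      ∀ δ, 0 < δ → δ ≤ m →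
        Metric.ball (f (a, 0)) (m * δ) ⊆ (fun ζ => f (a, ζ)) '' Metric.ball 0 δ := by
  -- In the trivial space, which occurs for `d = 0`, the norm `N` below vanishes and the
  -- quantitative argument with `N⁻¹` breaks down.
  rcases subsingleton_or_nontrivial F with hF | hF
  · refine ⟨1, one_pos, Filter.Eventually.of_forall fun a =>
      ⟨fun _ _ _ _ _ => Subsingleton.elim _ _, fun δ hδ _ b _ =>
        ⟨0, Metric.mem_ball_self hδ, Subsingleton.elim _ _⟩⟩⟩
  set N : NNReal := ‖(e.symm : F →L[ℝ] F)‖₊ with hN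
  have hNpos : 0 < N := e.nnnorm_symm_pos
  set c : NNReal := N⁻¹ / 2 with hc
  have hcpos : 0 < c := by positivity
  have hcN : c < N⁻¹ := half_lt_self (by positivity)
  have hcont : Continuous fun w : A × F =>
      (fderiv ℝ f w).comp (ContinuousLinearMap.inr ℝ A F) :=
    (hf.continuous_fderiv one_ne_zero).clm_comp continuous_const
  have hev : ∀ᶠ w in nhds (a₀, (0 : F)),
      ‖(fderiv ℝ f w).comp (ContinuousLinearMap.inr ℝ A F) - e‖ < c := by
    have h1 := (hcont.sub continuous_const).norm.tendsto (a₀, (0 : F)) (f := fun w =>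
      ‖(fderiv ℝ f w).comp (ContinuousLinearMap.inr ℝ A F) - (e : F →L[ℝ] F)‖)
    rw [he, sub_self, norm_zero] at h1
    exact h1.eventually (gt_mem_nhds (by exact_mod_cast hcpos))
  obtain ⟨ρ, hρ, hball⟩ := Metric.eventually_nhds_iff_ball.1 hev
  -- The image of the closed ball of radius `δ / 2` contains one of radius `(N⁻¹ - c) δ / 2 = N⁻¹ δ
  -- / 4`, whence the quarter.
  refine ⟨min ρ (N⁻¹ / 4 : NNReal), lt_min hρ (by positivity), ?_⟩
  filter_upwards [Metric.ball_mem_nhds a₀ hρ] with a ha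
  have happ : ApproximatesLinearOn (fun ζ => f (a, ζ)) (e : F →L[ℝ] F) (Metric.ball 0 ρ) c := by
    intro ζ hζ ζ' hζ'
    refine Convex.norm_image_sub_le_of_norm_hasFDerivWithin_le'
      (f := fun ζ => f (a, ζ)) (fun ξ hξ => (hasFDerivAt_slice
        ((hf.differentiable one_ne_zero) (a, ξ))).hasFDerivWithinAt) (fun ξ hξ => ?_)
        (convex_ball (0 : F) ρ) hζ' hζ
    refine (hball (a, ξ) ?_).le
    rw [← ball_prod_same]
    exact ⟨ha, hξ⟩
  refine ⟨(happ.injOn (Or.inr hcN)).mono (Metric.ball_subset_ball (min_le_left _ _)),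
    fun δ hδ hδm b hb => ?_⟩
  have hsub : Metric.closedBall (0 : F) (δ / 2) ⊆ Metric.ball 0 ρ :=
    Metric.closedBall_subset_ball (by linarith [hδm.trans (min_le_left _ _)])
  obtain ⟨ζ, hζ, hζb⟩ := happ.surjOn_closedBall_of_nonlinearRightInverse
    e.toNonlinearRightInverse (half_pos hδ).le hsub (a := b) (by
      rw [Metric.mem_closedBall]
      refine hb.le.trans ?_
      have h1 : (min ρ (N⁻¹ / 4 : NNReal) : ℝ) ≤ (N⁻¹ / 4 : NNReal) := min_le_right _ _
      have h2 : (e.toNonlinearRightInverse.nnnorm : ℝ) = N := rfl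
      rw [h2, hc]
      push_cast at h1 ⊢
      nlinarith)
  exact ⟨ζ, Metric.closedBall_subset_ball (half_lt_self hδ) hζ, hζb⟩

/-- Uniformity over compact sets of a property that is monotone in a parameter. -/
theorem _root_.IsCompact.exists_pos_forall_of_antitone {A : Type*} [TopologicalSpace A]
    {C : Set A} (hC : IsCompact C) {P : ℝ → A → Prop}
    (hanti : ∀ m m' a, 0 < m' → m' ≤ m → P m a → P m' a)
    (h : ∀ a ∈ C, ∃ m > 0, ∀ᶠ a' in nhds a, P m a') :
    ∃ m > 0, ∃ O, IsOpen O ∧ C ⊆ O ∧ ∀ a ∈ O, P m a := by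
  refine hC.induction_on (p := fun s => ∃ m > 0, ∃ O, IsOpen O ∧ s ⊆ O ∧ ∀ a ∈ O, P m a)
    ⟨1, one_pos, ∅, isOpen_empty, Set.empty_subset _, fun _ h => h.elim⟩
    (fun s t hst ⟨m, hm, O, hO, htO, hP⟩ => ⟨m, hm, O, hO, hst.trans htO, hP⟩) ?_ ?_
  · rintro s t ⟨m, hm, O, hO, hsO, hP⟩ ⟨m', hm', O', hO', htO', hP'⟩
    refine ⟨min m m', lt_min hm hm', O ∪ O', hO.union hO', Set.union_subset_union hsO htO', ?_⟩
    rintro a (ha | ha)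
    · exact hanti _ _ _ (lt_min hm hm') (min_le_left _ _) (hP a ha)
    · exact hanti _ _ _ (lt_min hm hm') (min_le_right _ _) (hP' a ha)
  · intro a ha
    obtain ⟨m, hm, hev⟩ := h a ha
    obtain ⟨O, hOP, hO, haO⟩ := eventually_nhds_iff.1 hev
    exact ⟨O, mem_nhdsWithin_of_mem_nhds (hO.mem_nhds haO), m, hm, O, hO, subset_rfl, hOP⟩

/-- The inverse of a smooth family of local diffeomorphisms is smooth in all variables. -/
theorem contDiffAt_inverse_family [FiniteDimensional ℝ A] [FiniteDimensional ℝ F]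
    {f : A × F → F} (hf : ContDiff ℝ ∞ f) {inv : A × F → F} {O : Set A} {B : Set F}
    (hO : IsOpen O) (hB : IsOpen B) {a : A} {b : F} (ha : a ∈ O) (hbB : inv (a, b) ∈ B)
    (hinv : f (a, inv (a, b)) = b)
    (huniq : ∀ a' ∈ O, ∀ ζ ∈ B, inv (a', f (a', ζ)) = ζ)
    (hinj : Function.Injective
      ((fderiv ℝ f (a, inv (a, b))).comp (ContinuousLinearMap.inr ℝ A F))) :
    ContDiffAt ℝ ∞ inv (a, b) := by
  set ζ := inv (a, b) with hζ
  -- Carrying the parameter along turns the family into a single local diffeomorphism. Its local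
  -- inverse takes values in `O ×ˢ B` near the point, where `huniq` identifies its second component
  -- with `inv`.
  set Θ : A × F → A × F := fun w => (w.1, f w) with hΘ
  have hΘs : ContDiff ℝ ∞ Θ := contDiff_fst.prodMk hf
  set L : A × F →L[ℝ] A × F := (ContinuousLinearMap.fst ℝ A F).prod (fderiv ℝ f (a, ζ)) with hL
  have hΘd : HasFDerivAt Θ L (a, ζ) :=
    hasFDerivAt_fst.prodMk ((hf.differentiable (by simp)) _).hasFDerivAt
  have hLinj : Function.Injective L := by
    rw [injective_iff_map_eq_zero]
    rintro ⟨u, v⟩ huv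
    have h1 : u = 0 := congrArg Prod.fst huv
    have h2 : fderiv ℝ f (a, ζ) (u, v) = 0 := congrArg Prod.snd huv
    subst h1
    have h3 : v = 0 := (injective_iff_map_eq_zero _).1 hinj v h2
    rw [h3]; rfl
  set e : (A × F) ≃L[ℝ] (A × F) :=
    (LinearEquiv.ofInjectiveEndo (L : A × F →ₗ[ℝ] A × F) hLinj).toContinuousLinearEquiv with he
  have hΘd' : HasFDerivAt Θ (e : A × F →L[ℝ] A × F) (a, ζ) := by
    have : (e : A × F →L[ℝ] A × F) = L := ContinuousLinearMap.ext fun v => rfl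
    rwa [this]
  have hΘa : Θ (a, ζ) = (a, b) := by simp only [hΘ, hinv]
  have hc : ContDiffAt ℝ ∞ Θ (a, ζ) := hΘs.contDiffAt
  have hloc := hc.to_localInverse hΘd' (by simp)
  have hval := hc.localInverse_apply_image hΘd' (by simp)
  have hright : ∀ᶠ w in nhds (Θ (a, ζ)), Θ (hc.localInverse hΘd' (by simp) w) = w :=
    (hc.hasStrictFDerivAt' hΘd' (by simp)).eventually_right_inverse
  have hmem : ∀ᶠ w in nhds (Θ (a, ζ)), hc.localInverse hΘd' (by simp) w ∈ O ×ˢ B := by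
    refine hloc.continuousAt.eventually_mem ?_
    rw [hval]
    exact (hO.prod hB).mem_nhds ⟨ha, hbB⟩
  rw [hΘa] at hloc hright hmem
  refine (contDiffAt_snd.comp _ hloc).congr_of_eventuallyEq ?_
  filter_upwards [hright, hmem] with w hw hwm
  have h1 := huniq _ hwm.1 _ hwm.2
  have h2 : ((hc.localInverse hΘd' (by simp) w).1, f (hc.localInverse hΘd' (by simp) w)) = w := hw
  rw [Prod.mk.eta, h2] at h1
  exact h1

end Inverse

/-! ### The end-point map -/

/-- The projection of phase space to configuration space. -/
def prXY : Phase d →L[ℝ] E d × E d := prX.prod prY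

/-- The embedding of the momenta. -/
def embPQ : E d × E d →L[ℝ] Phase d :=
  (ContinuousLinearMap.inr ℝ (E d) _).comp (ContinuousLinearMap.inr ℝ (E d) _)

@[simp] theorem prXY_apply (z : Phase d) : prXY z = (z.1, z.2.1) := rfl
@[simp] theorem embPQ_apply (ζ : E d × E d) : embPQ ζ = (0, 0, ζ) := rfl

/-- The Schur complement of the block `M` is `(-1/6 + 1/4) G = G / 12`, and the factors `det M` and
`det G` cancel. -/
theorem det_of_blocks {M G : Matrix (Fin d) (Fin d) ℝ} (hMG : M * G = 1)
    {T : E d × E d →L[ℝ] E d × E d}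
    (hT : ∀ ζ, T ζ = (-((1 / 2 : ℝ) • ζ.2 + (1 / 6 : ℝ) • matVec G ζ.1),
      matVec M ζ.2 + (1 / 2 : ℝ) • ζ.1)) : T.det = (1 / 12) ^ d := by
  set b := (EuclideanSpace.basisFun (Fin d) ℝ).toBasis
  have hmat : LinearMap.toMatrix (b.prod b) (b.prod b) (T : E d × E d →ₗ[ℝ] E d × E d) =
      Matrix.fromBlocks ((-(1 / 6) : ℝ) • G) ((-(1 / 2) : ℝ) • 1) ((1 / 2 : ℝ) • 1) M := by
    ext (i | i) (j | j) <;>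
    simp [LinearMap.toMatrix_apply, hT, b, matVec_apply, Matrix.one_apply]
  have hM : Invertible M := Matrix.invertibleOfIsUnitDet M (Matrix.isUnit_det_of_right_inverse hMG)
  have hinv : ⅟M = G := by
    rw [Matrix.invOf_eq_nonsing_inv]; exact Matrix.inv_eq_right_inv hMG
  rw [ContinuousLinearMap.det, ← LinearMap.det_toMatrix (b.prod b), hmat,
    Matrix.det_fromBlocks₂₂, hinv, ← Matrix.det_mul]
  have : M * ((-(1 / 6) : ℝ) • G - (-(1 / 2) : ℝ) • (1 : Matrix (Fin d) (Fin d) ℝ) * G *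
      (1 / 2 : ℝ) • (1 : Matrix (Fin d) (Fin d) ℝ)) = (1 / 12 : ℝ) • 1 := by
    simp only [Matrix.smul_mul, Matrix.mul_smul, one_mul, mul_one, hMG, smul_smul,
      ← sub_smul]
    norm_num
  rw [this, Matrix.det_smul, Matrix.det_one]
  simp

namespace UnitFlow

variable {U : Set (E d)} {g : E d → Matrix (Fin d) (Fin d) ℝ} {K : Set (E d)} (Φ : UnitFlow U g K)

/-- The end point in configuration space, as a function of the initial position and momenta. -/
def expMap (w : (E d × E d) × (E d × E d)) : E d × E d := prXY (Φ.endVal (w.1.1, w.1.2, w.2))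

/-- The derivative of the end point with respect to the momenta. -/
def expDeriv (a ζ : E d × E d) : E d × E d →L[ℝ] E d × E d :=
  (prXY.comp (fderiv ℝ Φ.endVal (a.1, a.2, ζ))).comp embPQ

variable {Φ}

theorem contDiff_expMap : ContDiff ℝ ∞ Φ.expMap :=
  prXY.contDiff.comp (contDiff_endVal.comp (by fun_prop))

theorem hasFDerivAt_expMap_slice (a ζ : E d × E d) :
    HasFDerivAt (fun ζ => Φ.expMap (a, ζ)) (Φ.expDeriv a ζ) ζ := by
  have h1 : HasFDerivAt (fun ζ : E d × E d => ((a.1, a.2, ζ) : Phase d)) embPQ ζ :=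
    (hasFDerivAt_prodMk_right a.1 (a.2, ζ)).comp ζ (hasFDerivAt_prodMk_right a.2 ζ)
  have h2 : HasFDerivAt Φ.endVal (fderiv ℝ Φ.endVal (a.1, a.2, ζ)) (a.1, a.2, ζ) :=
    ((contDiff_endVal.differentiable (by simp)) _).hasFDerivAt
  exact prXY.hasFDerivAt.comp ζ (h2.comp ζ h1)

theorem expDeriv_eq (a ζ : E d × E d) : Φ.expDeriv a ζ =
    (fderiv ℝ Φ.expMap (a, ζ)).comp (ContinuousLinearMap.inr ℝ _ _) :=
  (hasFDerivAt_expMap_slice a ζ).unique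
    (hasFDerivAt_slice ((contDiff_expMap.differentiable (by simp)) _))

theorem continuous_expDeriv : Continuous fun w : (E d × E d) × (E d × E d) =>
    Φ.expDeriv w.1 w.2 := by
  simp only [expDeriv_eq]
  exact (contDiff_expMap.continuous_fderiv (by simp)).clm_comp continuous_const

theorem curve_base {x : E d} (hx : x ∈ K) (s : ℝ) : Φ.curve (x, 0, 0, 0) s = (x, 0, 0, 0) := by
  rw [curve, Φ.flow_base x hx]; rfl

theorem expMap_base {x : E d} (hx : x ∈ K) : Φ.expMap ((x, 0), 0) = (x, 0) := by
  have : Φ.endVal (x, 0, 0, 0) = (x, 0, 0, 0) := by rw [← curve_one, curve_base hx]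
  exact congrArg prXY this

/-- Along a rest point the variational equation has constant, nilpotent coefficients, so its
solution is polynomial in time. -/
theorem expDeriv_base (hm : IsMetric U g) (hKU : K ⊆ U) {x : E d} (hx : x ∈ K) (ζ : E d × E d) :
    Φ.expDeriv (x, 0) 0 ζ = (-((1 / 2 : ℝ) • ζ.2 + (1 / 6 : ℝ) • matVec (g x)⁻¹ ζ.1),
      matVec (g x) ζ.2 + (1 / 2 : ℝ) • ζ.1) := by
  obtain ⟨π, κ⟩ := ζ
  set G := (g x)⁻¹ with hG
  set D := fderiv ℝ (hamiltonField g) (x, 0, 0, 0) with hD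
  -- This is the solution of `p' = 0`, `q' = G p`, `y' = g q`, `x' = -G y` with vanishing initial
  -- positions, obtained by successive integration.
  set c : ℝ → Phase d := fun s => (-((s ^ 2 / 2) • κ + (s ^ 3 / 6) • matVec G π),
    s • matVec (g x) κ + (s ^ 2 / 2) • π, π, κ + s • matVec G π) with hc
  have hgG : ∀ y, matVec (g x) (matVec G y) = y := fun y => by
    rw [matVec_matVec, hm.mul_inv (hKU hx), matVec_one]
  have hGg : ∀ y, matVec G (matVec (g x) y) = y := fun y => by
    rw [matVec_matVec, hG, Matrix.nonsing_inv_mul _ (hm.det_pos (hKU hx)).ne'.isUnit, matVec_one]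
  have hcd : ∀ s, HasDerivAt c (D (c s)) s := by
    intro s
    have p1 : HasDerivAt (fun s : ℝ => s ^ 2 / 2) s s := by
      have := (hasDerivAt_pow 2 s).div_const 2
      simpa using this
    have p2 : HasDerivAt (fun s : ℝ => s ^ 3 / 6) (s ^ 2 / 2) s := by
      have := (hasDerivAt_pow 3 s).div_const 6
      refine this.congr_deriv ?_
      norm_num; ring
    have p0 := hasDerivAt_id s
    have q := (((p1.smul_const κ).fun_add (p2.smul_const (matVec G π))).fun_neg).prodMk
      (((p0.smul_const (matVec (g x) κ)).fun_add (p1.smul_const π)).prodMk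
        ((hasDerivAt_const s π).prodMk ((p0.smul_const (matVec G π)).const_add κ)))
    refine HasDerivAt.congr_deriv (f := c) q ?_
    rw [hD, hm.fderiv_hamiltonField_zero (hKU hx)]
    simp only [hc, ← hG, one_smul]
    simp only [← matVecL_apply, map_add, map_smul]
    simp only [matVecL_apply, hgG, hGg]
  have heq : Set.EqOn (Φ.variationCurve (x, 0, 0, 0) (0, 0, π, κ)) c (Set.Icc 0 1) := by
    refine solution_unique (V := D) isOpen_univ D.contDiff.contDiffOn
      (fun s hs => ⟨trivial, ?_⟩) (fun s hs => ⟨trivial, (hcd s).hasDerivWithinAt⟩) ?_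
    · have := hasDerivWithinAt_variationCurve (Φ.base_mem_good hx) (0, 0, π, κ) hs
      rwa [curve_base hx] at this
    · rw [variationCurve_zero]
      simp [hc]
  have h1 := heq (Set.right_mem_Icc.2 zero_le_one)
  rw [variationCurve_one] at h1
  have h2 : Φ.expDeriv (x, 0) 0 (π, κ) =
      prXY (fderiv ℝ Φ.endVal (x, 0, 0, 0) (0, 0, π, κ)) := rfl
  rw [h2, h1]
  simp [hc]

theorem det_expDeriv_base (hm : IsMetric U g) (hKU : K ⊆ U) {x : E d} (hx : x ∈ K) :
    0 < (Φ.expDeriv (x, 0) 0).det := by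
  rw [det_of_blocks (hm.mul_inv (hKU hx)) (expDeriv_base hm hKU hx)]
  positivity

theorem _root_.StochGeodesic.injective_of_det_ne_zero {T : E d × E d →L[ℝ] E d × E d}
    (hT : T.det ≠ 0) : Function.Injective T :=
  (LinearMap.equivOfDetNeZero (T : E d × E d →ₗ[ℝ] E d × E d) hT).injective

theorem continuous_det_expDeriv : Continuous fun w : (E d × E d) × (E d × E d) =>
    (Φ.expDeriv w.1 w.2).det := ContinuousLinearMap.continuous_det.comp continuous_expDeriv

/-- Uniform invertibility of the end-point map near the zero section over `K`. -/
theorem exists_uniform_inverse (hm : IsMetric U g) (hK : IsCompact K) (hKU : K ⊆ U) :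
    ∃ δ > 0, ∃ r₀ > 0, ∃ O : Set (E d × E d), IsOpen O ∧ (∀ x ∈ K, (x, 0) ∈ O) ∧ ∀ a ∈ O,
      Set.InjOn (fun ζ => Φ.expMap (a, ζ)) (Metric.ball 0 δ) ∧
      (∀ ζ ∈ Metric.ball (0 : E d × E d) δ, (a.1, a.2, ζ) ∈ Φ.good ∧ 0 < (Φ.expDeriv a ζ).det) ∧
      ∀ b ∈ Metric.ball a r₀, ∃ ζ ∈ Metric.ball 0 δ, Φ.expMap (a, ζ) = b := by
  have hC : IsCompact ((fun x : E d => (x, (0 : E d))) '' K) := hK.image (by fun_prop)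
  obtain ⟨m, hm0, O, hO, hKO, hP⟩ := hC.exists_pos_forall_of_antitone (P := fun m a =>
      Set.InjOn (fun ζ => Φ.expMap (a, ζ)) (Metric.ball 0 m) ∧
      (∀ δ, 0 < δ → δ ≤ m → Metric.ball (Φ.expMap (a, 0)) (m * δ) ⊆
        (fun ζ => Φ.expMap (a, ζ)) '' Metric.ball 0 δ) ∧
      ∀ ζ ∈ Metric.ball (0 : E d × E d) m, (a.1, a.2, ζ) ∈ Φ.good ∧ 0 < (Φ.expDeriv a ζ).det)
    (by
      rintro m m' a hm' hmm ⟨h1, h2, h3⟩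
      refine ⟨h1.mono (Metric.ball_subset_ball hmm), fun δ hδ hδm => ?_,
        fun ζ hζ => h3 ζ (Metric.ball_subset_ball hmm hζ)⟩
      exact (Metric.ball_subset_ball (by gcongr)).trans (h2 δ hδ (hδm.trans hmm)))
    (by
      rintro _ ⟨x, hx, rfl⟩
      have hdet := det_expDeriv_base (Φ := Φ) hm hKU hx
      set e : (E d × E d) ≃L[ℝ] (E d × E d) := (LinearMap.equivOfDetNeZero
        (Φ.expDeriv (x, 0) 0 : E d × E d →ₗ[ℝ] E d × E d) hdet.ne').toContinuousLinearEquiv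
      obtain ⟨m, hm0, hev⟩ := eventually_injOn_and_ball_subset (f := Φ.expMap)
        (contDiff_expMap.of_le (by simp)) (a₀ := (x, 0)) (e := e)
        (by rw [← expDeriv_eq]; exact ContinuousLinearMap.ext fun v => rfl)
      have hev2 : ∀ᶠ w in nhds (((x, 0), 0) : (E d × E d) × (E d × E d)),
          (w.1.1, w.1.2, w.2) ∈ Φ.good ∧ 0 < (Φ.expDeriv w.1 w.2).det := by
        refine Filter.Eventually.and ?_ ?_
        · have hc : Continuous fun w : (E d × E d) × (E d × E d) =>
            ((w.1.1, w.1.2, w.2) : Phase d) := by fun_prop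
          exact hc.continuousAt.eventually_mem (Φ.isOpen_good.mem_nhds (Φ.base_mem_good hx))
        · exact continuous_det_expDeriv.continuousAt.eventually (lt_mem_nhds hdet)
      obtain ⟨ρ, hρ, hball⟩ := Metric.eventually_nhds_iff_ball.1 hev2
      refine ⟨min m ρ, lt_min hm0 hρ, ?_⟩
      filter_upwards [hev, Metric.ball_mem_nhds _ hρ] with a ⟨h1, h2⟩ ha
      refine ⟨h1.mono (Metric.ball_subset_ball (min_le_left _ _)), fun δ hδ hδm => ?_,
        fun ζ hζ => hball (a, ζ) ?_⟩
      · exact (Metric.ball_subset_ball (by gcongr; exact min_le_left _ _)).trans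
          (h2 δ hδ (hδm.trans (min_le_left _ _)))
      · rw [← ball_prod_same]
        exact ⟨ha, Metric.ball_subset_ball (min_le_right _ _) hζ⟩)
  have hdist : Continuous fun a : E d × E d => dist (Φ.expMap (a, 0)) a :=
    (contDiff_expMap.continuous.comp (by fun_prop)).dist continuous_id
  -- The image covers the ball of radius `m²` about the end point for zero momenta. Restricting to
  -- `a` displaced by less than `m² / 2` leaves a ball of radius `m² / 2` about `a` itself.
  refine ⟨m, hm0, m * m / 2, by positivity,
    O ∩ {a | dist (Φ.expMap (a, 0)) a < m * m / 2},
    hO.inter (isOpen_lt hdist continuous_const), fun x hx => ⟨hKO ⟨x, hx, rfl⟩, ?_⟩, ?_⟩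
  · change dist (Φ.expMap ((x, 0), 0)) (x, 0) < _
    rw [expMap_base hx, dist_self]; positivity
  · rintro a ⟨ha, had⟩
    obtain ⟨h1, h2, h3⟩ := hP a ha
    refine ⟨h1, h3, fun b hb => ?_⟩
    obtain ⟨ζ, hζ, hζb⟩ := h2 m hm0 le_rfl (a := b) (by
      rw [Metric.mem_ball] at hb ⊢
      have had' : dist (Φ.expMap (a, 0)) a < m * m / 2 := had
      linarith [dist_triangle_right b (Φ.expMap (a, 0)) a])
    exact ⟨ζ, hζ, hζb⟩

end UnitFlow

/-! ### The determinant and the trace on `E × E` -/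

/-- The standard basis of `E × E`. -/
def stdBasis (d : ℕ) : Module.Basis (Fin d ⊕ Fin d) ℝ (E d × E d) :=
  (EuclideanSpace.basisFun (Fin d) ℝ).toBasis.prod (EuclideanSpace.basisFun (Fin d) ℝ).toBasis

theorem det_eq_matrix_det (T : E d × E d →L[ℝ] E d × E d) :
    T.det = (LinearMap.toMatrix (stdBasis d) (stdBasis d) (T : E d × E d →ₗ[ℝ] _)).det := by
  rw [ContinuousLinearMap.det, ← LinearMap.det_toMatrix (stdBasis d)]

theorem contDiff_det : ContDiff ℝ ∞ (fun T : E d × E d →L[ℝ] E d × E d => T.det) := by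
  simp only [det_eq_matrix_det, Matrix.det_apply, LinearMap.toMatrix_apply]
  refine ContDiff.sum fun σ _ => (contDiff_prod fun i _ => ?_).const_smul _
  have h : ContDiff ℝ ∞ fun T : E d × E d →L[ℝ] E d × E d => T (stdBasis d i) :=
    ((ContinuousLinearMap.apply ℝ (E d × E d)) (stdBasis d i)).contDiff
  exact (LinearMap.toContinuousLinearMap ((stdBasis d).coord (σ i))).contDiff.comp h

theorem det_comp (S T : E d × E d →L[ℝ] E d × E d) : (S.comp T).det = S.det * T.det :=
  LinearMap.det_comp (S : E d × E d →ₗ[ℝ] E d × E d) (T : E d × E d →ₗ[ℝ] E d × E d)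

/-- This is the first-order term of the expansion of `det (1 + r B)` in powers of `r`. -/
theorem fderiv_det_id (B : E d × E d →L[ℝ] E d × E d) :
    fderiv ℝ (fun T : E d × E d →L[ℝ] E d × E d => T.det) (ContinuousLinearMap.id ℝ (E d × E d)) B
      = LinearMap.trace ℝ _ (B : E d × E d →ₗ[ℝ] _) := by
  have hD := ((contDiff_det (d := d)).differentiable (by simp)
    (ContinuousLinearMap.id ℝ (E d × E d) + (0 : ℝ) • B)).hasFDerivAt
  have h2 : HasDerivAt (fun r : ℝ => ContinuousLinearMap.id ℝ (E d × E d) + r • B) B 0 := by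
    simpa using ((hasDerivAt_id (0 : ℝ)).smul_const B).const_add (ContinuousLinearMap.id ℝ _)
  have h3 := hD.comp_hasDerivAt (0 : ℝ) h2
  have h0 : ContinuousLinearMap.id ℝ (E d × E d) + (0 : ℝ) • B = ContinuousLinearMap.id ℝ _ := 
    ContinuousLinearMap.ext fun v => by simp
  rw [h0] at h3
  refine h3.unique ?_
  set N := LinearMap.toMatrix (stdBasis d) (stdBasis d) (B : E d × E d →ₗ[ℝ] _) with hN
  obtain ⟨q, h4⟩ : ∃ q : Polynomial ℝ, ∀ r : ℝ,
      (ContinuousLinearMap.id ℝ (E d × E d) + r • B).det = 1 + N.trace * r + q.eval r * r ^ 2 := by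
    refine ⟨_, fun r => Eq.trans ?_ (Matrix.det_one_add_smul r N)⟩
    rw [det_eq_matrix_det]
    congr 1
    simp [N]
  simp only [Function.comp_def, h4, LinearMap.trace_eq_matrix_trace ℝ (stdBasis d), ← hN]
  have h5 := (((hasDerivAt_id (0 : ℝ)).const_mul N.trace).const_add 1).fun_add
    ((q.hasDerivAt 0).fun_mul (hasDerivAt_pow 2 (0 : ℝ)))
  simpa using h5

/-- The derivative of the determinant along a solution of a linear equation. -/
theorem hasDerivAt_det {M : ℝ → E d × E d →L[ℝ] E d × E d} {B : E d × E d →L[ℝ] E d × E d} {t : ℝ}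
    (hM : HasDerivAt M (B.comp (M t)) t) (h0 : (M t).det ≠ 0) :
    HasDerivAt (fun s => (M s).det)
      (LinearMap.trace ℝ _ (B : E d × E d →ₗ[ℝ] E d × E d) * (M t).det) t := by
  set e := (LinearMap.equivOfDetNeZero (M t : E d × E d →ₗ[ℝ] E d × E d) h0).toContinuousLinearEquiv
  have heM : (e : E d × E d →L[ℝ] E d × E d) = M t := ContinuousLinearMap.ext fun _ => rfl
  set i : E d × E d →L[ℝ] E d × E d := (e.symm : E d × E d →L[ℝ] E d × E d)
  have hMi : (M t).comp i = ContinuousLinearMap.id ℝ _ := by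
    rw [← heM]; exact ContinuousLinearMap.ext fun v => e.apply_symm_apply v
  have hiM : i.comp (M t) = ContinuousLinearMap.id ℝ _ := by
    rw [← heM]; exact ContinuousLinearMap.ext fun v => e.symm_apply_apply v
  -- Composition with the inverse of `M t` moves the base point to the identity, where the
  -- derivative of the determinant is the trace.
  have h1 : HasDerivAt (fun s => (M s).comp i) B t := by
    have h := hM.clm_comp (hasDerivAt_const t i)
    refine h.congr_deriv ?_
    rw [ContinuousLinearMap.comp_assoc, hMi]
    simp
  have hD := ((contDiff_det (d := d)).differentiable (by simp) ((M t).comp i)).hasFDerivAt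
  have h3 := hD.comp_hasDerivAt t h1
  rw [hMi, fderiv_det_id] at h3
  refine (h3.mul_const (M t).det).congr_of_eventuallyEq (Filter.Eventually.of_forall fun s => ?_)
  simp only [Function.comp_apply]
  rw [← det_comp, ContinuousLinearMap.comp_assoc, hiM, ContinuousLinearMap.comp_id]

theorem trace_eq_sum (B : E d × E d →L[ℝ] E d × E d) :
    LinearMap.trace ℝ _ (B : E d × E d →ₗ[ℝ] E d × E d) =
      ∑ i, (B (EuclideanSpace.single i 1, 0)).1 i + ∑ i, (B (0, EuclideanSpace.single i 1)).2 i := by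
  rw [LinearMap.trace_eq_matrix_trace ℝ (stdBasis d), Matrix.trace, Fintype.sum_sum_type]
  simp [LinearMap.toMatrix_apply, stdBasis]

/-! ### Characteristics at arbitrary times -/

/-- The dilation of positions. -/
def posDilation (t : ℝ) : E d × E d →L[ℝ] E d × E d :=
  (ContinuousLinearMap.id ℝ (E d)).prodMap (t • ContinuousLinearMap.id ℝ (E d))

/-- The dilation of momenta. -/
def momDilation (t : ℝ) : E d × E d →L[ℝ] E d × E d :=
  (t ^ 3 • ContinuousLinearMap.id ℝ (E d)).prodMap (t ^ 2 • ContinuousLinearMap.id ℝ (E d))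

@[simp] theorem posDilation_apply (t : ℝ) (b : E d × E d) : posDilation t b = (b.1, t • b.2) := rfl
@[simp] theorem momDilation_apply (t : ℝ) (ζ : E d × E d) :
    momDilation t ζ = (t ^ 3 • ζ.1, t ^ 2 • ζ.2) := rfl

theorem posDilation_inv {t : ℝ} (ht : t ≠ 0) (b : E d × E d) :
    posDilation t⁻¹ (posDilation t b) = b := by
  simp [smul_smul, inv_mul_cancel₀ ht]

theorem posDilation_inv' {t : ℝ} (ht : t ≠ 0) (b : E d × E d) :
    posDilation t (posDilation t⁻¹ b) = b := by
  simp [smul_smul, mul_inv_cancel₀ ht]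

theorem momDilation_inv {t : ℝ} (ht : t ≠ 0) (b : E d × E d) :
    momDilation t⁻¹ (momDilation t b) = b := by
  simp [smul_smul, ht]

theorem momDilation_inv' {t : ℝ} (ht : t ≠ 0) (b : E d × E d) :
    momDilation t (momDilation t⁻¹ b) = b := by
  simp [smul_smul, ht]

theorem det_posDilation (t : ℝ) : (posDilation t : E d × E d →L[ℝ] _).det = t ^ d := by
  have : ((posDilation t : E d × E d →L[ℝ] _) : E d × E d →ₗ[ℝ] E d × E d) =
    LinearMap.prodMap LinearMap.id (t • LinearMap.id) := rfl
  rw [ContinuousLinearMap.det, this, LinearMap.det_prodMap, LinearMap.det_id, LinearMap.det_smul]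
  simp

theorem det_momDilation (t : ℝ) : (momDilation t : E d × E d →L[ℝ] _).det = t ^ (5 * d) := by
  have : ((momDilation t : E d × E d →L[ℝ] _) : E d × E d →ₗ[ℝ] E d × E d) =
    LinearMap.prodMap (t ^ 3 • LinearMap.id) (t ^ 2 • LinearMap.id) := rfl
  rw [ContinuousLinearMap.det, this, LinearMap.det_prodMap, LinearMap.det_smul, LinearMap.det_smul]
  simp only [finrank_euclideanSpace, Fintype.card_fin, LinearMap.det_id, mul_one]
  ring

theorem dilation_mk (t : ℝ) (a ζ : E d × E d) : dilation t ((a.1, a.2, ζ) : Phase d) =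
    ((posDilation t a).1, (posDilation t a).2, momDilation t ζ) := rfl

theorem contDiff_posDilation : ContDiff ℝ ∞ fun w : ℝ × (E d × E d) => posDilation w.1 w.2 := by
  simp only [posDilation_apply]; fun_prop

theorem contDiff_momDilation : ContDiff ℝ ∞ fun w : ℝ × (E d × E d) => momDilation w.1 w.2 := by
  simp only [momDilation_apply]; fun_prop

theorem contDiff_dilation : ContDiff ℝ ∞ fun w : ℝ × Phase d => dilation w.1 w.2 := by
  simp only [dilation_apply]; fun_prop

namespace UnitFlow

variable {U : Set (E d)} {g : E d → Matrix (Fin d) (Fin d) ℝ} {K : Set (E d)} (Φ : UnitFlow U g K)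

/-- The curve starting at `z`, parametrized by `[0, t]`. -/
def curveAt (t : ℝ) (z : Phase d) (s : ℝ) : Phase d :=
  dilation t⁻¹ (Φ.curve (dilation t z) (t⁻¹ * s))

/-- The state at time `t` of the characteristic starting at `z`. -/
def stateAt (t : ℝ) (z : Phase d) : Phase d := dilation t⁻¹ (Φ.endVal (dilation t z))

/-- The action at time `t` of the characteristic starting at `z`. -/
def actionAt (t : ℝ) (z : Phase d) : ℝ := (t ^ 3)⁻¹ * Φ.action (dilation t z)

variable {Φ} {t : ℝ} {z : Phase d}

theorem isCharacteristic_curveAt (ht : 0 < t) (hz : dilation t z ∈ Φ.good) :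
    IsCharacteristic g U t z (Φ.curveAt t z) := by
  have h := (isCharacteristic_curve hz).dilate (inv_pos.2 ht)
  rw [dilation_inv_dilation ht.ne', one_div, inv_inv] at h
  exact h

theorem curveAt_self (ht : 0 < t) : Φ.curveAt t z t = Φ.stateAt t z := by
  rw [curveAt, inv_mul_cancel₀ ht.ne', curve_one, stateAt]

theorem continuous_curveAt : Continuous (Φ.curveAt t z) :=
  (dilation t⁻¹).continuous.comp ((continuous_IccExtend _).comp (by fun_prop))

theorem curveAt_mem (hz : dilation t z ∈ Φ.good) (s : ℝ) : (Φ.curveAt t z s).1 ∈ U :=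
  show (Φ.curve (dilation t z) (t⁻¹ * s)).1 ∈ U from Φ.dom_subset _ (curve_mem_dom hz _)

theorem stateAt_mem (hz : dilation t z ∈ Φ.good) : (Φ.stateAt t z).1 ∈ U :=
  show (Φ.flow (dilation t z) 1).1 ∈ U from Φ.dom_subset _ (hz 1)

theorem characteristic_self (hm : IsMetric U g) (ht : 0 < t) (hz : dilation t z ∈ Φ.good) :
    characteristic g U t z t = Φ.stateAt t z := by
  rw [(isCharacteristic_curveAt ht hz).characteristic_eqOn hm (Set.right_mem_Icc.2 ht.le),
    curveAt_self ht]

theorem integral_curveAt (hm : IsMetric U g) (ht : 0 < t) (hz : dilation t z ∈ Φ.good) :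
    ∫ s in (0 : ℝ)..t, lagrangian g (Φ.curveAt t z s) = Φ.actionAt t z := by
  have h1 : ∀ s, lagrangian g (Φ.curveAt t z s) =
      (fun r => t⁻¹ ^ 4 * lagrangian g (Φ.curve (dilation t z) r)) (t⁻¹ * s) := fun s =>
    hm.lagrangian_dilation _ (Φ.dom_subset _ (curve_mem_dom hz _))
  simp only [h1]
  rw [intervalIntegral.integral_comp_mul_left (c := t⁻¹)
    (fun r => t⁻¹ ^ 4 * lagrangian g (Φ.curve (dilation t z) r)) (inv_ne_zero ht.ne'),
    mul_zero, inv_mul_cancel₀ ht.ne', intervalIntegral.integral_const_mul, ← action_eq hz, actionAt]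
  rw [inv_inv, smul_eq_mul, ← mul_assoc]
  congr 1
  field_simp

theorem integral_characteristic (hm : IsMetric U g) (ht : 0 < t) (hz : dilation t z ∈ Φ.good) :
    ∫ s in (0 : ℝ)..t, lagrangian g (characteristic g U t z s) = Φ.actionAt t z := by
  rw [← integral_curveAt hm ht hz]
  refine intervalIntegral.integral_congr fun s hs => ?_
  rw [Set.uIcc_of_le ht.le] at hs
  rw [(isCharacteristic_curveAt ht hz).characteristic_eqOn hm hs]

/-- The curves of different lengths fit together. -/
theorem curveAt_eqOn (hm : IsMetric U g) {s T : ℝ} (hs : 0 < s) (hsT : s ≤ T)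
    (hzs : dilation s z ∈ Φ.good) (hzT : dilation T z ∈ Φ.good) :
    Set.EqOn (Φ.curveAt s z) (Φ.curveAt T z) (Set.Icc 0 s) :=
  (isCharacteristic_curveAt hs hzs).eqOn hm
    ((isCharacteristic_curveAt (hs.trans_le hsT) hzT).mono hsT)

theorem isOpen_goodTimes (z : Phase d) : IsOpen {s : ℝ | dilation s z ∈ Φ.good} :=
  Φ.isOpen_good.preimage (contDiff_dilation.continuous.comp (by fun_prop : Continuous
    fun s : ℝ => (s, z)))

/-- In `stateAt` and `actionAt` the rescaling changes with `t`. To differentiate them in time, they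
are compared near `t` with one fixed characteristic on a longer interval, of which `t` is an
interior point. -/
theorem exists_longer (ht : 0 < t) (hz : dilation t z ∈ Φ.good) :
    ∃ T > t, dilation T z ∈ Φ.good ∧ ∀ᶠ s in nhds t, 0 < s ∧ s < T ∧ dilation s z ∈ Φ.good := by
  have h1 : ∀ᶠ s in nhds t, dilation s z ∈ Φ.good := (isOpen_goodTimes z).mem_nhds hz
  obtain ⟨T, hT, hTt⟩ :=
    ((h1.filter_mono nhdsWithin_le_nhds).and (self_mem_nhdsWithin (s := Set.Ioi t))).exists
  refine ⟨T, hTt, hT, ?_⟩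
  filter_upwards [h1, lt_mem_nhds ht, gt_mem_nhds hTt] with s a b c using ⟨b, c, a⟩

theorem hasDerivAt_stateAt (hm : IsMetric U g) (ht : 0 < t) (hz : dilation t z ∈ Φ.good) :
    HasDerivAt (fun s => Φ.stateAt s z) (hamiltonField g (Φ.stateAt t z)) t := by
  obtain ⟨T, hT, hzT, hev⟩ := exists_longer ht hz
  have heq : ∀ s, 0 < s ∧ s < T ∧ dilation s z ∈ Φ.good → Φ.stateAt s z = Φ.curveAt T z s := by
    rintro s ⟨h1, h2, h3⟩
    rw [← curveAt_self h1]
    exact curveAt_eqOn hm h1 h2.le h3 hzT (Set.right_mem_Icc.2 h1.le)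
  rw [heq t hev.self_of_nhds]
  exact (((isCharacteristic_curveAt (ht.trans hT) hzT).2 t ⟨ht.le, hT.le⟩).2.hasDerivAt
    (Icc_mem_nhds ht hT)).congr_of_eventuallyEq (hev.mono heq)

theorem hasDerivAt_actionAt (hm : IsMetric U g) (ht : 0 < t) (hz : dilation t z ∈ Φ.good) :
    HasDerivAt (fun s => Φ.actionAt s z) (lagrangian g (Φ.stateAt t z)) t := by
  obtain ⟨T, hT, hzT, hev⟩ := exists_longer ht hz
  have hst : Φ.stateAt t z = Φ.curveAt T z t := by
    rw [← curveAt_self ht]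
    exact curveAt_eqOn hm ht hT.le hz hzT (Set.right_mem_Icc.2 ht.le)
  have heq : ∀ s, 0 < s ∧ s < T ∧ dilation s z ∈ Φ.good →
      Φ.actionAt s z = ∫ r in (0 : ℝ)..s, lagrangian g (Φ.curveAt T z r) := by
    rintro s ⟨h1, h2, h3⟩
    rw [← integral_curveAt hm h1 h3]
    refine intervalIntegral.integral_congr fun r hr => ?_
    rw [Set.uIcc_of_le h1.le] at hr
    rw [curveAt_eqOn hm h1 h2.le h3 hzT hr]
  have hc : Continuous fun r => lagrangian g (Φ.curveAt T z r) :=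
    hm.contDiffOn_lagrangian.continuousOn.comp_continuous continuous_curveAt (curveAt_mem hzT)
  rw [hst]
  exact (intervalIntegral.integral_hasDerivAt_right (hc.intervalIntegrable _ _)
    hc.stronglyMeasurable.stronglyMeasurableAtFilter hc.continuousAt).congr_of_eventuallyEq
      (hev.mono heq)

theorem contDiffAt_stateAt (ht : t ≠ 0) :
    ContDiffAt ℝ ∞ (fun w : ℝ × Phase d => Φ.stateAt w.1 w.2) (t, z) := by
  have h1 : ContDiffAt ℝ ∞ (fun w : ℝ × Phase d => Φ.endVal (dilation w.1 w.2)) (t, z) :=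
    (ContDiff.comp (g := Φ.endVal) (f := fun w : ℝ × Phase d => dilation w.1 w.2)
      contDiff_endVal contDiff_dilation).contDiffAt
  have h2 : ContDiffAt ℝ ∞ (fun w : ℝ × Phase d => w.1⁻¹) (t, z) := contDiffAt_fst.inv ht
  exact ContDiffAt.comp (g := fun w : ℝ × Phase d => dilation w.1 w.2)
    (f := fun w : ℝ × Phase d => (w.1⁻¹, Φ.endVal (dilation w.1 w.2))) (t, z)
    contDiff_dilation.contDiffAt (h2.prodMk h1)

/-- The first variation of the action with respect to the momenta. -/
theorem fderiv_actionAt (hm : IsMetric U g) (ht : 0 < t) {a ζ : E d × E d}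
    (hz : dilation t ((a.1, a.2, ζ) : Phase d) ∈ Φ.good) (v : E d × E d) :
    HasFDerivAt (fun ζ => prXY (Φ.stateAt t (a.1, a.2, ζ)))
      (((posDilation t⁻¹).comp (Φ.expDeriv (posDilation t a) (momDilation t ζ))).comp
        (momDilation t)) ζ ∧
    DifferentiableAt ℝ (fun ζ => Φ.actionAt t (a.1, a.2, ζ)) ζ ∧
    fderiv ℝ (fun ζ => Φ.actionAt t (a.1, a.2, ζ)) ζ v =
      inner ℝ (Φ.stateAt t (a.1, a.2, ζ)).2.2.1
        (((posDilation t⁻¹).comp (Φ.expDeriv (posDilation t a) (momDilation t ζ))).comp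
        (momDilation t) v).1 +
      inner ℝ (Φ.stateAt t (a.1, a.2, ζ)).2.2.2
        (((posDilation t⁻¹).comp (Φ.expDeriv (posDilation t a) (momDilation t ζ))).comp
        (momDilation t) v).2 := by
  have h0 : HasFDerivAt (fun ζ : E d × E d => dilation t ((a.1, a.2, ζ) : Phase d))
      ((dilation t).comp embPQ) ζ :=
    (dilation t).hasFDerivAt.comp ζ ((hasFDerivAt_prodMk_right a.1 (a.2, ζ)).comp ζ
      (hasFDerivAt_prodMk_right a.2 ζ))
  refine ⟨?_, ?_⟩
  · have h1 := hasFDerivAt_expMap_slice (Φ := Φ) (posDilation t a) (momDilation t ζ)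
    exact (posDilation t⁻¹).hasFDerivAt.comp ζ (h1.comp ζ (momDilation t).hasFDerivAt)
  set z : Phase d := dilation t (a.1, a.2, ζ) with hzdef
  have h1 : HasFDerivAt Φ.action (fderiv ℝ Φ.action z) z :=
    ((contDiff_action.differentiable (by simp)) _).hasFDerivAt
  have h2 := (h1.comp ζ h0).const_mul ((t ^ 3)⁻¹)
  have h3 : HasFDerivAt (fun ζ => Φ.actionAt t (a.1, a.2, ζ)) _ ζ := h2
  refine ⟨h3.differentiableAt, ?_⟩
  rw [h3.fderiv]
  have h4 := fderiv_action hm hz ((dilation t) (embPQ v))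
  simp only [smul_apply, ContinuousLinearMap.comp_apply, smul_eq_mul, h4]
  have h5 : (Φ.stateAt t (a.1, a.2, ζ)).2.2.1 = t⁻¹ ^ 3 • (Φ.endVal z).2.2.1 := rfl
  have h6 : (Φ.stateAt t (a.1, a.2, ζ)).2.2.2 = t⁻¹ ^ 2 • (Φ.endVal z).2.2.2 := rfl
  have h7 : Φ.expDeriv (posDilation t a) (momDilation t ζ) (momDilation t v) =
    prXY (fderiv ℝ Φ.endVal z (dilation t (embPQ v))) := by
    simp [expDeriv, hzdef]
  rw [h5, h6, h7]
  simp only [posDilation_apply, prXY_apply, inner_smul_left, inner_smul_right]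
  -- The initial position does not vary, so the boundary term at time zero disappears.
  simp only [dilation_apply, embPQ_apply, smul_zero, inner_zero_right]
  simp only [conj_trivial]
  field_simp
  ring

end UnitFlow

/-! ### The two-point function and the Jacobian -/

/-- The data of a uniform local inverse of the end-point map near the zero section over `K`. -/
structure Chart (U : Set (E d)) (g : E d → Matrix (Fin d) (Fin d) ℝ) (K : Set (E d)) where
  Φ : UnitFlow U g K
  δ : ℝ
  r₀ : ℝ
  c₀ : ℝ
  O : Set (E d × E d)
  δ_pos : 0 < δ
  r₀_pos : 0 < r₀
  c₀_pos : 0 < c₀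
  isOpen_O : IsOpen O
  mem_O : ∀ x ∈ K, ∀ η : E d, ‖η‖ < c₀ → (x, η) ∈ O
  injOn : ∀ a ∈ O, Set.InjOn (fun ζ => Φ.expMap (a, ζ)) (Metric.ball 0 δ)
  good : ∀ a ∈ O, ∀ ζ ∈ Metric.ball (0 : E d × E d) δ, (a.1, a.2, ζ) ∈ Φ.good
  det_pos : ∀ a ∈ O, ∀ ζ ∈ Metric.ball (0 : E d × E d) δ, 0 < (Φ.expDeriv a ζ).det
  surj : ∀ a ∈ O, ∀ b ∈ Metric.ball a r₀, ∃ ζ ∈ Metric.ball 0 δ, Φ.expMap (a, ζ) = b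

/-- A neighbourhood of `K × {0}` contains all `(x, η)` with `x ∈ K` and `η` small. -/
theorem exists_tube {K : Set (E d)} (hK : IsCompact K) {O : Set (E d × E d)} (hO : IsOpen O)
    (h : ∀ x ∈ K, (x, 0) ∈ O) : ∃ c > 0, ∀ x ∈ K, ∀ η : E d, ‖η‖ < c → (x, η) ∈ O := by
  obtain ⟨u, v, -, hv, hKu, h0v, huv⟩ := generalized_tube_lemma hK
    (isCompact_singleton (x := (0 : E d))) hO (by rintro ⟨x, η⟩ ⟨hx, hη⟩; cases hη; exact h x hx)
  obtain ⟨c, hc, hcv⟩ := Metric.isOpen_iff.1 hv 0 (h0v rfl)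
  exact ⟨c, hc, fun x hx η hη => huv ⟨hKu hx, hcv (by simpa using hη)⟩⟩

theorem IsMetric.nonempty_chart {U : Set (E d)} {g : E d → Matrix (Fin d) (Fin d) ℝ}
    (hm : IsMetric U g) {K : Set (E d)} (hK : IsCompact K) (hKU : K ⊆ U) :
    Nonempty (Chart U g K) := by
  obtain ⟨Φ⟩ := hm.nonempty_unitFlow hK hKU
  obtain ⟨δ, hδ, r₀, hr₀, O, hO, hKO, h⟩ := Φ.exists_uniform_inverse hm hK hKU
  obtain ⟨c₀, hc₀, hcO⟩ := exists_tube hK hO hKO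
  exact ⟨⟨Φ, δ, r₀, c₀, O, hδ, hr₀, hc₀, hO, hcO, fun a ha => (h a ha).1,
    fun a ha ζ hζ => ((h a ha).2.1 ζ hζ).1, fun a ha ζ hζ => ((h a ha).2.1 ζ hζ).2,
    fun a ha => (h a ha).2.2⟩⟩

namespace Chart

variable {U : Set (E d)} {g : E d → Matrix (Fin d) (Fin d) ℝ} {K : Set (E d)} (X : Chart U g K)

/-- The pairs of positions joined by a short characteristic in unit time. -/
def dom : Set ((E d × E d) × (E d × E d)) := {w | w.1 ∈ X.O ∧ w.2 ∈ Metric.ball w.1 X.r₀}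

/-- The momenta of the short characteristic in unit time. -/
def inv (w : (E d × E d) × (E d × E d)) : E d × E d :=
  Classical.epsilon fun ζ => ζ ∈ Metric.ball 0 X.δ ∧ X.Φ.expMap (w.1, ζ) = w.2

/-- The two-point function for unit time. -/
def action₁ (w : (E d × E d) × (E d × E d)) : ℝ := X.Φ.action (w.1.1, w.1.2, X.inv w)

/-- The Jacobian for unit time. -/
def jac₁ (w : (E d × E d) × (E d × E d)) : ℝ := (X.Φ.expDeriv w.1 (X.inv w)).det

/-- The amplitude for unit time. -/
def amp₁ (w : (E d × E d) × (E d × E d)) : ℝ := (Real.sqrt (X.jac₁ w))⁻¹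

/-- The times and positions joined to `a` by a short characteristic. -/
def timeDom (a : E d × E d) : Set (ℝ × E d × E d) :=
  {w | 0 < w.1 ∧ (posDilation w.1 a, posDilation w.1 w.2) ∈ X.dom}

/-- The rescaled pair of positions. -/
def rescale (a : E d × E d) (w : ℝ × E d × E d) : (E d × E d) × (E d × E d) :=
  (posDilation w.1 a, posDilation w.1 w.2)

variable {X}

theorem isOpen_dom : IsOpen X.dom :=
  (X.isOpen_O.preimage continuous_fst).inter
    (isOpen_lt (continuous_snd.dist continuous_fst) continuous_const)

theorem contDiff_rescale (a : E d × E d) : ContDiff ℝ ∞ (rescale a) := by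
  have h : rescale a = fun w : ℝ × E d × E d => ((a.1, w.1 • a.2), (w.2.1, w.1 • w.2.2)) := rfl
  rw [h]; fun_prop

theorem isOpen_timeDom (a : E d × E d) : IsOpen (X.timeDom a) :=
  (isOpen_lt continuous_const continuous_fst).inter
    (isOpen_dom.preimage (contDiff_rescale a).continuous)

theorem inv_spec {w : (E d × E d) × (E d × E d)} (hw : w ∈ X.dom) :
    X.inv w ∈ Metric.ball 0 X.δ ∧ X.Φ.expMap (w.1, X.inv w) = w.2 :=
  Classical.epsilon_spec (p := fun ζ => ζ ∈ Metric.ball 0 X.δ ∧ X.Φ.expMap (w.1, ζ) = w.2)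
    (X.surj _ hw.1 _ hw.2)

theorem inv_expMap {a ζ : E d × E d} (ha : a ∈ X.O) (hζ : ζ ∈ Metric.ball 0 X.δ) :
    X.inv (a, X.Φ.expMap (a, ζ)) = ζ := by
  have h := Classical.epsilon_spec
    (p := fun ζ' => ζ' ∈ Metric.ball 0 X.δ ∧ X.Φ.expMap (a, ζ') = X.Φ.expMap (a, ζ)) ⟨ζ, hζ, rfl⟩
  exact X.injOn a ha h.1 hζ h.2

theorem contDiffAt_inv {w : (E d × E d) × (E d × E d)} (hw : w ∈ X.dom) :
    ContDiffAt ℝ ∞ X.inv w := by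
  obtain ⟨h1, h2⟩ := inv_spec hw
  obtain ⟨a, b⟩ := w
  refine contDiffAt_inverse_family UnitFlow.contDiff_expMap X.isOpen_O Metric.isOpen_ball hw.1 h1 h2
    (fun a' ha' ζ hζ => inv_expMap ha' hζ) ?_
  rw [← UnitFlow.expDeriv_eq]
  exact injective_of_det_ne_zero (X.det_pos a hw.1 _ h1).ne'

theorem contDiffOn_inv : ContDiffOn ℝ ∞ X.inv X.dom :=
  fun _ hw => (contDiffAt_inv hw).contDiffWithinAt

theorem contDiffOn_action₁ : ContDiffOn ℝ ∞ X.action₁ X.dom :=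
  ContDiff.comp_contDiffOn (g := X.Φ.action) UnitFlow.contDiff_action
    ((contDiff_fst.fst.contDiffOn).prodMk ((contDiff_fst.snd.contDiffOn).prodMk contDiffOn_inv))

theorem contDiffOn_jac₁ : ContDiffOn ℝ ∞ X.jac₁ X.dom := by
  have h1 : ContDiff ℝ ∞ fun w : (E d × E d) × (E d × E d) => X.Φ.expDeriv w.1 w.2 := by
    simp only [UnitFlow.expDeriv_eq]
    exact (UnitFlow.contDiff_expMap.fderiv_right (by simp)).clm_comp contDiff_const
  exact (contDiff_det.comp h1).comp_contDiffOn
    (f := fun w : (E d × E d) × (E d × E d) => (w.1, X.inv w))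
    (contDiff_fst.contDiffOn.prodMk contDiffOn_inv)

theorem jac₁_pos {w : (E d × E d) × (E d × E d)} (hw : w ∈ X.dom) : 0 < X.jac₁ w :=
  X.det_pos _ hw.1 _ (inv_spec hw).1

theorem amp₁_pos {w : (E d × E d) × (E d × E d)} (hw : w ∈ X.dom) : 0 < X.amp₁ w :=
  inv_pos.2 (Real.sqrt_pos.2 (jac₁_pos hw))

theorem contDiffOn_amp₁ : ContDiffOn ℝ ∞ X.amp₁ X.dom :=
  (contDiffOn_jac₁.sqrt fun _ hw => (jac₁_pos hw).ne').inv fun _ hw =>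
    (Real.sqrt_pos.2 (jac₁_pos hw)).ne'

theorem good_of_mem {t : ℝ} {a ζ : E d × E d} (ha : posDilation t a ∈ X.O)
    (hζ : momDilation t ζ ∈ Metric.ball 0 X.δ) :
    dilation t ((a.1, a.2, ζ) : Phase d) ∈ X.Φ.good := by
  rw [dilation_mk]; exact X.good _ ha _ hζ

/-- Products carry the maximum norm, so the polydisc of momenta is a single ball of radius `δ`,
independent of `t`, in rescaled variables. -/
theorem mem_ball_iff_norm_lt {t : ℝ} (ht : 0 < t) {δ : ℝ} (ζ : E d × E d) :
    momDilation t ζ ∈ Metric.ball 0 δ ↔ ‖ζ.1‖ < δ / t ^ 3 ∧ ‖ζ.2‖ < δ / t ^ 2 := by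
  rw [mem_ball_zero_iff, Prod.norm_def, max_lt_iff]
  simp only [momDilation_apply, norm_smul, norm_pow, Real.norm_of_nonneg ht.le]
  rw [lt_div_iff₀ (by positivity), lt_div_iff₀ (by positivity), mul_comm, mul_comm (t ^ 2)]

theorem prXY_stateAt (t : ℝ) (a ζ : E d × E d) : prXY (X.Φ.stateAt t (a.1, a.2, ζ)) =
    posDilation t⁻¹ (X.Φ.expMap (posDilation t a, momDilation t ζ)) := rfl

/-- By uniqueness, any connecting characteristic coincides with the rescaled curve of the unit flow,
so the two-point problem at time `t` is the one at time 1 between rescaled positions. -/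
theorem isConnecting_iff (hm : IsMetric U g) {t : ℝ} (ht : 0 < t) {a b ζ : E d × E d}
    (ha : posDilation t a ∈ X.O) : IsConnecting g U X.δ t b.1 b.2 a.1 a.2 ζ ↔
      momDilation t ζ ∈ Metric.ball 0 X.δ ∧
        X.Φ.expMap (posDilation t a, momDilation t ζ) = posDilation t b := by
  rw [IsConnecting, ← and_assoc, ← mem_ball_iff_norm_lt ht]
  refine and_congr_right fun hζ => ?_
  have hz := good_of_mem ha hζ
  have hchar := UnitFlow.isCharacteristic_curveAt ht hz
  have hend : posDilation t (prXY (X.Φ.stateAt t (a.1, a.2, ζ))) =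
      X.Φ.expMap (posDilation t a, momDilation t ζ) := by
    rw [prXY_stateAt, posDilation_inv' ht.ne']
  constructor
  · rintro ⟨γ, hγ, h1, h2⟩
    have h3 := hγ.eqOn hm hchar (Set.right_mem_Icc.2 ht.le)
    rw [UnitFlow.curveAt_self ht] at h3
    rw [← hend, ← h3]
    simp [h1, h2]
  · intro h
    refine ⟨_, hchar, ?_⟩
    rw [UnitFlow.curveAt_self ht]
    rw [← hend] at h
    have h4 := congrArg (posDilation t⁻¹) h
    rw [posDilation_inv ht.ne', posDilation_inv ht.ne'] at h4
    exact ⟨congrArg Prod.fst h4, congrArg Prod.snd h4⟩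

/-! ### Reduction of the two-point function and the Jacobian to unit time. -/

section TimeDom

variable {a : E d × E d} {w : ℝ × E d × E d}

/-- The momenta of the short characteristic. -/
theorem isConnecting_unique_iff (hm : IsMetric U g) (hw : w ∈ X.timeDom a) (ζ : E d × E d) :
    IsConnecting g U X.δ w.1 w.2.1 w.2.2 a.1 a.2 ζ ↔
      ζ = momDilation w.1⁻¹ (X.inv (rescale a w)) := by
  obtain ⟨ht, hd⟩ := hw
  obtain ⟨h1, h2⟩ := inv_spec hd
  rw [isConnecting_iff hm ht hd.1]
  constructor
  · rintro ⟨h3, h4⟩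
    have h5 := X.injOn _ hd.1 h3 h1 (h4.trans h2.symm)
    rw [rescale, ← h5, momDilation_inv ht.ne']
  · rintro rfl
    rw [momDilation_inv' ht.ne']
    exact ⟨h1, h2⟩

theorem existsUnique_isConnecting (hm : IsMetric U g) (hw : w ∈ X.timeDom a) :
    ∃! ζ, IsConnecting g U X.δ w.1 w.2.1 w.2.2 a.1 a.2 ζ :=
  ⟨_, (isConnecting_unique_iff hm hw _).2 rfl, fun _ h => (isConnecting_unique_iff hm hw _).1 h⟩

theorem momenta_eq (hm : IsMetric U g) (hw : w ∈ X.timeDom a) :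
    momenta g U X.δ w.1 w.2.1 w.2.2 a.1 a.2 = momDilation w.1⁻¹ (X.inv (rescale a w)) :=
  (isConnecting_unique_iff hm hw _).1 (Classical.epsilon_spec (existsUnique_isConnecting hm hw).exists)

theorem good_momenta (hm : IsMetric U g) (hw : w ∈ X.timeDom a) :
    dilation w.1 ((a.1, a.2, momenta g U X.δ w.1 w.2.1 w.2.2 a.1 a.2) : Phase d) ∈ X.Φ.good := by
  refine good_of_mem hw.2.1 ?_
  rw [momenta_eq hm hw, momDilation_inv' hw.1.ne']
  exact (inv_spec hw.2).1

theorem phaseS_eq_actionAt (hm : IsMetric U g) (hw : w ∈ X.timeDom a) :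
    phaseS g U X.δ w.1 w.2.1 w.2.2 a.1 a.2 =
      X.Φ.actionAt w.1 (a.1, a.2, momenta g U X.δ w.1 w.2.1 w.2.2 a.1 a.2) :=
  UnitFlow.integral_characteristic hm hw.1 (good_momenta hm hw)

/-- The Lagrangian has weight 4, and the integration over time removes one power. -/
theorem phaseS_eq (hm : IsMetric U g) (hw : w ∈ X.timeDom a) :
    phaseS g U X.δ w.1 w.2.1 w.2.2 a.1 a.2 = (w.1 ^ 3)⁻¹ * X.action₁ (rescale a w) := by
  rw [phaseS_eq_actionAt hm hw, UnitFlow.actionAt, dilation_mk, momenta_eq hm hw,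
    momDilation_inv' hw.1.ne']
  rfl

theorem endpoint_eq (hm : IsMetric U g) {t : ℝ} (ht : 0 < t) {ζ : E d × E d}
    (ha : posDilation t a ∈ X.O) (hζ : momDilation t ζ ∈ Metric.ball 0 X.δ) :
    endpoint g U t a.1 a.2 ζ = prXY (X.Φ.stateAt t (a.1, a.2, ζ)) := by
  rw [endpoint, UnitFlow.characteristic_self hm ht (good_of_mem ha hζ)]
  rfl

/-- `endpoint` is defined by a choice and is known only for short momenta. These form an open set,
which suffices for the derivative. -/
theorem fderiv_endpoint (hm : IsMetric U g) {t : ℝ} (ht : 0 < t) {ζ : E d × E d}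
    (ha : posDilation t a ∈ X.O) (hζ : momDilation t ζ ∈ Metric.ball 0 X.δ) :
    fderiv ℝ (endpoint g U t a.1 a.2) ζ =
      ((posDilation t⁻¹).comp (X.Φ.expDeriv (posDilation t a) (momDilation t ζ))).comp
        (momDilation t) := by
  have h1 := (UnitFlow.fderiv_actionAt hm ht (good_of_mem ha hζ) 0).1
  refine (h1.congr_of_eventuallyEq ?_).fderiv
  have h2 : ∀ᶠ ζ' in nhds ζ, momDilation t ζ' ∈ Metric.ball 0 X.δ :=
    (momDilation t).continuous.continuousAt.eventually_mem (Metric.isOpen_ball.mem_nhds hζ)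
  filter_upwards [h2] with ζ' hζ'
  exact endpoint_eq hm ht ha hζ'

/-- The dilation of the momenta contributes `t^(3d + 2d)`, the inverse dilation of the positions
`t^(-d)`. -/
theorem jacobian_eq (hm : IsMetric U g) (hw : w ∈ X.timeDom a) :
    jacobian g U X.δ w.1 w.2.1 w.2.2 a.1 a.2 = w.1 ^ (4 * d) * X.jac₁ (rescale a w) := by
  have ht := hw.1.ne'
  have h1 : momDilation w.1 (momDilation w.1⁻¹ (X.inv (rescale a w))) ∈ Metric.ball 0 X.δ := by
    rw [momDilation_inv' ht]; exact (inv_spec hw.2).1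
  rw [jacobian, momenta_eq hm hw, fderiv_endpoint hm hw.1 hw.2.1 h1, det_comp, det_comp,
    momDilation_inv' ht, det_posDilation, det_momDilation]
  rw [mul_right_comm, jac₁]
  congr 1
  rw [inv_pow, inv_mul_eq_div, div_eq_iff (pow_ne_zero _ ht), ← pow_add]
  congr 1; ring

theorem jacobian_pos (hm : IsMetric U g) (hw : w ∈ X.timeDom a) :
    0 < jacobian g U X.δ w.1 w.2.1 w.2.2 a.1 a.2 := by
  rw [jacobian_eq hm hw]
  exact mul_pos (pow_pos hw.1 _) (jac₁_pos hw.2)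

theorem amplitude_eq (hm : IsMetric U g) (hw : w ∈ X.timeDom a) :
    amplitude g U X.δ w.1 w.2.1 w.2.2 a.1 a.2 = (w.1 ^ (2 * d))⁻¹ * X.amp₁ (rescale a w) := by
  have h1 : w.1 ^ (4 * d) = (w.1 ^ (2 * d)) ^ 2 := by rw [← pow_mul]; congr 1; ring
  rw [amplitude, jacobian_eq hm hw, h1, Real.sqrt_mul (by positivity),
    Real.sqrt_sq (pow_nonneg hw.1.le _), mul_inv]
  rfl

theorem mapsTo_rescale (a : E d × E d) : Set.MapsTo (rescale a) (X.timeDom a) X.dom :=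
  fun _ hw => hw.2

theorem contDiffOn_phaseS (hm : IsMetric U g) (a : E d × E d) : ContDiffOn ℝ ∞
    (fun w : ℝ × E d × E d => phaseS g U X.δ w.1 w.2.1 w.2.2 a.1 a.2) (X.timeDom a) := by
  refine ContDiffOn.congr ?_ fun w hw => phaseS_eq hm hw
  exact ((contDiff_fst.pow 3).contDiffOn.inv fun w hw => pow_ne_zero _ hw.1.ne').mul
    (contDiffOn_action₁.comp (contDiff_rescale a).contDiffOn (mapsTo_rescale a))

theorem contDiffOn_jacobian (hm : IsMetric U g) (a : E d × E d) : ContDiffOn ℝ ∞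
    (fun w : ℝ × E d × E d => jacobian g U X.δ w.1 w.2.1 w.2.2 a.1 a.2) (X.timeDom a) := by
  refine ContDiffOn.congr ?_ fun w hw => jacobian_eq hm hw
  exact (contDiff_fst.pow _).contDiffOn.mul
    (contDiffOn_jac₁.comp (contDiff_rescale a).contDiffOn (mapsTo_rescale a))

theorem contDiffOn_amplitude (hm : IsMetric U g) (a : E d × E d) : ContDiffOn ℝ ∞
    (fun w : ℝ × E d × E d => amplitude g U X.δ w.1 w.2.1 w.2.2 a.1 a.2) (X.timeDom a) := by
  refine ContDiffOn.congr ?_ fun w hw => amplitude_eq hm hw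
  exact ((contDiff_fst.pow _).contDiffOn.inv fun w hw => pow_ne_zero _ hw.1.ne').mul
    (contDiffOn_amp₁.comp (contDiff_rescale a).contDiffOn (mapsTo_rescale a))

end TimeDom

theorem mem_polydisc_iff {r t : ℝ} (ht : 0 < t) {x₀ y₀ x y : E d} :
    (x, y) ∈ polydisc r t x₀ y₀ ↔
      posDilation t (x, y) ∈ Metric.ball (posDilation t (x₀, y₀)) r := by
  rw [polydisc, Set.mem_prod, Metric.mem_ball, Metric.mem_ball, Metric.mem_ball, Prod.dist_eq,
    max_lt_iff]
  simp only [posDilation_apply, dist_smul₀, Real.norm_of_nonneg ht.le]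
  rw [lt_div_iff₀ ht, mul_comm]

theorem mem_timeDom {x₀ : E d} (hx₀ : x₀ ∈ K) {y₀ : E d} {w : ℝ × E d × E d} (ht : 0 < w.1)
    (hy : w.1 * ‖y₀‖ < X.c₀) (hw : w.2 ∈ polydisc X.r₀ w.1 x₀ y₀) : w ∈ X.timeDom (x₀, y₀) :=
  ⟨ht, X.mem_O x₀ hx₀ (w.1 • y₀) (by rwa [norm_smul, Real.norm_of_nonneg ht.le]),
    (mem_polydisc_iff ht).1 hw⟩

end Chart

/-! ### The Hamilton-Jacobi equation and the transport equation -/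

theorem contDiffOn_matVec {P : Type*} [NormedAddCommGroup P] [NormedSpace ℝ P] {s : Set P}
    {A : P → Matrix (Fin d) (Fin d) ℝ} {y : P → E d}
    (hA : ∀ i j, ContDiffOn ℝ ∞ (fun x => A x i j) s) (hy : ContDiffOn ℝ ∞ y s) :
    ContDiffOn ℝ ∞ (fun w => matVec (A w) (y w)) s := by
  rw [contDiffOn_euclidean]
  intro i
  simp only [matVec_apply]
  exact ContDiffOn.sum fun j _ => (hA i j).mul
    ((EuclideanSpace.proj (𝕜 := ℝ) j).contDiff.comp_contDiffOn hy)

/-- The embeddings of the factors of space-time. -/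
def embTX : E d →L[ℝ] ℝ × E d × E d :=
  (ContinuousLinearMap.inr ℝ ℝ _).comp (ContinuousLinearMap.inl ℝ _ _)
def embTY : E d →L[ℝ] ℝ × E d × E d :=
  (ContinuousLinearMap.inr ℝ ℝ _).comp (ContinuousLinearMap.inr ℝ _ _)

@[simp] theorem embTX_apply (u : E d) : embTX u = (0, u, 0) := rfl
@[simp] theorem embTY_apply (u : E d) : embTY u = (0, 0, u) := rfl

theorem inner_partialGradient {P : Type*} [NormedAddCommGroup P] [NormedSpace ℝ P]
    (ι : E d →L[ℝ] P) (f : P → ℝ) (z : P) (v : E d) :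
    inner ℝ (partialGradient ι f z) v = fderiv ℝ f z (ι v) := by
  simp [partialGradient, InnerProductSpace.toDual_symm_apply]

/-- Mixed partial derivatives commute. -/
theorem hasDerivAt_fderiv_slice {P Q : Type*} [NormedAddCommGroup P] [NormedSpace ℝ P]
    [NormedAddCommGroup Q] [NormedSpace ℝ Q] {f : ℝ × P → Q} {t : ℝ} {ζ : P}
    (hf : ContDiffAt ℝ 2 f (t, ζ)) {D : P →L[ℝ] Q}
    (hD : HasFDerivAt (fun ζ' => fderiv ℝ f (t, ζ') (1, 0)) D ζ) :
    HasDerivAt (fun s => (fderiv ℝ f (s, ζ)).comp (ContinuousLinearMap.inr ℝ ℝ P)) D t := by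
  have h1 : HasFDerivAt (fderiv ℝ f) (fderiv ℝ (fderiv ℝ f) (t, ζ)) (t, ζ) :=
    ((hf.fderiv_right (m := 1) (by norm_num)).differentiableAt (by simp)).hasFDerivAt
  have h2 : HasDerivAt (fun s : ℝ => (s, ζ)) ((1 : ℝ), (0 : P)) t :=
    (hasDerivAt_id t).prodMk (hasDerivAt_const t ζ)
  have h3 : HasDerivAt (fun s => fderiv ℝ f (s, ζ)) (fderiv ℝ (fderiv ℝ f) (t, ζ) (1, 0)) t :=
    h1.comp_hasDerivAt t h2
  have h4 := h3.clm_comp (hasDerivAt_const t (ContinuousLinearMap.inr ℝ ℝ P))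
  refine h4.congr_deriv (ContinuousLinearMap.ext fun u => ?_)
  have h5 : HasFDerivAt (fun ζ' => fderiv ℝ f (t, ζ')) _ ζ :=
    h1.comp ζ (hasFDerivAt_prodMk_right t ζ)
  have h6 := h5.clm_apply (hasFDerivAt_const ((1 : ℝ), (0 : P)) ζ)
  have h7 := congrArg (fun T => T u) (hD.unique h6)
  have h8 := (hf.isSymmSndFDerivAt (by simp)) (1, 0) (0, u)
  simp at h7 h8 ⊢
  rw [h7, h8]

namespace Chart

variable {U : Set (E d)} {g : E d → Matrix (Fin d) (Fin d) ℝ} {K : Set (E d)} {X : Chart U g K}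
  {a : E d × E d}

/-- The two-point function of the starting position `a`. -/
def phase (X : Chart U g K) (a : E d × E d) (w : ℝ × E d × E d) : ℝ :=
  phaseS g U X.δ w.1 w.2.1 w.2.2 a.1 a.2

/-- The Jacobian of the starting position `a`. -/
def jac (X : Chart U g K) (a : E d × E d) (w : ℝ × E d × E d) : ℝ :=
  jacobian g U X.δ w.1 w.2.1 w.2.2 a.1 a.2

/-- The amplitude of the starting position `a`. -/
def amp (X : Chart U g K) (a : E d × E d) (w : ℝ × E d × E d) : ℝ :=
  amplitude g U X.δ w.1 w.2.1 w.2.2 a.1 a.2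

/-- The position at time `v.1` for the initial momenta `v.2`. -/
def endAt (X : Chart U g K) (a : E d × E d) (v : ℝ × E d × E d) : E d × E d :=
  prXY (X.Φ.stateAt v.1 (a.1, a.2, v.2))

/-- Times and momenta of short characteristics. -/
def momDom (X : Chart U g K) (a : E d × E d) : Set (ℝ × E d × E d) :=
  {v | (0 < v.1 ∧ posDilation v.1 a ∈ X.O ∧ momDilation v.1 v.2 ∈ Metric.ball 0 X.δ) ∧
    (v.1, X.endAt a v) ∈ X.timeDom a}

theorem contDiffAt_endAt {v : ℝ × E d × E d} (hv : 0 < v.1) :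
    ContDiffAt ℝ ∞ (X.endAt a) v := by
  have h1 := UnitFlow.contDiffAt_stateAt (Φ := X.Φ) (z := (a.1, a.2, v.2)) hv.ne'
  have h2 : ContDiffAt ℝ ∞ (fun v : ℝ × E d × E d => (v.1, ((a.1, a.2, v.2) : Phase d))) v := by
    fun_prop
  exact prXY.contDiff.contDiffAt.comp v (ContDiffAt.comp
    (g := fun w : ℝ × Phase d => X.Φ.stateAt w.1 w.2)
    (f := fun v : ℝ × E d × E d => (v.1, ((a.1, a.2, v.2) : Phase d))) v h1 h2)

theorem eventually_mem_momDom {v : ℝ × E d × E d} (hv : v ∈ X.momDom a) :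
    ∀ᶠ v' in nhds v, v' ∈ X.momDom a := by
  obtain ⟨⟨h1, h2, h3⟩, h4⟩ := hv
  have hc1 : Continuous fun v : ℝ × E d × E d => posDilation v.1 a := by
    simp only [posDilation_apply]; fun_prop
  have e1 : ∀ᶠ v' : ℝ × E d × E d in nhds v, 0 < v'.1 :=
    continuous_fst.continuousAt.eventually (lt_mem_nhds h1)
  have e2 := hc1.continuousAt.eventually_mem (X.isOpen_O.mem_nhds h2)
  have e3 := contDiff_momDilation.continuous.continuousAt.eventually_mem
    (Metric.isOpen_ball.mem_nhds h3)
  have e4 := (continuousAt_fst.prodMk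
    (contDiffAt_endAt (X := X) (a := a) h1).continuousAt).eventually_mem
      ((isOpen_timeDom a).mem_nhds h4)
  filter_upwards [e1, e2, e3, e4] with v' a1 a2 a3 a4 using ⟨⟨a1, a2, a3⟩, a4⟩

theorem momenta_endAt (hm : IsMetric U g) {v : ℝ × E d × E d} (hv : v ∈ X.momDom a) :
    momenta g U X.δ v.1 (X.endAt a v).1 (X.endAt a v).2 a.1 a.2 = v.2 := by
  rw [momenta_eq (w := (v.1, X.endAt a v)) hm hv.2]
  refine ((isConnecting_unique_iff (w := (v.1, X.endAt a v)) hm hv.2 _).1 ?_).symm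
  refine (isConnecting_iff (b := X.endAt a v) hm hv.1.1 hv.1.2.1).2 ⟨hv.1.2.2, ?_⟩
  rw [endAt, prXY_stateAt, posDilation_inv' hv.1.1.ne']

theorem momenta_mem_momDom (hm : IsMetric U g) {w : ℝ × E d × E d} (hw : w ∈ X.timeDom a) :
    ∃ ζ, (w.1, ζ) ∈ X.momDom a ∧ X.endAt a (w.1, ζ) = w.2 := by
  have h := (isConnecting_iff (b := w.2) hm hw.1 hw.2.1).1
    ((isConnecting_unique_iff hm hw _).2 rfl)
  have h2 : X.endAt a (w.1, momDilation w.1⁻¹ (X.inv (rescale a w))) = w.2 := by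
    rw [endAt, prXY_stateAt, h.2, posDilation_inv hw.1.ne']
  refine ⟨momDilation w.1⁻¹ (X.inv (rescale a w)), ⟨⟨hw.1, hw.2.1, h.1⟩, ?_⟩, h2⟩
  rw [h2]
  exact hw

theorem good_of_mem_momDom {v : ℝ × E d × E d} (hv : v ∈ X.momDom a) :
    dilation v.1 ((a.1, a.2, v.2) : Phase d) ∈ X.Φ.good := good_of_mem hv.1.2.1 hv.1.2.2

/-- In the coordinates `(t, p₀, q₀)` the implicit function `S` is explicit. Differentiating this
identity in the momenta gives the spatial gradient of `S`, and in time its time derivative. -/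
theorem phase_endAt (hm : IsMetric U g) {v : ℝ × E d × E d} (hv : v ∈ X.momDom a) :
    X.phase a (v.1, X.endAt a v) = X.Φ.actionAt v.1 (a.1, a.2, v.2) := by
  rw [phase, phaseS_eq_actionAt hm hv.2]
  simp only [momenta_endAt hm hv]

theorem hasFDerivAt_endAt_slice (hm : IsMetric U g) {v : ℝ × E d × E d} (hv : v ∈ X.momDom a) :
    HasFDerivAt (fun ζ => X.endAt a (v.1, ζ)) (fderiv ℝ (endpoint g U v.1 a.1 a.2) v.2) v.2 := by
  rw [fderiv_endpoint hm hv.1.1 hv.1.2.1 hv.1.2.2]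
  exact (UnitFlow.fderiv_actionAt hm hv.1.1 (good_of_mem_momDom hv) 0).1

theorem jac_endAt (hm : IsMetric U g) {v : ℝ × E d × E d} (hv : v ∈ X.momDom a) :
    X.jac a (v.1, X.endAt a v) =
      ((fderiv ℝ (X.endAt a) v).comp (ContinuousLinearMap.inr ℝ ℝ _)).det := by
  have h1 : HasFDerivAt (X.endAt a) (fderiv ℝ (X.endAt a) v) (v.1, v.2) :=
    ((contDiffAt_endAt hv.1.1).differentiableAt (by simp)).hasFDerivAt
  have h2 := HasFDerivAt.comp (g := X.endAt a) (f := fun ζ => (v.1, ζ)) v.2 h1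
    (hasFDerivAt_prodMk_right v.1 v.2)
  rw [jac, jacobian]
  simp only [momenta_endAt hm hv]
  rw [(hasFDerivAt_endAt_slice hm hv).unique h2]

theorem contDiffOn_phase (hm : IsMetric U g) : ContDiffOn ℝ ∞ (X.phase a) (X.timeDom a) :=
  contDiffOn_phaseS hm a

theorem contDiffOn_jac (hm : IsMetric U g) : ContDiffOn ℝ ∞ (X.jac a) (X.timeDom a) :=
  contDiffOn_jacobian hm a

theorem contDiffOn_amp (hm : IsMetric U g) : ContDiffOn ℝ ∞ (X.amp a) (X.timeDom a) :=
  contDiffOn_amplitude hm a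

theorem hasDerivAt_endAt (hm : IsMetric U g) {v : ℝ × E d × E d} (hv : v ∈ X.momDom a) :
    HasDerivAt (fun s => X.endAt a (s, v.2))
      (prXY (hamiltonField g (X.Φ.stateAt v.1 (a.1, a.2, v.2)))) v.1 :=
  prXY.hasFDerivAt.comp_hasDerivAt v.1
    (UnitFlow.hasDerivAt_stateAt hm hv.1.1 (good_of_mem_momDom hv))

theorem surjective_fderiv_endpoint (hm : IsMetric U g) {v : ℝ × E d × E d} (hv : v ∈ X.momDom a) :
    Function.Surjective (fderiv ℝ (endpoint g U v.1 a.1 a.2) v.2) := by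
  have hdet : (fderiv ℝ (endpoint g U v.1 a.1 a.2) v.2).det ≠ 0 := by
    have h1 := jacobian_pos hm hv.2
    rw [jacobian] at h1
    simp only [momenta_endAt hm hv] at h1
    exact h1.ne'
  exact (LinearMap.equivOfDetNeZero
    (fderiv ℝ (endpoint g U v.1 a.1 a.2) v.2 : E d × E d →ₗ[ℝ] E d × E d) hdet).surjective

theorem hasFDerivAt_phase (hm : IsMetric U g) {w : ℝ × E d × E d} (hw : w ∈ X.timeDom a) :
    HasFDerivAt (X.phase a) (fderiv ℝ (X.phase a) w) w :=
  (((contDiffOn_phase hm).contDiffAt ((isOpen_timeDom a).mem_nhds hw)).differentiableAt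
    (by simp)).hasFDerivAt

/-- The spatial gradient of the two-point function consists of the final momenta. -/
theorem fderiv_phase_space (hm : IsMetric U g) {v : ℝ × E d × E d} (hv : v ∈ X.momDom a)
    (u : E d × E d) : fderiv ℝ (X.phase a) (v.1, X.endAt a v) (0, u) =
      inner ℝ (X.Φ.stateAt v.1 (a.1, a.2, v.2)).2.2.1 u.1 +
        inner ℝ (X.Φ.stateAt v.1 (a.1, a.2, v.2)).2.2.2 u.2 := by
  have hS : HasFDerivAt (X.phase a) (fderiv ℝ (X.phase a) (v.1, X.endAt a v))
      (v.1, X.endAt a (v.1, v.2)) := hasFDerivAt_phase hm hv.2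
  have hM := hasFDerivAt_endAt_slice hm hv
  -- Every spatial direction is the image of a variation of the momenta, for which the first
  -- variation of the action applies.
  obtain ⟨u, rfl⟩ := surjective_fderiv_endpoint hm hv u
  have h0 := HasFDerivAt.comp (g := fun b : E d × E d => (v.1, b))
    (f := fun ζ' => X.endAt a (v.1, ζ')) v.2 (hasFDerivAt_prodMk_right v.1 _) hM
  have h1 := HasFDerivAt.comp (g := X.phase a)
    (f := fun ζ' => (v.1, X.endAt a (v.1, ζ'))) v.2 hS h0
  have h2 : (X.phase a ∘ fun ζ' => (v.1, X.endAt a (v.1, ζ'))) =ᶠ[nhds v.2]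
      fun ζ' => X.Φ.actionAt v.1 (a.1, a.2, ζ') := by
    have hc : ContinuousAt (fun ζ' : E d × E d => (v.1, ζ')) v.2 := by fun_prop
    filter_upwards [hc.eventually (eventually_mem_momDom hv)] with ζ' hζ'
    exact phase_endAt (v := (v.1, ζ')) hm hζ'
  have h3 := (UnitFlow.fderiv_actionAt hm hv.1.1 (good_of_mem_momDom hv) u).2.2
  have h4 := h1.fderiv
  rw [h2.fderiv_eq] at h4
  rw [fderiv_endpoint hm hv.1.1 hv.1.2.1 hv.1.2.2] at h4 ⊢
  rw [← h3, h4]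
  rfl

/-- The time derivative of the two-point function. -/
theorem fderiv_phase_time (hm : IsMetric U g) {v : ℝ × E d × E d} (hv : v ∈ X.momDom a) :
    fderiv ℝ (X.phase a) (v.1, X.endAt a v) (1, 0) =
      -hamiltonFun g (X.Φ.stateAt v.1 (a.1, a.2, v.2)) := by
  have hS : HasFDerivAt (X.phase a) (fderiv ℝ (X.phase a) (v.1, X.endAt a v))
      (v.1, X.endAt a (v.1, v.2)) := hasFDerivAt_phase hm hv.2
  have h0 : HasDerivAt (fun s => (s, X.endAt a (s, v.2))) _ v.1 :=
    (hasDerivAt_id v.1).prodMk (hasDerivAt_endAt hm hv)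
  have h1 := HasFDerivAt.comp_hasDerivAt (l := X.phase a)
    (f := fun s => (s, X.endAt a (s, v.2))) v.1 hS h0
  have h2 : (X.phase a ∘ fun s => (s, X.endAt a (s, v.2))) =ᶠ[nhds v.1]
      fun s => X.Φ.actionAt s (a.1, a.2, v.2) := by
    have hc : ContinuousAt (fun s : ℝ => (s, v.2)) v.1 := by fun_prop
    filter_upwards [hc.eventually (eventually_mem_momDom hv)] with s hs
    exact phase_endAt (v := (s, v.2)) hm hs
  have h3 := (h1.congr_of_eventuallyEq h2.symm).unique
    (UnitFlow.hasDerivAt_actionAt hm hv.1.1 (good_of_mem_momDom hv))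
  set Z := X.Φ.stateAt v.1 (a.1, a.2, v.2) with hZ
  -- Along a characteristic the total derivative of `S` is the Lagrangian. Removing the spatial part
  -- `p·x' + q·y'` leaves `-H`.
  have h4 : ((1 : ℝ), prXY (hamiltonField g Z)) = (1, 0) + (0, prXY (hamiltonField g Z)) := by simp
  rw [h4, map_add, fderiv_phase_space hm hv, IsMetric.lagrangian_eq_sub, ← hZ] at h3
  simp only [prXY_apply] at h3
  linarith

/-- The derivative of the two-point function in `y`, as a vector. -/
def gradY (X : Chart U g K) (a : E d × E d) (w : ℝ × E d × E d) : E d :=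
  partialGradient embTY (X.phase a) w

theorem stateAt_eq (hm : IsMetric U g) {v : ℝ × E d × E d} (hv : v ∈ X.momDom a) :
    ∃ p, X.Φ.stateAt v.1 (a.1, a.2, v.2) =
      ((X.endAt a v).1, (X.endAt a v).2, p, X.gradY a (v.1, X.endAt a v)) ∧
      ∀ u, fderiv ℝ (X.phase a) (v.1, X.endAt a v) (0, u, 0) = inner ℝ p u := by
  have h := fderiv_phase_space hm hv
  have hq : X.gradY a (v.1, X.endAt a v) = (X.Φ.stateAt v.1 (a.1, a.2, v.2)).2.2.2 := by
    refine ext_inner_right ℝ fun u => ?_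
    rw [gradY, inner_partialGradient, embTY_apply, h]
    simp
  refine ⟨(X.Φ.stateAt v.1 (a.1, a.2, v.2)).2.2.1, ?_, fun u => ?_⟩
  · rw [hq]; rfl
  · rw [h]; simp

theorem mem_of_timeDom (hm : IsMetric U g) {w : ℝ × E d × E d} (hw : w ∈ X.timeDom a) :
    w.2.1 ∈ U := by
  obtain ⟨ζ, hζ, h⟩ := momenta_mem_momDom hm hw
  rw [← h]
  exact UnitFlow.stateAt_mem (good_of_mem_momDom hζ)

/-- The time derivative of `S` is `-H` at the final state, and the final momenta are the spatial
derivatives of `S`. -/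
theorem hamilton_jacobi (hm : IsMetric U g) {w : ℝ × E d × E d} (hw : w ∈ X.timeDom a) :
    fderiv ℝ (X.phase a) w (1, 0, 0) +
      1 / 2 * inner ℝ (matVec (g w.2.1) (X.gradY a w)) (X.gradY a w)
      - fderiv ℝ (X.phase a) w (0, matVec (g w.2.1)⁻¹ w.2.2, 0)
      + 1 / 2 * fderiv ℝ (X.phase a) w (0, 0, gradient (energy g w.2.2) w.2.1) = 0 := by
  obtain ⟨ζ, hζ, h⟩ := momenta_mem_momDom hm hw
  obtain ⟨p, hp, hpx⟩ := stateAt_eq hm hζ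
  have h2 := fderiv_phase_time hm hζ
  rw [hp] at h2
  simp only [h, Prod.mk.eta] at h2 hpx
  have h3 : fderiv ℝ (X.phase a) w (0, 0, gradient (energy g w.2.2) w.2.1) =
      inner ℝ (gradient (energy g w.2.2) w.2.1) (X.gradY a w) := by
    rw [real_inner_comm, gradY, inner_partialGradient, embTY_apply]
  have h4 : ((1 : ℝ), (0 : E d), (0 : E d)) = (1, (0 : E d × E d)) := rfl
  rw [h4, h2, hpx, h3, hamiltonFun, hamiltonian, real_inner_comm p]
  ring

/-- The velocity field of the short characteristics from `a`. -/
def velocity (X : Chart U g K) (a : E d × E d) (w : ℝ × E d × E d) : E d × E d :=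
  (-matVec (g w.2.1)⁻¹ w.2.2,
    matVec (g w.2.1) (X.gradY a w) + (1 / 2 : ℝ) • gradient (energy g w.2.2) w.2.1)

theorem contDiffOn_gradY (hm : IsMetric U g) : ContDiffOn ℝ ∞ (X.gradY a) (X.timeDom a) :=
  contDiffOn_partialGradient _ (isOpen_timeDom a) (contDiffOn_phase hm)

theorem contDiffOn_velocity (hm : IsMetric U g) : ContDiffOn ℝ ∞ (X.velocity a) (X.timeDom a) := by
  have hx : Set.MapsTo (fun w : ℝ × E d × E d => w.2.1) (X.timeDom a) U :=
    fun w hw => mem_of_timeDom hm hw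
  have hx' : ContDiffOn ℝ ∞ (fun w : ℝ × E d × E d => w.2.1) (X.timeDom a) := by fun_prop
  refine (contDiffOn_matVec (A := fun w : ℝ × E d × E d => (g w.2.1)⁻¹)
    (fun i j => (hm.contDiffOn_inv i j).comp hx' hx) (by fun_prop)).neg.prodMk
    ((contDiffOn_matVec (A := fun w : ℝ × E d × E d => g w.2.1)
      (fun i j => (hm.smooth i j).comp hx' hx) (contDiffOn_gradY hm)).add (ContDiffOn.const_smul _ ?_))
  exact hm.contDiffOn_gradient_energy.comp (g := fun w : E d × E d => gradient (energy g w.2) w.1)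
    (f := fun w : ℝ × E d × E d => w.2) (by fun_prop) hx

theorem hasDerivAt_endAt_velocity (hm : IsMetric U g) {v : ℝ × E d × E d} (hv : v ∈ X.momDom a) :
    HasDerivAt (fun s => X.endAt a (s, v.2)) (X.velocity a (v.1, X.endAt a v)) v.1 := by
  refine (hasDerivAt_endAt hm hv).congr_deriv ?_
  obtain ⟨p, hp, -⟩ := stateAt_eq hm hv
  have hU : (X.endAt a v).1 ∈ U := mem_of_timeDom hm hv.2
  rw [prXY_apply, hp, hamiltonField_fst,
    hm.hamiltonField_snd (z := ((X.endAt a v).1, (X.endAt a v).2, p,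
      X.gradY a (v.1, X.endAt a v))) hU]
  rfl

/-- The Jacobian along characteristics. -/
theorem fderiv_jac (hm : IsMetric U g) {w : ℝ × E d × E d} (hw : w ∈ X.timeDom a) :
    fderiv ℝ (X.jac a) w (1, X.velocity a w) = LinearMap.trace ℝ _
      (((fderiv ℝ (X.velocity a) w).comp (ContinuousLinearMap.inr ℝ ℝ _) :
        E d × E d →L[ℝ] E d × E d) : E d × E d →ₗ[ℝ] E d × E d) * X.jac a w := by
  obtain ⟨ζ, hζ, h⟩ := momenta_mem_momDom hm hw
  obtain ⟨t, b⟩ := w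
  simp only at hζ h
  subst h
  have hJ : HasFDerivAt (X.jac a) (fderiv ℝ (X.jac a) (t, X.endAt a (t, ζ)))
      (t, X.endAt a (t, ζ)) := (((contDiffOn_jac hm).contDiffAt
        ((isOpen_timeDom a).mem_nhds hw)).differentiableAt (by simp)).hasFDerivAt
  have hV : HasFDerivAt (X.velocity a) (fderiv ℝ (X.velocity a) (t, X.endAt a (t, ζ)))
      (t, X.endAt a (t, ζ)) := (((contDiffOn_velocity hm).contDiffAt
        ((isOpen_timeDom a).mem_nhds hw)).differentiableAt (by simp)).hasFDerivAt
  have hE := contDiffAt_endAt (X := X) (a := a) (v := (t, ζ)) hζ.1.1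
  have hev := eventually_mem_momDom hζ
  have hslice : HasFDerivAt (fun ζ' => X.endAt a (t, ζ'))
      ((fderiv ℝ (X.endAt a) (t, ζ)).comp (ContinuousLinearMap.inr ℝ ℝ _)) ζ :=
    HasFDerivAt.comp (g := X.endAt a) (f := fun ζ' => (t, ζ')) ζ
      (hE.differentiableAt (by simp)).hasFDerivAt (hasFDerivAt_prodMk_right t ζ)
  -- The end point moves with the velocity field for all nearby momenta. Differentiating this in the
  -- momenta and interchanging the derivatives gives `M' = DV ∘ M` for the derivative `M` of the end
  -- point, and Liouville's formula applies.
  have hD : HasFDerivAt (fun ζ' => fderiv ℝ (X.endAt a) (t, ζ') (1, 0))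
      (((fderiv ℝ (X.velocity a) (t, X.endAt a (t, ζ))).comp (ContinuousLinearMap.inr ℝ ℝ _)).comp
        ((fderiv ℝ (X.endAt a) (t, ζ)).comp (ContinuousLinearMap.inr ℝ ℝ _))) ζ := by
    have h0 := HasFDerivAt.comp (g := fun b : E d × E d => (t, b))
      (f := fun ζ' => X.endAt a (t, ζ')) ζ (hasFDerivAt_prodMk_right t _) hslice
    have h1 := HasFDerivAt.comp (g := X.velocity a)
      (f := fun ζ' => (t, X.endAt a (t, ζ'))) ζ hV h0
    refine h1.congr_of_eventuallyEq ?_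
    have hc : ContinuousAt (fun ζ' : E d × E d => (t, ζ')) ζ := by fun_prop
    filter_upwards [hc.eventually hev] with ζ' hζ'
    have h2 : HasDerivAt (fun s => X.endAt a (s, ζ')) (fderiv ℝ (X.endAt a) (t, ζ') (1, 0)) t :=
      HasFDerivAt.comp_hasDerivAt (l := X.endAt a) (f := fun s => (s, ζ')) t
        ((contDiffAt_endAt (v := (t, ζ')) hζ'.1.1).differentiableAt (by simp)).hasFDerivAt
        ((hasDerivAt_id t).prodMk (hasDerivAt_const t ζ'))
    exact h2.unique (hasDerivAt_endAt_velocity (v := (t, ζ')) hm hζ')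
  have hM := hasDerivAt_fderiv_slice (hE.of_le (by norm_cast)) hD
  have hdet0 : ((fderiv ℝ (X.endAt a) (t, ζ)).comp (ContinuousLinearMap.inr ℝ ℝ _)).det ≠ 0 := by
    rw [← jac_endAt (v := (t, ζ)) hm hζ]
    exact (jacobian_pos hm hw).ne'
  have h1 := hasDerivAt_det hM hdet0
  have h2 : HasDerivAt (fun s => X.jac a (s, X.endAt a (s, ζ))) _ t :=
    HasFDerivAt.comp_hasDerivAt (l := X.jac a) (f := fun s => (s, X.endAt a (s, ζ))) t hJ
      ((hasDerivAt_id t).prodMk (hasDerivAt_endAt_velocity (v := (t, ζ)) hm hζ))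
  have h3 : (fun s => X.jac a (s, X.endAt a (s, ζ))) =ᶠ[nhds t] fun s =>
      ((fderiv ℝ (X.endAt a) (s, ζ)).comp (ContinuousLinearMap.inr ℝ ℝ _)).det := by
    have hc : ContinuousAt (fun s : ℝ => (s, ζ)) t := by fun_prop
    filter_upwards [hc.eventually hev] with s hs
    exact jac_endAt (v := (s, ζ)) hm hs
  rw [jac_endAt (v := (t, ζ)) hm hζ]
  exact (h2.congr_of_eventuallyEq h3.symm).unique h1

end Chart

/-! ### The transport equation -/

theorem inner_single_one (v : E d) (i : Fin d) : inner ℝ v (EuclideanSpace.single i 1) = v i := by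
  simp [EuclideanSpace.inner_single_right]

theorem sum_smul_single (v : E d) : ∑ i, v i • EuclideanSpace.single i (1 : ℝ) = v := by
  ext k
  simp [Pi.single_apply]

theorem IsMetric.gradient_energy_apply {U : Set (E d)} {g : E d → Matrix (Fin d) (Fin d) ℝ}
    (hm : IsMetric U g) {x : E d} (hx : x ∈ U) (y : E d) (i : Fin d) :
    gradient (energy g y) x i = ∑ k, ∑ j,
      fderiv ℝ (fun x' => (g x')⁻¹ k j) x (EuclideanSpace.single i 1) * y j * y k := by
  have h1 : ∀ k j, HasFDerivAt (fun x' => (g x')⁻¹ k j) (fderiv ℝ (fun x' => (g x')⁻¹ k j) x) x :=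
    fun k j => (((hm.contDiffOn_inv k j).contDiffAt (hm.isOpen.mem_nhds hx)).differentiableAt
      (by simp)).hasFDerivAt
  have h2 : HasFDerivAt (energy g y) (∑ k, ∑ j,
      (y k) • (y j) • fderiv ℝ (fun x' => (g x')⁻¹ k j) x) x := by
    have h3 : energy g y = fun x' => ∑ k, ∑ j, (g x')⁻¹ k j * y j * y k :=
      funext fun x' => inner_matVec _ _ _
    rw [h3]
    exact HasFDerivAt.fun_sum fun k _ => HasFDerivAt.fun_sum fun j _ =>
      ((h1 k j).mul_const (y j)).mul_const (y k)
  rw [← inner_single_one, gradient, InnerProductSpace.toDual_symm_apply, h2.fderiv]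
  simp only [sum_apply, smul_apply, smul_eq_mul]
  exact Finset.sum_congr rfl fun k _ => Finset.sum_congr rfl fun j _ => by ring

theorem sum_symm_single (c : Fin d → Fin d → ℝ) (hc : ∀ k j, c k j = c j k) (y : E d) (i : Fin d) :
    ∑ k, ∑ j, (c k j * (EuclideanSpace.single i (1 : ℝ) : E d) j * y k +
      c k j * y j * (EuclideanSpace.single i (1 : ℝ) : E d) k) = 2 * ∑ j, c i j * y j := by
  have h1 : ∀ k, ∑ j, c k j * (EuclideanSpace.single i (1 : ℝ) : E d) j * y k = c i k * y k := by
    intro k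
    rw [Finset.sum_eq_single i (by intro j _ hj; simp [hj]) (by simp), hc]
    simp
  have h2 : ∀ k, ∑ j, c k j * y j * (EuclideanSpace.single i (1 : ℝ) : E d) k =
      (∑ j, c k j * y j) * (EuclideanSpace.single i (1 : ℝ) : E d) k := fun k =>
    (Finset.sum_mul _ _ _).symm
  simp only [Finset.sum_add_distrib, h1, h2]
  rw [Finset.sum_eq_single (f := fun k => (∑ j, c k j * y j) *
    (EuclideanSpace.single i (1 : ℝ) : E d) k) i (by intro j _ hj; simp [hj]) (by simp)]
  simp [two_mul]

/-- Half the mixed derivative of the energy is the divergence of `G(x) y`, term by term. -/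
theorem IsMetric.hasLineDerivAt_gradient_energy {U : Set (E d)}
    {g : E d → Matrix (Fin d) (Fin d) ℝ} (hm : IsMetric U g) {x : E d} (hx : x ∈ U) (y : E d)
    (i : Fin d) : HasLineDerivAt ℝ (fun y' => gradient (energy g y') x i)
      (2 * ∑ j, fderiv ℝ (fun x' => (g x')⁻¹ i j) x (EuclideanSpace.single i 1) * y j) y
      (EuclideanSpace.single i 1) := by
  set c : Fin d → Fin d → ℝ := fun k j =>
    fderiv ℝ (fun x' => (g x')⁻¹ k j) x (EuclideanSpace.single i 1) with hc
  have hsymm : ∀ k j, c k j = c j k := by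
    intro k j
    have h : (fun x' => (g x')⁻¹ k j) =ᶠ[nhds x] fun x' => (g x')⁻¹ j k := by
      filter_upwards [hm.isOpen.mem_nhds hx] with x' hx'
      have := (hm.herm_inv hx').apply k j
      simpa using this.symm
    simp only [hc]
    rw [h.fderiv_eq]
  have h1 : ∀ k, HasDerivAt (fun s : ℝ => (y + s • EuclideanSpace.single i (1 : ℝ)) k)
      ((EuclideanSpace.single i (1 : ℝ) : E d) k) 0 := by
    intro k
    have := ((hasDerivAt_id (0 : ℝ)).mul_const ((EuclideanSpace.single i (1 : ℝ) : E d) k)).const_add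
      (y k)
    simpa using this
  have h2 : HasDerivAt (fun s : ℝ => ∑ k, ∑ j, c k j *
      (y + s • EuclideanSpace.single i (1 : ℝ)) j * (y + s • EuclideanSpace.single i (1 : ℝ)) k) _ 0 :=
    HasDerivAt.fun_sum fun k _ => HasDerivAt.fun_sum fun j _ =>
      ((h1 j).const_mul (c k j)).mul (h1 k)
  have h3 := funext fun y' => hm.gradient_energy_apply hx y' i
  rw [h3]
  refine HasDerivAt.congr_deriv h2 ?_
  simp only [zero_smul, add_zero]
  exact sum_symm_single c hsymm y i

namespace Chart

variable {U : Set (E d)} {g : E d → Matrix (Fin d) (Fin d) ℝ} {K : Set (E d)} {X : Chart U g K}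
  {a : E d × E d}

theorem gradY_apply (w : ℝ × E d × E d) (j : Fin d) :
    X.gradY a w j = fderiv ℝ (X.phase a) w (embTY (EuclideanSpace.single j 1)) := by
  rw [← inner_single_one, gradY, inner_partialGradient]

theorem hasFDerivAt_fderiv_phase (hm : IsMetric U g) {w : ℝ × E d × E d} (hw : w ∈ X.timeDom a) :
    HasFDerivAt (fderiv ℝ (X.phase a)) (fderiv ℝ (fderiv ℝ (X.phase a)) w) w :=
  ((((contDiffOn_phase hm).contDiffAt ((isOpen_timeDom a).mem_nhds hw)).fderiv_right
    (m := 1) (by norm_cast)).differentiableAt (by simp)).hasFDerivAt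

/-- The `x`-divergence of `-G(x) y` cancels against the `y`-divergence of half the gradient of the
energy, by the symmetry of `G`. Only the divergence of `g S_y` in `y` is left. -/
theorem trace_fderiv_velocity (hm : IsMetric U g) {w : ℝ × E d × E d} (hw : w ∈ X.timeDom a) :
    LinearMap.trace ℝ _ (((fderiv ℝ (X.velocity a) w).comp (ContinuousLinearMap.inr ℝ ℝ _) :
        E d × E d →L[ℝ] E d × E d) : E d × E d →ₗ[ℝ] E d × E d) =
      ∑ i, ∑ j, g w.2.1 i j * fderiv ℝ (fderiv ℝ (X.phase a)) w
        (embTY (EuclideanSpace.single i 1)) (embTY (EuclideanSpace.single j 1)) := by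
  have hx := mem_of_timeDom hm hw
  have hV : HasFDerivAt (X.velocity a) (fderiv ℝ (X.velocity a) w) w :=
    (((contDiffOn_velocity hm).contDiffAt
        ((isOpen_timeDom a).mem_nhds hw)).differentiableAt (by simp)).hasFDerivAt
  have h1 : ∀ i, (fderiv ℝ (X.velocity a) w (embTX (EuclideanSpace.single i 1))).1 i =
      -∑ j, fderiv ℝ (fun x' => (g x')⁻¹ i j) w.2.1 (EuclideanSpace.single i 1) * w.2.2 j := by
    intro i
    have e1 := (((EuclideanSpace.proj (𝕜 := ℝ) i).comp
      (ContinuousLinearMap.fst ℝ (E d) (E d))).hasFDerivAt.comp w hV).hasLineDerivAt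
        (embTX (EuclideanSpace.single i 1))
    have e2 : HasDerivAt (fun s : ℝ => -∑ j,
        (g (w.2.1 + s • EuclideanSpace.single i (1 : ℝ)))⁻¹ i j * w.2.2 j) _ 0 :=
      (HasDerivAt.fun_sum fun j _ => HasDerivAt.mul_const
        ((((hm.contDiffOn_inv i j).contDiffAt (hm.isOpen.mem_nhds hx)).differentiableAt
          (by simp)).hasFDerivAt.hasLineDerivAt (EuclideanSpace.single i 1)) (w.2.2 j)).neg
    refine HasDerivAt.unique e1 (e2.congr_of_eventuallyEq (Filter.Eventually.of_forall fun s => ?_))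
    simp [velocity, matVec_apply]
  have h2 : ∀ i, (fderiv ℝ (X.velocity a) w (embTY (EuclideanSpace.single i 1))).2 i =
      ∑ j, g w.2.1 i j * fderiv ℝ (fderiv ℝ (X.phase a)) w
        (embTY (EuclideanSpace.single i 1)) (embTY (EuclideanSpace.single j 1)) +
      ∑ j, fderiv ℝ (fun x' => (g x')⁻¹ i j) w.2.1 (EuclideanSpace.single i 1) * w.2.2 j := by
    intro i
    have e1 := (((EuclideanSpace.proj (𝕜 := ℝ) i).comp
      (ContinuousLinearMap.snd ℝ (E d) (E d))).hasFDerivAt.comp w hV).hasLineDerivAt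
        (embTY (EuclideanSpace.single i 1))
    have e3 := (hasFDerivAt_fderiv_phase hm hw).hasLineDerivAt (embTY (EuclideanSpace.single i 1))
    have e2 : HasDerivAt (fun s : ℝ => ∑ j, g w.2.1 i j *
        fderiv ℝ (X.phase a) (w + s • embTY (EuclideanSpace.single i 1))
          (embTY (EuclideanSpace.single j 1)) + 1 / 2 * gradient
            (energy g (w.2.2 + s • EuclideanSpace.single i (1 : ℝ))) w.2.1 i) _ 0 :=
      (HasDerivAt.fun_sum fun j _ => ((HasDerivAt.clm_apply e3
        (hasDerivAt_const (0 : ℝ) (embTY (EuclideanSpace.single j 1)))).const_mul (g w.2.1 i j))).add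
      (HasDerivAt.const_mul (1 / 2) (hm.hasLineDerivAt_gradient_energy hx w.2.2 i))
    have e4 := HasDerivAt.unique e1 (e2.congr_of_eventuallyEq
      (Filter.Eventually.of_forall fun s => by simp [velocity, matVec_apply, gradY_apply]))
    refine e4.trans ?_
    simp
  rw [trace_eq_sum, ← Finset.sum_add_distrib]
  refine Finset.sum_congr rfl fun i _ => ?_
  have := h1 i
  have := h2 i
  simp only [ContinuousLinearMap.comp_apply, ContinuousLinearMap.inr_apply, embTX_apply,
    embTY_apply] at *
  linarith

/-- The direction of differentiation in the parabolic operator. -/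
def drift (g : E d → Matrix (Fin d) (Fin d) ℝ) (b : E d × E d) : ℝ × E d × E d :=
  (1, -matVec (g b.1)⁻¹ b.2, (1 / 2 : ℝ) • gradient (energy g b.2) b.1)

theorem hamilton_jacobi_drift (hm : IsMetric U g) {w : ℝ × E d × E d} (hw : w ∈ X.timeDom a) :
    fderiv ℝ (X.phase a) w (drift g w.2) + 1 / 2 * ∑ i, ∑ j, g w.2.1 i j *
      fderiv ℝ (X.phase a) w (embTY (EuclideanSpace.single i 1)) *
      fderiv ℝ (X.phase a) w (embTY (EuclideanSpace.single j 1)) = 0 := by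
  have h := hamilton_jacobi hm hw
  have h1 : drift g w.2 = (1, 0, 0) - (0, matVec (g w.2.1)⁻¹ w.2.2, 0) +
      (1 / 2 : ℝ) • (0, 0, gradient (energy g w.2.2) w.2.1) := by
    simp [drift]
  have h2 : ∑ i, ∑ j, g w.2.1 i j *
      fderiv ℝ (X.phase a) w (embTY (EuclideanSpace.single i 1)) *
      fderiv ℝ (X.phase a) w (embTY (EuclideanSpace.single j 1)) =
      inner ℝ (matVec (g w.2.1) (X.gradY a w)) (X.gradY a w) := by
    rw [inner_matVec]
    refine Finset.sum_congr rfl fun i _ => Finset.sum_congr rfl fun j _ => ?_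
    rw [gradY_apply, gradY_apply]; ring
  rw [h1, h2, map_add, map_sub, map_smul, smul_eq_mul]
  linarith

/-- Along characteristics `J' = tr(g S_yy) J`, so `φ = J^(-1/2)` satisfies `φ' = -½ tr(g S_yy) φ`.
-/
theorem transport (hm : IsMetric U g) {w : ℝ × E d × E d} (hw : w ∈ X.timeDom a) :
    fderiv ℝ (X.amp a) w (drift g w.2) + ∑ i, ∑ j, g w.2.1 i j *
      fderiv ℝ (X.amp a) w (embTY (EuclideanSpace.single i 1)) *
      fderiv ℝ (X.phase a) w (embTY (EuclideanSpace.single j 1)) +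
      1 / 2 * X.amp a w * ∑ i, ∑ j, g w.2.1 i j * fderiv ℝ (fderiv ℝ (X.phase a)) w
        (embTY (EuclideanSpace.single i 1)) (embTY (EuclideanSpace.single j 1)) = 0 := by
  have hJ : HasFDerivAt (X.jac a) (fderiv ℝ (X.jac a) w) w := (((contDiffOn_jac hm).contDiffAt
    ((isOpen_timeDom a).mem_nhds hw)).differentiableAt (by simp)).hasFDerivAt
  have hpos : 0 < X.jac a w := jacobian_pos hm hw
  have hs : 0 < Real.sqrt (X.jac a w) := Real.sqrt_pos.2 hpos
  have hjac := fderiv_jac hm hw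
  rw [trace_fderiv_velocity hm hw] at hjac
  have hA : HasFDerivAt (X.amp a) _ w :=
    (hasDerivAt_inv hs.ne').comp_hasFDerivAt w (hJ.sqrt hpos.ne')
  have hamp : X.amp a w = (Real.sqrt (X.jac a w))⁻¹ := rfl
  -- The derivative along characteristics splits into the first-order part of the parabolic operator
  -- and the cross term `(g S_y, φ_y)`.
  have hdir : ((1 : ℝ), X.velocity a w) = drift g w.2 + ∑ i, ∑ j, (g w.2.1 i j *
      fderiv ℝ (X.phase a) w (embTY (EuclideanSpace.single j 1))) •
        embTY (EuclideanSpace.single i 1) := by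
    have h1 : ∑ i, ∑ j, (g w.2.1 i j *
      fderiv ℝ (X.phase a) w (embTY (EuclideanSpace.single j 1))) •
        embTY (EuclideanSpace.single i 1) = embTY (matVec (g w.2.1) (X.gradY a w)) := by
      simp only [← Finset.sum_smul, ← gradY_apply, ← matVec_apply, ← map_smul, ← map_sum,
        sum_smul_single]
    rw [h1]
    simp [drift, velocity, add_comm]
  have hmain : fderiv ℝ (X.amp a) w (1, X.velocity a w) = -(1 / 2 * X.amp a w *
      ∑ i, ∑ j, g w.2.1 i j * fderiv ℝ (fderiv ℝ (X.phase a)) w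
        (embTY (EuclideanSpace.single i 1)) (embTY (EuclideanSpace.single j 1))) := by
    rw [hA.fderiv, smul_apply, smul_apply, hjac, hamp]
    have hsq : Real.sqrt (X.jac a w) ^ 2 = X.jac a w := Real.sq_sqrt hpos.le
    simp only [smul_eq_mul]
    generalize (∑ i, ∑ j, g w.2.1 i j * fderiv ℝ (fderiv ℝ (X.phase a)) w
        (embTY (EuclideanSpace.single i 1)) (embTY (EuclideanSpace.single j 1))) = T
    rw [hsq]
    field_simp
  rw [hdir, map_add] at hmain
  simp only [map_sum, map_smul, smul_eq_mul] at hmain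
  have hcomm : ∑ i, ∑ j, g w.2.1 i j *
      fderiv ℝ (X.amp a) w (embTY (EuclideanSpace.single i 1)) *
      fderiv ℝ (X.phase a) w (embTY (EuclideanSpace.single j 1)) = ∑ i, ∑ j, g w.2.1 i j *
      fderiv ℝ (X.phase a) w (embTY (EuclideanSpace.single j 1)) *
      fderiv ℝ (X.amp a) w (embTY (EuclideanSpace.single i 1)) :=
    Finset.sum_congr rfl fun i _ => Finset.sum_congr rfl fun j _ => by ring
  rw [hcomm]
  linarith

end Chart

/-! ### The parabolic operator on products of amplitudes and exponentials -/

section SecondDerivatives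

variable {P : Type*} [NormedAddCommGroup P] [NormedSpace ℝ P]

theorem hasFDerivAt_fderiv_of_contDiffAt {f : P → ℝ} {w : P} (hf : ContDiffAt ℝ 2 f w) :
    HasFDerivAt (fderiv ℝ f) (fderiv ℝ (fderiv ℝ f) w) w :=
  ((hf.fderiv_right (m := 1) (by norm_num)).differentiableAt (by simp)).hasFDerivAt

theorem hasFDerivAt_of_contDiffAt {f : P → ℝ} {w : P} (hf : ContDiffAt ℝ 2 f w) :
    HasFDerivAt f (fderiv ℝ f w) w :=
  (hf.differentiableAt (by simp)).hasFDerivAt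

theorem fderiv_mul_apply {f k : P → ℝ} {w : P} (hf : ContDiffAt ℝ 2 f w) (hk : ContDiffAt ℝ 2 k w)
    (u : P) : fderiv ℝ (fun w => f w * k w) w u = f w * fderiv ℝ k w u + k w * fderiv ℝ f w u := by
  rw [((hasFDerivAt_of_contDiffAt hf).fun_mul (hasFDerivAt_of_contDiffAt hk)).fderiv]
  simp

theorem fderiv_fderiv_mul {f k : P → ℝ} {w : P} (hf : ContDiffAt ℝ 2 f w)
    (hk : ContDiffAt ℝ 2 k w) (u v : P) :
    fderiv ℝ (fderiv ℝ (fun w => f w * k w)) w u v =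
      f w * fderiv ℝ (fderiv ℝ k) w u v + fderiv ℝ f w u * fderiv ℝ k w v +
        (k w * fderiv ℝ (fderiv ℝ f) w u v + fderiv ℝ k w u * fderiv ℝ f w v) := by
  have h1 : fderiv ℝ (fun w => f w * k w) =ᶠ[nhds w]
      fun w => f w • fderiv ℝ k w + k w • fderiv ℝ f w := by
    filter_upwards [hf.eventually (by simp), hk.eventually (by simp)] with w' h2 h3
    exact ((hasFDerivAt_of_contDiffAt h2).fun_mul (hasFDerivAt_of_contDiffAt h3)).fderiv
  have h2 := ((hasFDerivAt_of_contDiffAt hf).fun_smul (hasFDerivAt_fderiv_of_contDiffAt hk)).fun_add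
    ((hasFDerivAt_of_contDiffAt hk).fun_smul (hasFDerivAt_fderiv_of_contDiffAt hf))
  rw [h1.fderiv_eq, h2.fderiv]
  simp

theorem fderiv_exp_apply {f : P → ℝ} {w : P} (hf : ContDiffAt ℝ 2 f w) (u : P) :
    fderiv ℝ (fun w => Real.exp (f w)) w u = Real.exp (f w) * fderiv ℝ f w u := by
  rw [(hasFDerivAt_of_contDiffAt hf).exp.fderiv]
  simp

theorem fderiv_fderiv_exp {f : P → ℝ} {w : P} (hf : ContDiffAt ℝ 2 f w) (u v : P) :
    fderiv ℝ (fderiv ℝ (fun w => Real.exp (f w))) w u v =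
      Real.exp (f w) * (fderiv ℝ (fderiv ℝ f) w u v + fderiv ℝ f w u * fderiv ℝ f w v) := by
  have h1 : fderiv ℝ (fun w => Real.exp (f w)) =ᶠ[nhds w]
      fun w => Real.exp (f w) • fderiv ℝ f w := by
    filter_upwards [hf.eventually (by simp)] with w' h2
    exact (hasFDerivAt_of_contDiffAt h2).exp.fderiv
  rw [h1.fderiv_eq,
    ((hasFDerivAt_of_contDiffAt hf).exp.fun_smul (hasFDerivAt_fderiv_of_contDiffAt hf)).fderiv]
  simp
  ring

theorem fderiv_fderiv_const_mul {f : P → ℝ} {w : P} (hf : ContDiffAt ℝ 2 f w) (c : ℝ) (u v : P) :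
    fderiv ℝ (fderiv ℝ (fun w => c * f w)) w u v = c * fderiv ℝ (fderiv ℝ f) w u v := by
  rw [fderiv_fderiv_mul contDiffAt_const hf]
  simp

end SecondDerivatives

/-- The contraction `∑ g_ij B_ij`. -/
def contract (A : Matrix (Fin d) (Fin d) ℝ) (B : Fin d → Fin d → ℝ) : ℝ := ∑ i, ∑ j, A i j * B i j

theorem contract_add (A : Matrix (Fin d) (Fin d) ℝ) (B B' : Fin d → Fin d → ℝ) :
    contract A (fun i j => B i j + B' i j) = contract A B + contract A B' := by
  simp [contract, mul_add, Finset.sum_add_distrib]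

theorem contract_mul (A : Matrix (Fin d) (Fin d) ℝ) (c : ℝ) (B : Fin d → Fin d → ℝ) :
    contract A (fun i j => c * B i j) = c * contract A B := by
  simp [contract, Finset.mul_sum, mul_left_comm]

theorem contract_swap {A : Matrix (Fin d) (Fin d) ℝ} (hA : A.IsHermitian)
    (B : Fin d → Fin d → ℝ) : contract A (fun i j => B j i) = contract A B := by
  rw [contract, contract, Finset.sum_comm]
  refine Finset.sum_congr rfl fun i _ => Finset.sum_congr rfl fun j _ => ?_
  have := hA.apply i j
  simp only [star_trivial] at this
  rw [this]

theorem abs_contract_le (A : Matrix (Fin d) (Fin d) ℝ) (B : Fin d → Fin d → ℝ) {m b : ℝ}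
    (hA : ∑ i, ∑ j, |A i j| ≤ m) (hb : 0 ≤ b) (hB : ∀ i j, |B i j| ≤ b) :
    |contract A B| ≤ m * b := by
  calc |contract A B| ≤ ∑ i, ∑ j, |A i j| * b := by
        refine (Finset.abs_sum_le_sum_abs _ _).trans (Finset.sum_le_sum fun i _ =>
          (Finset.abs_sum_le_sum_abs _ _).trans (Finset.sum_le_sum fun j _ => ?_))
        rw [abs_mul]
        exact mul_le_mul_of_nonneg_left (hB i j) (abs_nonneg _)
    _ = (∑ i, ∑ j, |A i j|) * b := by simp only [Finset.sum_mul]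
    _ ≤ m * b := mul_le_mul_of_nonneg_right hA hb

section WKB

variable {P : Type*} [NormedAddCommGroup P] [NormedSpace ℝ P]

/-- A second-order operator with frozen coefficients. -/
def frozenOp (A : Matrix (Fin d) (Fin d) ℝ) (h : ℝ) (ξ : P) (e : Fin d → P) (f : P → ℝ) (w : P) : ℝ :=
  h * fderiv ℝ f w ξ - h ^ 2 / 2 * contract A fun i j => fderiv ℝ (fderiv ℝ f) w (e i) (e j)

/-- Conjugation of the operator by `exp(-S/h)`, for a solution `S` of the Hamilton-Jacobi
equation. -/
theorem frozenOp_mul_exp {A : Matrix (Fin d) (Fin d) ℝ} (hA : A.IsHermitian) {h : ℝ} (hh : h ≠ 0)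
    {ξ : P} {e : Fin d → P} {ψ S : P → ℝ} {w : P} (hψ : ContDiffAt ℝ 2 ψ w)
    (hS : ContDiffAt ℝ 2 S w)
    (hHJ : fderiv ℝ S w ξ + 1 / 2 * contract A (fun i j => fderiv ℝ S w (e i) * fderiv ℝ S w (e j))
      = 0) :
    frozenOp A h ξ e (fun w => ψ w * Real.exp (-S w / h)) w = Real.exp (-S w / h) *
      (h * (fderiv ℝ ψ w ξ + contract A (fun i j => fderiv ℝ ψ w (e i) * fderiv ℝ S w (e j)) +
        1 / 2 * ψ w * contract A fun i j => fderiv ℝ (fderiv ℝ S) w (e i) (e j)) -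
        h ^ 2 / 2 * contract A fun i j => fderiv ℝ (fderiv ℝ ψ) w (e i) (e j)) := by
  have hSe : (fun w => Real.exp (-S w / h)) = fun w => Real.exp ((-h⁻¹) * S w) := by
    funext w; congr 1; field_simp
  have hcS : ContDiffAt ℝ 2 (fun w => (-h⁻¹) * S w) w := contDiffAt_const.mul hS
  have hE : ContDiffAt ℝ 2 (fun w => Real.exp (-S w / h)) w := by rw [hSe]; exact hcS.exp
  have hD : ∀ u, fderiv ℝ (fun w => (-h⁻¹) * S w) w u = (-h⁻¹) * fderiv ℝ S w u := fun u => by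
    rw [fderiv_mul_apply contDiffAt_const hS]; simp
  have hE0 : Real.exp ((-h⁻¹) * S w) = Real.exp (-S w / h) := by congr 1; field_simp
  have h1 : ∀ u, fderiv ℝ (fun w => ψ w * Real.exp (-S w / h)) w u =
      Real.exp (-S w / h) * (fderiv ℝ ψ w u - ψ w * fderiv ℝ S w u / h) := by
    intro u
    rw [fderiv_mul_apply hψ hE, hSe, fderiv_exp_apply hcS, hD, hE0]
    field_simp; ring
  have h2 : ∀ u v, fderiv ℝ (fderiv ℝ (fun w => ψ w * Real.exp (-S w / h))) w u v =
      Real.exp (-S w / h) * (fderiv ℝ (fderiv ℝ ψ) w u v +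
        ((-h⁻¹) * (fderiv ℝ ψ w u * fderiv ℝ S w v) + ((-h⁻¹) * (fderiv ℝ ψ w v * fderiv ℝ S w u) +
        ((-h⁻¹ * ψ w) * fderiv ℝ (fderiv ℝ S) w u v +
        (h⁻¹ ^ 2 * ψ w) * (fderiv ℝ S w u * fderiv ℝ S w v))))) := by
    intro u v
    rw [fderiv_fderiv_mul hψ hE, hSe, fderiv_fderiv_exp hcS, fderiv_exp_apply hcS,
      fderiv_exp_apply hcS, hD, hD, fderiv_fderiv_const_mul hS, hE0]
    ring
  rw [frozenOp]
  simp only [h1, h2, contract_mul, contract_add]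
  rw [contract_swap hA (fun i j => fderiv ℝ ψ w (e i) * fderiv ℝ S w (e j))]
  -- The Hamilton-Jacobi equation removes the terms of order `h⁰`.
  have hξ : fderiv ℝ S w ξ = -(1 / 2 * contract A (fun i j => fderiv ℝ S w (e i) * fderiv ℝ S w (e j)))
    := by linarith
  rw [hξ]
  field_simp
  ring

/-- The operator applied to `C χ φ exp(-S/h)`, where `S` solves the Hamilton-Jacobi equation and
`φ` the transport equation. -/
theorem frozenOp_wkb {A : Matrix (Fin d) (Fin d) ℝ} (hA : A.IsHermitian) {h : ℝ} (hh : h ≠ 0)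
    (C : ℝ) {ξ : P} {e : Fin d → P} {χ φ S : P → ℝ} {w : P} (hχ : ContDiffAt ℝ 2 χ w)
    (hφ : ContDiffAt ℝ 2 φ w) (hS : ContDiffAt ℝ 2 S w)
    (hHJ : fderiv ℝ S w ξ + 1 / 2 * contract A (fun i j => fderiv ℝ S w (e i) * fderiv ℝ S w (e j))
      = 0)
    (hT : fderiv ℝ φ w ξ + contract A (fun i j => fderiv ℝ φ w (e i) * fderiv ℝ S w (e j)) +
      1 / 2 * φ w * (contract A fun i j => fderiv ℝ (fderiv ℝ S) w (e i) (e j)) = 0) :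
    frozenOp A h ξ e (fun w => C * χ w * φ w * Real.exp (-S w / h)) w =
      -(h ^ 2 * C) * (Real.exp (-S w / h) *
      (1 / 2 * χ w * contract A (fun i j => fderiv ℝ (fderiv ℝ φ) w (e i) (e j)) +
        (1 / 2 * φ w * contract A (fun i j => fderiv ℝ (fderiv ℝ χ) w (e i) (e j)) +
        contract A (fun i j => fderiv ℝ χ w (e i) * fderiv ℝ φ w (e j)) -
        φ w / h * (fderiv ℝ χ w ξ +
          contract A fun i j => fderiv ℝ χ w (e i) * fderiv ℝ S w (e j))))) := by
  have hCχ : ContDiffAt ℝ 2 (fun w => C * χ w) w := contDiffAt_const.mul hχ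
  have hψ : ContDiffAt ℝ 2 (fun w => C * χ w * φ w) w := hCχ.mul hφ
  have hD : ∀ u, fderiv ℝ (fun w => C * χ w) w u = C * fderiv ℝ χ w u := fun u => by
    rw [fderiv_mul_apply contDiffAt_const hχ]; simp
  have h1 : ∀ u, fderiv ℝ (fun w => C * χ w * φ w) w u =
      C * χ w * fderiv ℝ φ w u + C * φ w * fderiv ℝ χ w u := fun u => by
    rw [fderiv_mul_apply hCχ hφ, hD]; ring
  have h2 : ∀ u v, fderiv ℝ (fderiv ℝ (fun w => C * χ w * φ w)) w u v =
      C * (χ w * fderiv ℝ (fderiv ℝ φ) w u v + (φ w * fderiv ℝ (fderiv ℝ χ) w u v +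
        (fderiv ℝ χ w u * fderiv ℝ φ w v + fderiv ℝ χ w v * fderiv ℝ φ w u))) := fun u v => by
    rw [fderiv_fderiv_mul hCχ hφ, fderiv_fderiv_const_mul hχ, hD, hD]; ring
  have h3 : ∀ i j, (C * χ w * fderiv ℝ φ w (e i) + C * φ w * fderiv ℝ χ w (e i)) *
      fderiv ℝ S w (e j) = C * χ w * (fderiv ℝ φ w (e i) * fderiv ℝ S w (e j)) +
        C * φ w * (fderiv ℝ χ w (e i) * fderiv ℝ S w (e j)) := fun i j => by ring
  rw [frozenOp_mul_exp hA hh hψ hS hHJ]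
  simp only [h1, h2, h3, contract_mul, contract_add]
  rw [contract_swap hA (fun i j => fderiv ℝ χ w (e i) * fderiv ℝ φ w (e j))]
  -- The transport equation removes the terms of order `h` in which `χ` is not differentiated.
  have hξ : fderiv ℝ φ w ξ = -(contract A (fun i j => fderiv ℝ φ w (e i) * fderiv ℝ S w (e j)) +
      1 / 2 * φ w * (contract A fun i j => fderiv ℝ (fderiv ℝ S) w (e i) (e j))) := by linarith
  rw [hξ]
  field_simp
  ring

end WKB

/-! ### Partial derivatives of functions on space-time. -/

section Slices

variable {f : ℝ × E d × E d → ℝ} {w : ℝ × E d × E d}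

theorem deriv_slice (hf : DifferentiableAt ℝ f w) :
    deriv (fun s => f (s, w.2.1, w.2.2)) w.1 = fderiv ℝ f w (1, 0) :=
  (HasFDerivAt.comp_hasDerivAt (l := f) (f := fun s => (s, w.2)) w.1 hf.hasFDerivAt
    ((hasDerivAt_id w.1).prodMk (hasDerivAt_const w.1 w.2))).deriv

theorem hasFDerivAt_embTX : HasFDerivAt (fun x' : E d => (w.1, x', w.2.2)) embTX w.2.1 :=
  (hasFDerivAt_prodMk_right w.1 (w.2.1, w.2.2)).comp w.2.1 (hasFDerivAt_prodMk_left w.2.1 w.2.2)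

theorem hasFDerivAt_embTY (y : E d) : HasFDerivAt (fun y' : E d => (w.1, w.2.1, y')) embTY y :=
  (hasFDerivAt_prodMk_right w.1 (w.2.1, y)).comp y (hasFDerivAt_prodMk_right w.2.1 y)

theorem fderiv_slice_fst (hf : DifferentiableAt ℝ f w) (v : E d) :
    fderiv ℝ (fun x' => f (w.1, x', w.2.2)) w.2.1 v = fderiv ℝ f w (embTX v) := by
  have h := (HasFDerivAt.comp (g := f) (f := fun x' => (w.1, x', w.2.2)) w.2.1 hf.hasFDerivAt
    hasFDerivAt_embTX).fderiv
  exact congrArg (fun T => T v) h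

theorem fderiv_slice_snd (hf : DifferentiableAt ℝ f w) :
    fderiv ℝ (fun y' => f (w.1, w.2.1, y')) w.2.2 = (fderiv ℝ f w).comp embTY :=
  (HasFDerivAt.comp (g := f) (f := fun y' => (w.1, w.2.1, y')) w.2.2 hf.hasFDerivAt
    (hasFDerivAt_embTY _)).fderiv

theorem fderiv_fderiv_slice_snd (hf : ContDiffAt ℝ 2 f w) (u v : E d) :
    fderiv ℝ (fderiv ℝ fun y' => f (w.1, w.2.1, y')) w.2.2 u v =
      fderiv ℝ (fderiv ℝ f) w (embTY u) (embTY v) := by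
  have h1 : (fderiv ℝ fun y' => f (w.1, w.2.1, y')) =ᶠ[nhds w.2.2]
      fun y' => (fderiv ℝ f (w.1, w.2.1, y')).comp embTY := by
    have hc : ContinuousAt (fun y' : E d => (w.1, w.2.1, y')) w.2.2 := by fun_prop
    filter_upwards [hc.eventually (hf.eventually (by simp))] with y' hy'
    exact fderiv_slice_snd (w := (w.1, w.2.1, y')) (hy'.differentiableAt (by simp))
  have h2 := HasFDerivAt.comp (g := fderiv ℝ f) (f := fun y' => (w.1, w.2.1, y')) w.2.2
    (hasFDerivAt_fderiv_of_contDiffAt hf) (hasFDerivAt_embTY _)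
  have h3 := h2.clm_comp (hasFDerivAt_const (embTY : E d →L[ℝ] _) w.2.2)
  rw [h1.fderiv_eq]
  rw [show (fun y' => (fderiv ℝ f (w.1, w.2.1, y')).comp embTY) = fun y' =>
    ((fderiv ℝ f ∘ fun y' => (w.1, w.2.1, y')) y').comp embTY from rfl, h3.fderiv]
  simp

end Slices

/-- At a single point the coefficients may be frozen, so the algebra for `frozenOp` applies without
differentiating `g`. -/
theorem parabolicOp_eq (g : E d → Matrix (Fin d) (Fin d) ℝ) (h : ℝ) (u : ℝ → E d → E d → ℝ)
    {w : ℝ × E d × E d}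
    (hu : ContDiffAt ℝ 2 (fun w : ℝ × E d × E d => u w.1 w.2.1 w.2.2) w) :
    parabolicOp g h u w.1 w.2.1 w.2.2 = frozenOp (g w.2.1) h (Chart.drift g w.2)
      (fun i => embTY (EuclideanSpace.single i 1)) (fun w => u w.1 w.2.1 w.2.2) w := by
  have hd := hu.differentiableAt (by simp)
  have h1 := deriv_slice hd
  have h2 := fderiv_slice_fst hd
  have h3 := fderiv_slice_snd hd
  have h4 := fderiv_fderiv_slice_snd hu
  simp only at h1 h2 h3 h4
  have hdrift : Chart.drift g w.2 = (1, 0) - embTX (matVec (g w.2.1)⁻¹ w.2.2) +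
      (1 / 2 : ℝ) • embTY (gradient (energy g w.2.2) w.2.1) := by
    simp [Chart.drift]
  rw [parabolicOp, frozenOp, h1, h2, hdrift]
  rw [show u w.1 w.2.1 = fun y' => u w.1 w.2.1 y' from rfl, h3]
  simp only [h4, map_add, map_sub, map_smul, contract, ContinuousLinearMap.comp_apply, smul_eq_mul]
  ring

/-! ### Cut-off functions -/

/-- Space-time points in the interior of the polydisc, by the rescaled distance. -/
theorem mem_polydisc_zero_iff {r t : ℝ} (ht : 0 < t) {b : E d × E d} :
    b ∈ polydisc r t (0 : E d) 0 ↔ ‖posDilation t b‖ < r := by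
  rw [show b = (b.1, b.2) from rfl, Chart.mem_polydisc_iff ht,
    show posDilation t ((0 : E d), (0 : E d)) = 0 from map_zero _, mem_ball_zero_iff]

theorem mem_polydisc_sub_iff {r t : ℝ} {a b : E d × E d} :
    b - a ∈ polydisc r t (0 : E d) 0 ↔ b ∈ polydisc r t a.1 a.2 := by
  simp [polydisc, Set.mem_prod, dist_eq_norm]

namespace IsCutoff

variable {r ε t₀ M : ℝ} {χ : ℝ → E d → E d → ℝ} {w : ℝ × E d × E d}

/-- A cut-off function as a function on space-time. -/
def _root_.StochGeodesic.uncurried (χ : ℝ → E d → E d → ℝ) (w : ℝ × E d × E d) : ℝ :=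
  χ w.1 w.2.1 w.2.2

theorem contDiffAt (hχ : IsCutoff r ε t₀ M χ) (ht : 0 < w.1) : ContDiffAt ℝ ∞ (uncurried χ) w :=
  hχ.smooth.contDiffAt ((isOpen_lt continuous_const continuous_fst).mem_nhds ht)

theorem contDiffAt_two (hχ : IsCutoff r ε t₀ M χ) (ht : 0 < w.1) :
    ContDiffAt ℝ 2 (uncurried χ) w := (hχ.contDiffAt ht).of_le (by norm_cast)

theorem norm_continuous : Continuous fun w : ℝ × E d × E d => ‖posDilation w.1 w.2‖ :=
  contDiff_posDilation.continuous.norm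

theorem eventually_eq_zero (hχ : IsCutoff r ε t₀ M χ) (ht : 0 < w.1)
    (hw : r < ‖posDilation w.1 w.2‖) : uncurried χ =ᶠ[nhds w] fun _ => 0 := by
  filter_upwards [continuous_fst.continuousAt.eventually (lt_mem_nhds ht),
    norm_continuous.continuousAt.eventually (lt_mem_nhds hw)] with w' h1 h2
  exact hχ.eq_zero _ h1 _ _ fun h => absurd ((mem_polydisc_zero_iff h1).1 h) h2.le.not_gt

theorem eventually_eq_one (hχ : IsCutoff r ε t₀ M χ) (ht : 0 < w.1)
    (hw : w.2 ∈ polydisc (r - ε) w.1 (0 : E d) 0) : uncurried χ =ᶠ[nhds w] fun _ => 1 := by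
  rw [mem_polydisc_zero_iff ht] at hw
  filter_upwards [continuous_fst.continuousAt.eventually (lt_mem_nhds ht),
    norm_continuous.continuousAt.eventually (gt_mem_nhds hw)] with w' h1 h2
  exact hχ.eq_one _ h1 _ _ ((mem_polydisc_zero_iff h1).2 h2)

theorem fderiv_of_eventuallyEq_const {f : ℝ × E d × E d → ℝ} {c : ℝ} (hf : f =ᶠ[nhds w] fun _ => c) :
    fderiv ℝ f w = 0 ∧ fderiv ℝ (fderiv ℝ f) w = 0 := by
  have h1 : fderiv ℝ f =ᶠ[nhds w] fun _ => 0 := by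
    filter_upwards [hf.eventuallyEq_nhds] with w' hw'
    rw [hw'.fderiv_eq]
    simp
  refine ⟨h1.eq_of_nhds, ?_⟩
  rw [h1.fderiv_eq]
  simp

/-- In the inner polydisc the derivatives of the cut-off function vanish. -/
theorem fderiv_eq_zero_of_mem (hχ : IsCutoff r ε t₀ M χ) (ht : 0 < w.1)
    (hw : w.2 ∈ polydisc (r - ε) w.1 (0 : E d) 0) :
    fderiv ℝ (uncurried χ) w = 0 ∧ fderiv ℝ (fderiv ℝ (uncurried χ)) w = 0 :=
  fderiv_of_eventuallyEq_const (hχ.eventually_eq_one ht hw)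

/-- Outside the polydisc, its boundary included, the derivatives of the cut-off function vanish. -/
theorem fderiv_eq_zero_of_notMem (hχ : IsCutoff r ε t₀ M χ) (hr : 0 < r) (ht : 0 < w.1)
    (hw : w.2 ∉ polydisc r w.1 (0 : E d) 0) :
    fderiv ℝ (uncurried χ) w = 0 ∧ fderiv ℝ (fderiv ℝ (uncurried χ)) w = 0 := by
  rw [mem_polydisc_zero_iff ht, not_lt] at hw
  have hk : Continuous fun l : ℝ => (w.1, l • w.2) := by fun_prop
  -- A boundary point is a limit of exterior points along its ray from the centre, at fixed time.
  -- The derivatives vanish at those points and are continuous.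
  have hlim : Filter.Tendsto (fun l : ℝ => (w.1, l • w.2)) (nhdsWithin 1 (Set.Ioi 1)) (nhds w) := by
    have := hk.continuousAt (x := 1) |>.tendsto
    simp only [one_smul] at this
    exact this.mono_left nhdsWithin_le_nhds
  have hout : ∀ᶠ l in nhdsWithin (1 : ℝ) (Set.Ioi 1),
      fderiv ℝ (uncurried χ) (w.1, l • w.2) = 0 ∧
        fderiv ℝ (fderiv ℝ (uncurried χ)) (w.1, l • w.2) = 0 := by
    filter_upwards [self_mem_nhdsWithin] with l hl
    have hl : 1 < l := hl
    refine fderiv_of_eventuallyEq_const (c := 0) (hχ.eventually_eq_zero ht ?_)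
    rw [map_smul, norm_smul, Real.norm_of_nonneg (by linarith)]
    nlinarith
  have h1 := (hχ.contDiffAt ht).fderiv_right (m := 1) (by norm_cast)
  have h2 := h1.fderiv_right (m := 0) (by norm_num)
  constructor
  · exact tendsto_nhds_unique ((h1.continuousAt.tendsto.comp hlim).congr' (hout.mono fun l hl => hl.1))
      tendsto_const_nhds
  · exact tendsto_nhds_unique ((h2.continuousAt.tendsto.comp hlim).congr' (hout.mono fun l hl => hl.2))
      tendsto_const_nhds

theorem abs_fderiv_time_le (hχ : IsCutoff r ε t₀ M χ) (ht : w.1 ∈ Set.Ioc 0 t₀) :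
    |fderiv ℝ (uncurried χ) w (1, 0)| ≤ M / w.1 := by
  rw [← deriv_slice ((hχ.contDiffAt_two ht.1).differentiableAt (by simp))]
  exact hχ.bound_t _ ht _ _

theorem abs_fderiv_fst_le (hχ : IsCutoff r ε t₀ M χ) (ht : w.1 ∈ Set.Ioc 0 t₀) (v : E d) :
    |fderiv ℝ (uncurried χ) w (embTX v)| ≤ M * ‖v‖ := by
  rw [← fderiv_slice_fst ((hχ.contDiffAt_two ht.1).differentiableAt (by simp))]
  exact ContinuousLinearMap.le_of_opNorm_le _ (hχ.bound_x _ ht _ _) v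

theorem abs_fderiv_snd_le (hχ : IsCutoff r ε t₀ M χ) (ht : w.1 ∈ Set.Ioc 0 t₀) (v : E d) :
    |fderiv ℝ (uncurried χ) w (embTY v)| ≤ M * ‖v‖ := by
  have h := fderiv_slice_snd ((hχ.contDiffAt_two ht.1).differentiableAt (by simp))
  have h2 := congrArg (fun T => T v) h
  simp only [ContinuousLinearMap.comp_apply] at h2
  rw [← h2]
  exact ContinuousLinearMap.le_of_opNorm_le _ (hχ.bound_y _ ht _ _) v

theorem abs_fderiv_fderiv_snd_le (hχ : IsCutoff r ε t₀ M χ) (ht : w.1 ∈ Set.Ioc 0 t₀) (u v : E d) :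
    |fderiv ℝ (fderiv ℝ (uncurried χ)) w (embTY u) (embTY v)| ≤ M * ‖u‖ * ‖v‖ := by
  rw [← fderiv_fderiv_slice_snd (hχ.contDiffAt_two ht.1)]
  exact ContinuousLinearMap.le_of_opNorm_le _
    (ContinuousLinearMap.le_of_opNorm_le _ (hχ.bound_yy _ ht _ _) u) v

theorem nonneg (hχ : IsCutoff r ε t₀ M χ) (ht₀ : 0 < t₀) : 0 ≤ M :=
  (norm_nonneg _).trans (hχ.bound_x t₀ ⟨ht₀, le_rfl⟩ 0 0)

end IsCutoff

/-! ### Uniform bounds -/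

/-- For `q = 0` the Hamiltonian is linear in `y`. The resulting `q' = G p` shows that `q` cannot
vanish along a whole curve unless `p` vanishes initially. -/
theorem IsMetric.hamiltonField_of_snd_eq_zero {U : Set (E d)} {g : E d → Matrix (Fin d) (Fin d) ℝ}
    (hm : IsMetric U g) {x : E d} (hx : x ∈ U) (y p : E d) :
    (hamiltonField g (x, y, p, 0)).2.2.2 = matVec (g x)⁻¹ p := by
  have h1 : (fun y' => hamiltonian g x y' p 0) = fun y' => inner ℝ (-matVec (g x)⁻¹ p) y' := by
    funext y'
    simp [hamiltonian, inner_matVec_comm (hm.herm_inv hx) y' p]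
  have h2 : gradient (fun y' => inner ℝ (-matVec (g x)⁻¹ p) y') y = -matVec (g x)⁻¹ p := by
    refine HasGradientAt.gradient ?_
    rw [hasGradientAt_iff_hasFDerivAt]
    exact (InnerProductSpace.toDual ℝ (E d) (-matVec (g x)⁻¹ p)).hasFDerivAt
  change -gradient (fun y' => hamiltonian g x y' p 0) y = _
  rw [h1, h2, neg_neg]

namespace UnitFlow

variable {U : Set (E d)} {g : E d → Matrix (Fin d) (Fin d) ℝ} {K : Set (E d)} {Φ : UnitFlow U g K}

/-- The action of a curve with non-zero momenta is positive. -/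
theorem action_pos (hm : IsMetric U g) {z : Phase d} (hz : z ∈ Φ.good) (h0 : z.2.2 ≠ 0) :
    0 < Φ.action z := by
  have hU : ∀ s, (Φ.curve z s).1 ∈ U := fun s => Φ.dom_subset _ (curve_mem_dom hz s)
  have hnn : ∀ s, 0 ≤ lagrangian g (Φ.curve z s) := fun s => by
    rw [hm.lagrangian_eq (hU s)]
    exact mul_nonneg (by norm_num) (hm.inner_nonneg (hU s) _)
  have hcurve : Continuous (Φ.curve z) := (Φ.flow z).continuous.Icc_extend'
  have hcont : Continuous fun s => lagrangian g (Φ.curve z s) := by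
    have : (fun s => lagrangian g (Φ.curve z s)) = fun s => Φ.lagr (Φ.curve z s) :=
      funext fun s => (Φ.lagr_eq _ (curve_mem_dom hz s)).symm
    rw [this]
    exact Φ.lagr.continuous.comp hcurve
  rw [action_eq hz]
  refine intervalIntegral.integral_pos zero_lt_one hcont.continuousOn (fun s _ => hnn s) ?_
  by_contra hcon
  push Not at hcon
  -- If the Lagrangian is nowhere positive, then `q` vanishes identically. Its derivative at time 0
  -- is `G p`, so `p` vanishes there too, contrary to `h0`.
  have hq : ∀ s ∈ Set.Icc (0 : ℝ) 1, (Φ.curve z s).2.2.2 = 0 := by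
    intro s hs
    by_contra hne
    have h1 := hcon s hs
    rw [hm.lagrangian_eq (hU s)] at h1
    have h2 := hm.inner_pos (hU s) hne
    linarith
  have hmem : (0 : ℝ) ∈ Set.Icc (0 : ℝ) 1 := ⟨le_rfl, zero_le_one⟩
  have hder := ((isCharacteristic_curve hz).2 0 hmem).2
  have h1 := prQ.hasFDerivAt.comp_hasDerivWithinAt (0 : ℝ) hder
  have h2 : HasDerivWithinAt (prQ ∘ Φ.curve z) 0 (Set.Icc (0 : ℝ) 1) 0 :=
    (hasDerivWithinAt_const (0 : ℝ) _ (0 : E d)).congr (fun s hs => hq s hs) (hq 0 hmem)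
  have h3 := (uniqueDiffOn_Icc zero_lt_one 0 hmem).eq_deriv _ h1 h2
  have hq0 := hq 0 hmem
  have hU0 := hU 0
  rw [Φ.curve_zero] at h3 hq0 hU0
  obtain ⟨x, y, p, q⟩ := z
  simp only at hq0 hU0
  subst hq0
  rw [prQ_apply, hm.hamiltonField_of_snd_eq_zero hU0] at h3
  apply h0
  have h4 := matVec_matVec (g x) (g x)⁻¹ p
  rw [h3, hm.mul_inv hU0, matVec_one, matVec_zero] at h4
  simp [← h4]

end UnitFlow

namespace Chart

variable {U : Set (E d)} {g : E d → Matrix (Fin d) (Fin d) ℝ} {K : Set (E d)} {X : Chart U g K}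
  {a : E d × E d}

theorem mem_of_dom {w : (E d × E d) × (E d × E d)} (hw : w ∈ X.dom) : w.2.1 ∈ U := by
  obtain ⟨h1, h2⟩ := inv_spec hw
  rw [← h2]
  have h3 := UnitFlow.curve_mem_dom (X.good _ hw.1 _ h1) 1
  rw [X.Φ.curve_one] at h3
  exact X.Φ.dom_subset _ h3

/-- The excluded end point is the one reached with zero momenta; any other requires non-zero
momenta. -/
theorem action₁_pos (hm : IsMetric U g) {w : (E d × E d) × (E d × E d)} (hw : w ∈ X.dom)
    (hne : w.2 ≠ X.Φ.expMap (w.1, 0)) : 0 < X.action₁ w := by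
  obtain ⟨h1, h2⟩ := inv_spec hw
  refine UnitFlow.action_pos hm (X.good _ hw.1 _ h1) fun h => hne ?_
  rw [← h2]
  exact congrArg (fun ζ => X.Φ.expMap (w.1, ζ)) h

/-- The pairs of positions at distance at most `r`, the first over `K` and of size at most `c`. -/
def _root_.StochGeodesic.tubeSet (K : Set (E d)) (c r : ℝ) : Set ((E d × E d) × (E d × E d)) :=
  {w | w.1.1 ∈ K ∧ ‖w.1.2‖ ≤ c ∧ dist w.2 w.1 ≤ r}

theorem _root_.StochGeodesic.isCompact_tubeSet {K : Set (E d)} (hK : IsCompact K) (c r : ℝ) :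
    IsCompact (tubeSet K c r) := by
  have h : tubeSet K c r = (fun p : (E d × E d) × (E d × E d) => (p.1, p.1 + p.2)) ''
      ((K ×ˢ Metric.closedBall 0 c) ×ˢ Metric.closedBall 0 r) := by
    ext ⟨a, b⟩
    constructor
    · rintro ⟨h1, h2, h3⟩
      refine ⟨(a, b - a), ⟨⟨h1, by simpa using h2⟩, ?_⟩, by simp⟩
      rwa [mem_closedBall_zero_iff, ← dist_eq_norm]
    · rintro ⟨⟨a', v⟩, ⟨⟨h1, h2⟩, h3⟩, h4⟩
      simp only [Prod.mk.injEq] at h4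
      obtain ⟨rfl, rfl⟩ := h4
      refine ⟨h1, by simpa using h2, ?_⟩
      simpa [dist_eq_norm] using h3
  rw [h]
  exact (((hK.prod (isCompact_closedBall 0 c)).prod (isCompact_closedBall 0 r))).image (by fun_prop)

theorem tubeSet_subset_dom {c r : ℝ} (hc : c < X.c₀) (hr : r < X.r₀) : tubeSet K c r ⊆ X.dom := by
  rintro ⟨a, b⟩ ⟨h1, h2, h3⟩
  exact ⟨X.mem_O _ h1 _ (h2.trans_lt hc), h3.trans_lt hr⟩

/-- Away from the end points of the characteristics with zero momenta, the action has a positive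
lower bound. -/
theorem exists_action_bound (hm : IsMetric U g) (hK : IsCompact K) {r ρ : ℝ} (hr : r < X.r₀)
    (hρ : 0 < ρ) : ∃ c, 0 < c ∧ c < X.c₀ ∧ ∃ Ω > 0, ∀ w ∈ tubeSet K c r, ρ ≤ dist w.2 w.1 →
      Ω ≤ X.action₁ w := by
  have hO : IsOpen {a : E d × E d | dist (X.Φ.expMap (a, 0)) a < ρ} :=
    isOpen_lt ((UnitFlow.contDiff_expMap.continuous.comp (by fun_prop)).dist continuous_id)
      continuous_const
  -- For small initial `y` the characteristic with zero momenta moves by less than `ρ`, so its end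
  -- point is not among the points considered.
  obtain ⟨c₁, hc₁, hc₁'⟩ := exists_tube hK hO (fun x hx => by
    simpa [UnitFlow.expMap_base hx] using hρ)
  -- `tubeSet` is closed, for the sake of compactness; halving keeps its bound strictly below both
  -- `c₁` and `X.c₀`.
  set c := min c₁ X.c₀ / 2 with hc
  have hc0 : 0 < c := half_pos (lt_min hc₁ X.c₀_pos)
  have hcc₁ : c < c₁ := (half_lt_self (lt_min hc₁ X.c₀_pos)).trans_le (min_le_left _ _)
  have hcc₀ : c < X.c₀ := (half_lt_self (lt_min hc₁ X.c₀_pos)).trans_le (min_le_right _ _)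
  have hsub := tubeSet_subset_dom (X := X) hcc₀ hr
  have hcl : IsClosed {w : (E d × E d) × (E d × E d) | ρ ≤ dist w.2 w.1} :=
    isClosed_le continuous_const (by fun_prop)
  obtain ⟨Ω, hΩ, h⟩ := ((isCompact_tubeSet hK c r).inter_right hcl).exists_forall_le'
    (a := 0) (f := X.action₁) (contDiffOn_action₁.continuousOn.mono fun w hw => hsub hw.1)
    (fun w hw => action₁_pos hm (hsub hw.1) fun heq => by
      have h1 := hc₁' _ hw.1.1 w.1.2 (hw.1.2.1.trans_lt hcc₁)
      have h2 : ρ ≤ dist w.2 w.1 := hw.2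
      rw [heq] at h2
      exact absurd h1 h2.not_gt)
  exact ⟨c, hc0, hcc₀, Ω, hΩ, fun w hw hd => h w ⟨hw, hd⟩⟩

/-- A common bound for the quantities that enter the inhomogeneity, for unit time. -/
structure IsBound (X : Chart U g K) (B : ℝ) (w : (E d × E d) × (E d × E d)) : Prop where
  amp_lower : B⁻¹ ≤ X.amp₁ w
  amp_upper : X.amp₁ w ≤ B
  fderiv_amp : ‖fderiv ℝ X.amp₁ w‖ ≤ B
  fderiv_fderiv_amp : ‖fderiv ℝ (fderiv ℝ X.amp₁) w‖ ≤ B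
  fderiv_action : ‖fderiv ℝ X.action₁ w‖ ≤ B
  metric : ∑ i, ∑ j, |g w.2.1 i j| ≤ B
  velocity : ‖matVec (g w.2.1)⁻¹ w.2.2‖ ≤ B
  force : ‖gradient (energy g w.2.2) w.2.1‖ ≤ B

theorem exists_isBound (hm : IsMetric U g) {𝒦 : Set ((E d × E d) × (E d × E d))}
    (h𝒦 : IsCompact 𝒦) (hsub : 𝒦 ⊆ X.dom) : ∃ B, 1 ≤ B ∧ ∀ w ∈ 𝒦, IsBound X B w := by
  have hx : ContinuousOn (fun w : (E d × E d) × (E d × E d) => w.2) 𝒦 := by fun_prop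
  have hx1 : ContinuousOn (fun w : (E d × E d) × (E d × E d) => w.2.1) 𝒦 := by fun_prop
  have hU : Set.MapsTo (fun w : (E d × E d) × (E d × E d) => w.2.1) 𝒦 U :=
    fun w hw => mem_of_dom (hsub hw)
  have c1 : ContinuousOn X.amp₁ 𝒦 := contDiffOn_amp₁.continuousOn.mono hsub
  have d1 : ContDiffOn ℝ ∞ (fderiv ℝ X.amp₁) X.dom :=
    contDiffOn_amp₁.fderiv_of_isOpen isOpen_dom (by simp)
  have c2 : ContinuousOn (fun w => (X.amp₁ w)⁻¹) 𝒦 :=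
    c1.inv₀ fun w hw => (amp₁_pos (hsub hw)).ne'
  have c3 := (d1.continuousOn.mono hsub).norm
  have c4 := ((d1.fderiv_of_isOpen (m := ∞) isOpen_dom (by simp)).continuousOn.mono hsub).norm
  have c5 := ((contDiffOn_action₁ (X := X).fderiv_of_isOpen (m := ∞) isOpen_dom
    (by simp)).continuousOn.mono hsub).norm
  have c6 : ContinuousOn (fun w : (E d × E d) × (E d × E d) => ∑ i, ∑ j, |g w.2.1 i j|) 𝒦 :=
    continuousOn_finsetSum _ fun i _ => continuousOn_finsetSum _ fun j _ =>
      ((hm.smooth i j).continuousOn.comp hx1 hU).abs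
  have c7 : ContinuousOn (fun w : (E d × E d) × (E d × E d) => ‖matVec (g w.2.1)⁻¹ w.2.2‖) 𝒦 := by
    have h1 : ContDiffOn ℝ ∞ (fun b : E d × E d => matVec (g b.1)⁻¹ b.2) {b | b.1 ∈ U} :=
      contDiffOn_matVec (A := fun b : E d × E d => (g b.1)⁻¹)
        (fun i j => (hm.contDiffOn_inv i j).comp contDiffOn_fst fun _ h => h) contDiffOn_snd
    exact (h1.continuousOn.comp hx hU).norm
  have c8 : ContinuousOn (fun w : (E d × E d) × (E d × E d) =>
      ‖gradient (energy g w.2.2) w.2.1‖) 𝒦 :=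
    (hm.contDiffOn_gradient_energy.continuousOn.comp hx hU).norm
  have hb : ∀ f : (E d × E d) × (E d × E d) → ℝ, ContinuousOn f 𝒦 →
      ∃ B, ∀ w ∈ 𝒦, f w ≤ B := fun f hf => by
    obtain ⟨B, hB⟩ := h𝒦.exists_bound_of_continuousOn hf
    exact ⟨B, fun w hw => (le_abs_self _).trans (hB w hw)⟩
  obtain ⟨B1, b1⟩ := hb _ c1
  obtain ⟨B2, b2⟩ := hb _ c2
  obtain ⟨B3, b3⟩ := hb _ c3
  obtain ⟨B4, b4⟩ := hb _ c4
  obtain ⟨B5, b5⟩ := hb _ c5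
  obtain ⟨B6, b6⟩ := hb _ c6
  obtain ⟨B7, b7⟩ := hb _ c7
  obtain ⟨B8, b8⟩ := hb _ c8
  obtain ⟨B, hB⟩ := (Finset.finite_toSet {1, B1, B2, B3, B4, B5, B6, B7, B8}).bddAbove
  have hB' : ∀ b ∈ ({1, B1, B2, B3, B4, B5, B6, B7, B8} : Finset ℝ), b ≤ B := fun b hb => hB hb
  simp only [Finset.mem_insert, Finset.mem_singleton, forall_eq_or_imp, forall_eq] at hB'
  obtain ⟨h0, h1, h2, h3, h4, h5, h6, h7, h8⟩ := hB'
  refine ⟨B, h0, fun w hw => ⟨?_, (b1 w hw).trans h1, (b3 w hw).trans h3, (b4 w hw).trans h4,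
    (b5 w hw).trans h5, (b6 w hw).trans h6, (b7 w hw).trans h7, (b8 w hw).trans h8⟩⟩
  exact inv_le_of_inv_le₀ (amp₁_pos (hsub hw)) ((b2 w hw).trans h2)

/-- The embedding of the second `y`-variable. -/
def embη : E d →L[ℝ] (E d × E d) × (E d × E d) :=
  (ContinuousLinearMap.inr ℝ (E d × E d) _).comp (ContinuousLinearMap.inr ℝ _ _)

theorem norm_embη_le (v : E d) : ‖(embη v : (E d × E d) × (E d × E d))‖ ≤ ‖v‖ := by
  simp [embη, Prod.norm_def]

/-- The `y`-derivatives of functions of the rescaled variables. -/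
theorem fderiv_rescaled {f : ℝ × E d × E d → ℝ} {w : ℝ × E d × E d} (hf : ContDiffAt ℝ 2 f w)
    {κ : (E d × E d) × (E d × E d) → ℝ} (hκ : ContDiffAt ℝ 2 κ (rescale a w)) {c : ℝ}
    (h : ∀ᶠ w' in nhds w, w'.1 = w.1 → f w' = c * κ (rescale a w')) :
    (∀ v, fderiv ℝ f w (embTY v) = c * w.1 * fderiv ℝ κ (rescale a w) (embη v)) ∧
    ∀ u v, fderiv ℝ (fderiv ℝ f) w (embTY u) (embTY v) =
      c * w.1 ^ 2 * fderiv ℝ (fderiv ℝ κ) (rescale a w) (embη u) (embη v) := by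
  -- Time is frozen along `R`. The hypothesis is needed only at equal times, so `c` may be a power
  -- of `t`.
  set R : E d → (E d × E d) × (E d × E d) := fun y' => rescale a (w.1, w.2.1, y') with hRdef
  have hR : ∀ y, HasFDerivAt R (w.1 • embη) y := by
    intro y
    have h1 : R = fun y' => (posDilation w.1 a, (w.2.1, (0 : E d))) + (w.1 • embη) y' := by
      funext y'
      simp [R, rescale, embη]
    rw [h1]
    exact (ContinuousLinearMap.hasFDerivAt _).const_add _
  have hRc : ContinuousAt R w.2.2 := (hR _).continuousAt
  have hc : ContinuousAt (fun y' : E d => (w.1, w.2.1, y')) w.2.2 := by fun_prop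
  have e0 : (fun y' => f (w.1, w.2.1, y')) =ᶠ[nhds w.2.2] fun y' => c * κ (R y') := by
    filter_upwards [hc.eventually h] with y' hy' using hy' rfl
  have e1 : ∀ᶠ y' in nhds w.2.2, HasFDerivAt (fun y' => c * κ (R y'))
      (c • (fderiv ℝ κ (R y')).comp (w.1 • embη)) y' := by
    filter_upwards [hRc.eventually (hκ.eventually (by simp))] with y' hy'
    exact ((hasFDerivAt_of_contDiffAt hy').comp y' (hR y')).const_mul c
  constructor
  · intro v
    have h1 := congrArg (fun T => T v) (fderiv_slice_snd (hf.differentiableAt (by simp)))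
    simp only [ContinuousLinearMap.comp_apply] at h1
    rw [← h1, e0.fderiv_eq, e1.self_of_nhds.fderiv]
    simp [R, mul_assoc]
  · intro u v
    rw [← fderiv_fderiv_slice_snd hf, e0.fderiv.fderiv_eq]
    have e2 : fderiv ℝ (fun y' => c * κ (R y')) =ᶠ[nhds w.2.2]
        fun y' => c • (fderiv ℝ κ (R y')).comp (w.1 • embη) := e1.mono fun y' hy' => hy'.fderiv
    have h2 := HasFDerivAt.comp (g := fderiv ℝ κ) (f := R) w.2.2
      (hasFDerivAt_fderiv_of_contDiffAt (w := R w.2.2) hκ) (hR _)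
    have h3 := (h2.clm_comp (hasFDerivAt_const (w.1 • embη : E d →L[ℝ] _) w.2.2)).const_smul c
    rw [e2.fderiv_eq]
    have h4 := congrArg (fun T => T u v) h3.fderiv
    refine Eq.trans h4 ?_
    simp [R]
    ring

end Chart

/-! ### The inhomogeneity -/

/-- Negative powers of `h` and `t` are absorbed by the exponential factor. -/
theorem exists_exp_absorb (d : ℕ) {Ω t₀ h₀ : ℝ} (hΩ : 0 < Ω) (ht₀ : 0 < t₀) (hh₀ : 0 < h₀) :
    ∃ A, 0 ≤ A ∧ ∀ h ∈ Set.Ioc 0 h₀, ∀ t ∈ Set.Ioc 0 t₀,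
      h⁻¹ * (t ^ (2 * d + 2))⁻¹ * Real.exp (-Ω / (h * t ^ 3)) ≤
        A * Real.exp (-(Ω / 2) / (h * t ^ 3)) := by
  -- With `z = (h t³)⁻¹` the prefactor is `h^d t^(d+1) z^(d+1)`, with non-negative powers of `h` and
  -- `t`. The factor `z^(d+1)` is controlled by `s^n / n! ≤ exp s` with `n = d + 1` and `s = Ω z /
  -- 2`.
  refine ⟨h₀ ^ d * t₀ ^ (d + 1) * (((d + 1).factorial : ℝ) / (Ω / 2) ^ (d + 1)), by positivity,
    fun h hh t ht => ?_⟩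
  have hh0 := hh.1
  have ht0 := ht.1
  set z := (h * t ^ 3)⁻¹ with hz
  have hz0 : 0 < z := by positivity
  have h1 : h⁻¹ * (t ^ (2 * d + 2))⁻¹ = h ^ d * t ^ (d + 1) * z ^ (d + 1) := by
    have e1 : z ^ (d + 1) = ((h ^ d * h) * (t ^ (2 * d + 2) * t ^ (d + 1)))⁻¹ := by
      rw [hz, inv_pow, mul_pow, ← pow_mul, ← pow_succ, ← pow_add]
      congr 3; ring
    rw [e1]
    field_simp
  have h2 : z ^ (d + 1) * Real.exp (-(Ω / 2) * z) ≤ ((d + 1).factorial : ℝ) / (Ω / 2) ^ (d + 1) := by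
    have h3 := Real.pow_div_factorial_le_exp (Ω / 2 * z) (by positivity) (d + 1)
    rw [div_le_iff₀ (by positivity), mul_pow] at h3
    rw [le_div_iff₀ (by positivity), neg_mul, Real.exp_neg]
    have h4 := Real.exp_pos (Ω / 2 * z)
    rw [← div_eq_mul_inv, div_mul_eq_mul_div, div_le_iff₀ h4]
    linarith
  have h5 : Real.exp (-Ω / (h * t ^ 3)) =
      Real.exp (-(Ω / 2) * z) * Real.exp (-(Ω / 2) / (h * t ^ 3)) := by
    rw [← Real.exp_add]
    congr 1
    rw [hz]; ring
  rw [h5, h1, ← mul_assoc]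
  refine mul_le_mul_of_nonneg_right ?_ (Real.exp_pos _).le
  rw [mul_assoc]
  refine mul_le_mul ?_ h2 (by positivity) (by positivity)
  exact mul_le_mul (pow_le_pow_left₀ hh0.le hh.2 _) (pow_le_pow_left₀ ht0.le ht.2 _)
    (by positivity) (by positivity)

/-- The cut-off function centred at `a`. -/
def shifted (χ : ℝ → E d → E d → ℝ) (a : E d × E d) (w : ℝ × E d × E d) : ℝ :=
  χ w.1 (w.2.1 - a.1) (w.2.2 - a.2)

theorem shifted_eq (χ : ℝ → E d → E d → ℝ) (a : E d × E d) :
    shifted χ a = fun w => uncurried χ (w - (0, a)) := by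
  funext w
  simp [shifted, uncurried]

theorem fderiv_shifted (χ : ℝ → E d → E d → ℝ) (a : E d × E d) :
    fderiv ℝ (shifted χ a) = fun w => fderiv ℝ (uncurried χ) (w - (0, a)) := by
  rw [shifted_eq]
  exact funext fun w => fderiv_comp_sub _

theorem fderiv_fderiv_shifted (χ : ℝ → E d → E d → ℝ) (a : E d × E d) (w : ℝ × E d × E d) :
    fderiv ℝ (fderiv ℝ (shifted χ a)) w = fderiv ℝ (fderiv ℝ (uncurried χ)) (w - (0, a)) := by
  rw [fderiv_shifted]
  exact fderiv_comp_sub _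

theorem IsCutoff.contDiffAt_shifted {r ε t₀ M : ℝ} {χ : ℝ → E d → E d → ℝ}
    (hχ : IsCutoff r ε t₀ M χ) {a : E d × E d} {w : ℝ × E d × E d} (ht : 0 < w.1) :
    ContDiffAt ℝ ∞ (shifted χ a) w := by
  rw [shifted_eq]
  exact ContDiffAt.comp (g := uncurried χ) (f := fun w => w - (0, a)) w
    (hχ.contDiffAt (by simpa using ht)) (by fun_prop)

theorem IsCutoff.shifted_eventually_eq_zero {r ε t₀ M : ℝ} {χ : ℝ → E d → E d → ℝ}
    (hχ : IsCutoff r ε t₀ M χ) {a : E d × E d} {w : ℝ × E d × E d} (ht : 0 < w.1)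
    (hw : r < dist (posDilation w.1 w.2) (posDilation w.1 a)) :
    shifted χ a =ᶠ[nhds w] fun _ => 0 := by
  rw [shifted_eq]
  have hc : ContinuousAt (fun w : ℝ × E d × E d => w - (0, a)) w := by fun_prop
  refine hc.eventually (hχ.eventually_eq_zero (by simpa using ht) ?_)
  rw [dist_eq_norm, ← map_sub] at hw
  simpa using hw

namespace Chart

variable {U : Set (E d)} {g : E d → Matrix (Fin d) (Fin d) ℝ} {K : Set (E d)} {X : Chart U g K}
  {a : E d × E d} {w : ℝ × E d × E d}

theorem contDiffAt_amp (hm : IsMetric U g) (hw : w ∈ X.timeDom a) : ContDiffAt ℝ ∞ (X.amp a) w :=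
  (contDiffOn_amp hm).contDiffAt ((isOpen_timeDom a).mem_nhds hw)

theorem contDiffAt_phase (hm : IsMetric U g) (hw : w ∈ X.timeDom a) :
    ContDiffAt ℝ ∞ (X.phase a) w :=
  (contDiffOn_phase hm).contDiffAt ((isOpen_timeDom a).mem_nhds hw)

theorem contDiffAt_cutoffWKB (hm : IsMetric U g) {r ε t₀ M : ℝ} {χ : ℝ → E d → E d → ℝ}
    (hχ : IsCutoff r ε t₀ M χ) (C : ℝ → ℝ) (h : ℝ) (hw : w ∈ X.timeDom a) :
    ContDiffAt ℝ ∞ (fun w : ℝ × E d × E d => cutoffWKB g U X.δ C χ h a.1 a.2 w.1 w.2.1 w.2.2) w :=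
  ((contDiffAt_const.mul (hχ.contDiffAt_shifted hw.1)).mul (contDiffAt_amp hm hw)).mul
    ((contDiffAt_phase hm hw).neg.div_const h).exp

/-- The inhomogeneity in terms of the cut-off function, the amplitude and the phase. -/
theorem inhomogeneity_eq (hm : IsMetric U g) {r ε t₀ M : ℝ} {χ : ℝ → E d → E d → ℝ}
    (hχ : IsCutoff r ε t₀ M χ) {C : ℝ → ℝ} {h : ℝ} (hh : h ≠ 0) (hC : C h ≠ 0)
    (hw : w ∈ X.timeDom a) :
    inhomogeneity g U X.δ C χ h a.1 a.2 w.1 w.2.1 w.2.2 = Real.exp (-X.phase a w / h) *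
      (1 / 2 * shifted χ a w * contract (g w.2.1) (fun i j => fderiv ℝ (fderiv ℝ (X.amp a)) w
          (embTY (EuclideanSpace.single i 1)) (embTY (EuclideanSpace.single j 1))) +
        (1 / 2 * X.amp a w * contract (g w.2.1) (fun i j => fderiv ℝ (fderiv ℝ (shifted χ a)) w
          (embTY (EuclideanSpace.single i 1)) (embTY (EuclideanSpace.single j 1))) +
        contract (g w.2.1) (fun i j => fderiv ℝ (shifted χ a) w (embTY (EuclideanSpace.single i 1)) *
          fderiv ℝ (X.amp a) w (embTY (EuclideanSpace.single j 1))) -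
        X.amp a w / h * (fderiv ℝ (shifted χ a) w (drift g w.2) +
          contract (g w.2.1) fun i j => fderiv ℝ (shifted χ a) w (embTY (EuclideanSpace.single i 1)) *
            fderiv ℝ (X.phase a) w (embTY (EuclideanSpace.single j 1))))) := by
  have hHJ := hamilton_jacobi_drift hm hw
  have hT := transport hm hw
  simp only [mul_assoc] at hHJ hT
  rw [← mul_assoc (1 / 2 : ℝ)] at hT
  have h1 := frozenOp_wkb (hm.herm (mem_of_timeDom hm hw)) hh (C h)
    (e := fun i => embTY (EuclideanSpace.single i 1))
    ((hχ.contDiffAt_shifted (a := a) hw.1).of_le (by norm_cast))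
    ((contDiffAt_amp hm hw).of_le (by norm_cast)) ((contDiffAt_phase hm hw).of_le (by norm_cast))
    hHJ hT
  rw [inhomogeneity, parabolicOp_eq g h _ ((contDiffAt_cutoffWKB hm hχ C h hw).of_le (by norm_cast))]
  refine Eq.trans (congrArg (fun s => -s / (h ^ 2 * C h)) h1) ?_
  rw [neg_mul, neg_neg]
  exact mul_div_cancel_left₀ _ (mul_ne_zero (pow_ne_zero 2 hh) hC)

theorem norm_embη_single_le (i : Fin d) :
    ‖(embη (EuclideanSpace.single i (1 : ℝ)) : (E d × E d) × (E d × E d))‖ ≤ 1 :=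
  (norm_embη_le _).trans (by simp)

theorem amp_eq (hm : IsMetric U g) (hw : w ∈ X.timeDom a) :
    X.amp a w = (w.1 ^ (2 * d))⁻¹ * X.amp₁ (rescale a w) := amplitude_eq hm hw

theorem phase_eq (hm : IsMetric U g) (hw : w ∈ X.timeDom a) :
    X.phase a w = (w.1 ^ 3)⁻¹ * X.action₁ (rescale a w) := phaseS_eq hm hw

/-- The amplitude depends on `y` through `t y`. The two factors of `t` in the second derivative are
the source of `t²` in the final estimate. -/
theorem fderiv_amp (hm : IsMetric U g) (hw : w ∈ X.timeDom a) :
    (∀ v, fderiv ℝ (X.amp a) w (embTY v) =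
      (w.1 ^ (2 * d))⁻¹ * w.1 * fderiv ℝ X.amp₁ (rescale a w) (embη v)) ∧
    ∀ u v, fderiv ℝ (fderiv ℝ (X.amp a)) w (embTY u) (embTY v) =
      (w.1 ^ (2 * d))⁻¹ * w.1 ^ 2 * fderiv ℝ (fderiv ℝ X.amp₁) (rescale a w) (embη u) (embη v) := by
  refine fderiv_rescaled ((contDiffAt_amp hm hw).of_le (by norm_cast))
    ((contDiffOn_amp₁.contDiffAt (isOpen_dom.mem_nhds hw.2)).of_le (by norm_cast)) ?_
  filter_upwards [(isOpen_timeDom a).mem_nhds hw] with w' hw' h1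
  rw [amp_eq hm hw', h1]

theorem fderiv_phase_snd (hm : IsMetric U g) (hw : w ∈ X.timeDom a) (v : E d) :
    fderiv ℝ (X.phase a) w (embTY v) =
      (w.1 ^ 3)⁻¹ * w.1 * fderiv ℝ X.action₁ (rescale a w) (embη v) := by
  refine (fderiv_rescaled ((contDiffAt_phase hm hw).of_le (by norm_cast))
    ((contDiffOn_action₁.contDiffAt (isOpen_dom.mem_nhds hw.2)).of_le (by norm_cast)) ?_).1 v
  filter_upwards [(isOpen_timeDom a).mem_nhds hw] with w' hw' h1
  rw [phase_eq hm hw', h1]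

section Bounds

variable {B : ℝ}

theorem abs_fderiv_amp_le (hm : IsMetric U g) (hw : w ∈ X.timeDom a)
    (hB : IsBound X B (rescale a w)) (i : Fin d) :
    |fderiv ℝ (X.amp a) w (embTY (EuclideanSpace.single i 1))| ≤
      (w.1 ^ (2 * d))⁻¹ * w.1 * B := by
  have ht := hw.1
  rw [(fderiv_amp hm hw).1, abs_mul, abs_of_nonneg (by positivity)]
  refine mul_le_mul_of_nonneg_left ?_ (by positivity)
  refine (ContinuousLinearMap.le_of_opNorm_le_of_le _ hB.fderiv_amp (norm_embη_single_le i)).trans ?_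
  rw [mul_one]

theorem abs_fderiv_fderiv_amp_le (hm : IsMetric U g) (hw : w ∈ X.timeDom a)
    (hB : IsBound X B (rescale a w)) (i j : Fin d) :
    |fderiv ℝ (fderiv ℝ (X.amp a)) w (embTY (EuclideanSpace.single i 1))
      (embTY (EuclideanSpace.single j 1))| ≤ (w.1 ^ (2 * d))⁻¹ * w.1 ^ 2 * B := by
  have ht := hw.1
  rw [(fderiv_amp hm hw).2, abs_mul, abs_of_nonneg (by positivity)]
  refine mul_le_mul_of_nonneg_left ?_ (by positivity)
  refine (ContinuousLinearMap.le_of_opNorm_le_of_le _ (ContinuousLinearMap.le_of_opNorm_le_of_le _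
    hB.fderiv_fderiv_amp (norm_embη_single_le i)) (norm_embη_single_le j)).trans ?_
  rw [mul_one, mul_one]

theorem abs_fderiv_phase_le (hm : IsMetric U g) (hw : w ∈ X.timeDom a)
    (hB : IsBound X B (rescale a w)) (i : Fin d) :
    |fderiv ℝ (X.phase a) w (embTY (EuclideanSpace.single i 1))| ≤ (w.1 ^ 2)⁻¹ * B := by
  have ht := hw.1
  rw [fderiv_phase_snd hm hw, show (w.1 ^ 3)⁻¹ * w.1 = (w.1 ^ 2)⁻¹ by field_simp, abs_mul,
    abs_of_nonneg (by positivity)]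
  refine mul_le_mul_of_nonneg_left ?_ (by positivity)
  refine (ContinuousLinearMap.le_of_opNorm_le_of_le _ hB.fderiv_action
    (norm_embη_single_le i)).trans ?_
  rw [mul_one]

/-- The bound holds at `t y`, and `G(x) y` is linear in `y`; the quadratic energy in `norm_force_le`
costs `t⁻²` instead. -/
theorem norm_velocity_le (ht : 0 < w.1) (hB : IsBound X B (rescale a w)) :
    ‖matVec (g w.2.1)⁻¹ w.2.2‖ ≤ B / w.1 := by
  have h := hB.velocity
  simp only [rescale, posDilation_apply, matVec_smul, norm_smul, Real.norm_of_nonneg ht.le] at h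
  rwa [le_div_iff₀ ht, mul_comm]

theorem norm_force_le (ht : 0 < w.1) (hB : IsBound X B (rescale a w)) :
    ‖gradient (energy g w.2.2) w.2.1‖ ≤ B / w.1 ^ 2 := by
  have h := hB.force
  have h1 : energy g (w.1 • w.2.2) = fun x' => w.1 ^ 2 * energy g w.2.2 x' :=
    funext fun x' => energy_smul g _ _ _
  simp only [rescale, posDilation_apply, h1, gradient_const_smul, norm_smul, norm_pow,
    Real.norm_of_nonneg ht.le] at h
  rwa [le_div_iff₀ (by positivity), mul_comm]

/-- The main term of the inhomogeneity is of the order `t²`. -/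
theorem abs_main_le (hm : IsMetric U g) (hw : w ∈ X.timeDom a) (hB1 : 1 ≤ B)
    (hB : IsBound X B (rescale a w)) {s : ℝ} (hs : 0 ≤ s) :
    |1 / 2 * s * contract (g w.2.1) (fun i j => fderiv ℝ (fderiv ℝ (X.amp a)) w
          (embTY (EuclideanSpace.single i 1)) (embTY (EuclideanSpace.single j 1)))| ≤
      B ^ 3 * w.1 ^ 2 * (s * X.amp a w) := by
  have ht := hw.1
  have hB0 : 0 < B := by linarith
  have h1 := abs_contract_le (g w.2.1) _ hB.metric (by positivity)
    (abs_fderiv_fderiv_amp_le hm hw hB)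
  -- The lower bound of the unit-time amplitude trades the singular power of `t` for the amplitude
  -- itself, so that the estimate is relative to `u^D`.
  have h2 : (w.1 ^ (2 * d))⁻¹ ≤ B * X.amp a w := by
    rw [amp_eq hm hw, mul_left_comm]
    refine le_mul_of_one_le_right (by positivity) ?_
    have := mul_le_mul_of_nonneg_left hB.amp_lower hB0.le
    rwa [mul_inv_cancel₀ hB0.ne'] at this
  rw [abs_mul, abs_of_nonneg (by positivity)]
  calc 1 / 2 * s * _ ≤ 1 / 2 * s * (B * ((w.1 ^ (2 * d))⁻¹ * w.1 ^ 2 * B)) :=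
        mul_le_mul_of_nonneg_left h1 (by positivity)
    _ ≤ s * (B * ((w.1 ^ (2 * d))⁻¹ * w.1 ^ 2 * B)) := by
        refine mul_le_mul_of_nonneg_right ?_ (by positivity)
        linarith
    _ = s * B ^ 2 * w.1 ^ 2 * (w.1 ^ (2 * d))⁻¹ := by ring
    _ ≤ s * B ^ 2 * w.1 ^ 2 * (B * X.amp a w) := mul_le_mul_of_nonneg_left h2 (by positivity)
    _ = _ := by ring

theorem abs_fderiv_shifted_drift_le {r ε t₀ M : ℝ} {χ : ℝ → E d → E d → ℝ}
    (hχ : IsCutoff r ε t₀ M χ) (ht : w.1 ∈ Set.Ioc 0 t₀)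
    (hB : IsBound X B (rescale a w)) :
    |fderiv ℝ (shifted χ a) w (drift g w.2)| ≤ M / w.1 + M * (B / w.1) + M * (B / w.1 ^ 2) := by
  have hM : 0 ≤ M := hχ.nonneg (ht.1.trans_le ht.2)
  have ht' : (w - (0, a)).1 ∈ Set.Ioc 0 t₀ := by simpa using ht
  have hdrift : drift g w.2 = (1, 0) - embTX (matVec (g w.2.1)⁻¹ w.2.2) +
      (1 / 2 : ℝ) • embTY (gradient (energy g w.2.2) w.2.1) := by
    simp [drift]
  have h1 := hχ.abs_fderiv_time_le ht'
  have h2 := (hχ.abs_fderiv_fst_le ht' (matVec (g w.2.1)⁻¹ w.2.2)).trans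
    (mul_le_mul_of_nonneg_left (norm_velocity_le ht.1 hB) hM)
  have h3 := (hχ.abs_fderiv_snd_le ht' (gradient (energy g w.2.2) w.2.1)).trans
    (mul_le_mul_of_nonneg_left (norm_force_le ht.1 hB) hM)
  have h4 : (w - (0, a)).1 = w.1 := by simp
  rw [h4] at h1
  rw [fderiv_shifted, hdrift, map_add, map_sub, map_smul, smul_eq_mul]
  rw [abs_le] at h1 h2 h3 ⊢
  constructor <;> linarith [h1.1, h1.2, h2.1, h2.2, h3.1, h3.2]

/-- The terms of the inhomogeneity with derivatives of the cut-off function. -/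
theorem abs_boundary_le (hm : IsMetric U g) (hw : w ∈ X.timeDom a) (hB1 : 1 ≤ B)
    (hB : IsBound X B (rescale a w)) {r ε t₀ M : ℝ} {χ : ℝ → E d → E d → ℝ}
    (hχ : IsCutoff r ε t₀ M χ) (ht : w.1 ∈ Set.Ioc 0 t₀) {h h₀ : ℝ} (hh : h ∈ Set.Ioc 0 h₀) :
    |1 / 2 * X.amp a w * contract (g w.2.1) (fun i j => fderiv ℝ (fderiv ℝ (shifted χ a)) w
          (embTY (EuclideanSpace.single i 1)) (embTY (EuclideanSpace.single j 1))) +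
        contract (g w.2.1) (fun i j => fderiv ℝ (shifted χ a) w (embTY (EuclideanSpace.single i 1)) *
          fderiv ℝ (X.amp a) w (embTY (EuclideanSpace.single j 1))) -
        X.amp a w / h * (fderiv ℝ (shifted χ a) w (drift g w.2) +
          contract (g w.2.1) fun i j => fderiv ℝ (shifted χ a) w (embTY (EuclideanSpace.single i 1)) *
            fderiv ℝ (X.phase a) w (embTY (EuclideanSpace.single j 1)))| ≤
      M * (B ^ 2 * h₀ * t₀ ^ 2 + B ^ 2 * h₀ * t₀ ^ 3 + B * (t₀ + B * t₀ + B + B ^ 2)) *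
        (h⁻¹ * (w.1 ^ (2 * d + 2))⁻¹) := by
  have hM : 0 ≤ M := hχ.nonneg (ht.1.trans_le ht.2)
  have ht' : (w - (0, a)).1 ∈ Set.Ioc 0 t₀ := by simpa using ht
  have hB0 : 0 < B := by linarith
  have hamp0 : 0 ≤ X.amp a w := by
    rw [amp_eq hm hw]
    have := amp₁_pos hw.2
    have := ht.1
    exact mul_nonneg (by positivity) (le_of_lt ‹0 < X.amp₁ _›)
  have hamp : X.amp a w ≤ (w.1 ^ (2 * d))⁻¹ * B := by
    rw [amp_eq hm hw]
    exact mul_le_mul_of_nonneg_left hB.amp_upper (inv_nonneg.2 (pow_nonneg ht.1.le _))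
  have hD : ∀ i, |fderiv ℝ (shifted χ a) w (embTY (EuclideanSpace.single i 1))| ≤ M := by
    intro i
    rw [fderiv_shifted]
    simpa using hχ.abs_fderiv_snd_le ht' (EuclideanSpace.single i 1)
  have hDD : ∀ i j, |fderiv ℝ (fderiv ℝ (shifted χ a)) w (embTY (EuclideanSpace.single i 1))
      (embTY (EuclideanSpace.single j 1))| ≤ M := by
    intro i j
    rw [fderiv_fderiv_shifted]
    simpa using hχ.abs_fderiv_fderiv_snd_le ht' (EuclideanSpace.single i 1)
      (EuclideanSpace.single j 1)
  have hdr := abs_fderiv_shifted_drift_le (a := a) hχ ht hB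
  have c1 := abs_contract_le (g w.2.1) _ hB.metric hM hDD
  have c2 := abs_contract_le (g w.2.1) (fun i j => fderiv ℝ (shifted χ a) w
    (embTY (EuclideanSpace.single i 1)) * fderiv ℝ (X.amp a) w (embTY (EuclideanSpace.single j 1)))
    (b := M * ((w.1 ^ (2 * d))⁻¹ * w.1 * B)) hB.metric
    (by have := ht.1; positivity) (fun i j => by
      rw [abs_mul]
      exact mul_le_mul (hD i) (abs_fderiv_amp_le hm hw hB j) (abs_nonneg _) hM)
  have c3 := abs_contract_le (g w.2.1) (fun i j => fderiv ℝ (shifted χ a) w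
    (embTY (EuclideanSpace.single i 1)) * fderiv ℝ (X.phase a) w (embTY (EuclideanSpace.single j 1)))
    (b := M * ((w.1 ^ 2)⁻¹ * B)) hB.metric
    (by have := ht.1; positivity) (fun i j => by
      rw [abs_mul]
      exact mul_le_mul (hD i) (abs_fderiv_phase_le hm hw hB j) (abs_nonneg _) hM)
  revert c1 c2 c3 hdr
  generalize contract (g w.2.1) (fun i j => fderiv ℝ (fderiv ℝ (shifted χ a)) w
          (embTY (EuclideanSpace.single i 1)) (embTY (EuclideanSpace.single j 1))) = q1
  generalize contract (g w.2.1) (fun i j => fderiv ℝ (shifted χ a) w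
    (embTY (EuclideanSpace.single i 1)) * fderiv ℝ (X.amp a) w (embTY (EuclideanSpace.single j 1))) = q2
  generalize contract (g w.2.1) (fun i j => fderiv ℝ (shifted χ a) w
    (embTY (EuclideanSpace.single i 1)) * fderiv ℝ (X.phase a) w
      (embTY (EuclideanSpace.single j 1))) = q3
  generalize fderiv ℝ (shifted χ a) w (drift g w.2) = q4
  intro hdr c1 c2 c3
  generalize X.amp a w = φ at *
  obtain ⟨ht0, htt⟩ := ht
  obtain ⟨hh0, hhh⟩ := hh
  generalize w.1 = t at *
  have hh₀ : 0 < h₀ := hh0.trans_le hhh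
  have hpow : t ^ (2 * d + 2) = t ^ (2 * d) * t ^ 2 := pow_add _ _ _
  -- The common factor is the size of the worst term, which combines `φ / h` with `(g S_y, χ_y)` and
  -- the force. The milder terms are brought to it by positive powers of `h ≤ h₀` and `t ≤ t₀`.
  have e1 : |1 / 2 * φ * q1| ≤ M * (B ^ 2 * h₀ * t₀ ^ 2) * (h⁻¹ * (t ^ (2 * d + 2))⁻¹) := by
    rw [abs_mul, abs_of_nonneg (by positivity)]
    calc 1 / 2 * φ * |q1| ≤ φ * |q1| := by
          refine mul_le_mul_of_nonneg_right ?_ (abs_nonneg _)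
          linarith
      _ ≤ ((t ^ (2 * d))⁻¹ * B) * (B * M) := mul_le_mul hamp c1 (abs_nonneg _) (by positivity)
      _ = M * (B ^ 2 * h * t ^ 2) * (h⁻¹ * (t ^ (2 * d + 2))⁻¹) := by
          rw [hpow]; field_simp
      _ ≤ _ := by gcongr
  have e2 : |q2| ≤ M * (B ^ 2 * h₀ * t₀ ^ 3) * (h⁻¹ * (t ^ (2 * d + 2))⁻¹) := by
    calc |q2| ≤ B * (M * ((t ^ (2 * d))⁻¹ * t * B)) := c2
      _ = M * (B ^ 2 * h * t ^ 3) * (h⁻¹ * (t ^ (2 * d + 2))⁻¹) := by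
          rw [hpow]; field_simp
      _ ≤ _ := by gcongr
  have e3 : |φ / h * (q4 + q3)| ≤ M * (B * (t₀ + B * t₀ + B + B ^ 2)) *
      (h⁻¹ * (t ^ (2 * d + 2))⁻¹) := by
    rw [abs_mul, abs_of_nonneg (by positivity)]
    calc φ / h * |q4 + q3| ≤ ((t ^ (2 * d))⁻¹ * B) / h *
          (M / t + M * (B / t) + M * (B / t ^ 2) + B * (M * ((t ^ 2)⁻¹ * B))) := by
          refine mul_le_mul ?_ ((abs_add_le _ _).trans (add_le_add hdr c3)) (abs_nonneg _)
            (by positivity)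
          gcongr
      _ = M * (B * (t + B * t + B + B ^ 2)) * (h⁻¹ * (t ^ (2 * d + 2))⁻¹) := by
          rw [hpow]; field_simp
      _ ≤ _ := by gcongr
  calc _ ≤ |1 / 2 * φ * q1 + q2| + |φ / h * (q4 + q3)| := abs_sub _ _
    _ ≤ |1 / 2 * φ * q1| + |q2| + |φ / h * (q4 + q3)| := by gcongr; exact abs_add_le _ _
    _ ≤ _ := by linarith

end Bounds

end Chart

/-! ### Smoothness of the cut-off function `u^D` and the estimate of its inhomogeneity. -/

namespace Chart

variable {U : Set (E d)} {g : E d → Matrix (Fin d) (Fin d) ℝ} {K : Set (E d)} {X : Chart U g K}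

theorem rescale_mem_tubeSet {c r : ℝ} {a : E d × E d} {w : ℝ × E d × E d} (ht : 0 < w.1)
    (ha : a.1 ∈ K) (hc : w.1 * ‖a.2‖ < c)
    (hw : dist (posDilation w.1 w.2) (posDilation w.1 a) ≤ r) : rescale a w ∈ tubeSet K c r :=
  ⟨ha, by
    change ‖w.1 • a.2‖ ≤ c
    rw [norm_smul, Real.norm_of_nonneg ht.le]
    exact hc.le, hw⟩

theorem _root_.StochGeodesic.mem_polydisc_iff_dist {r t : ℝ} (ht : 0 < t) {a b : E d × E d} :
    b ∈ polydisc r t a.1 a.2 ↔ dist (posDilation t b) (posDilation t a) < r :=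
  mem_polydisc_iff ht

theorem cutoffWKB_eventually_eq_zero {r ε t₀ M : ℝ} {χ : ℝ → E d → E d → ℝ}
    (hχ : IsCutoff r ε t₀ M χ) (C : ℝ → ℝ) (h : ℝ) {a : E d × E d} {w : ℝ × E d × E d}
    (ht : 0 < w.1) (hw : r < dist (posDilation w.1 w.2) (posDilation w.1 a)) :
    (fun w : ℝ × E d × E d => cutoffWKB g U X.δ C χ h a.1 a.2 w.1 w.2.1 w.2.2)
      =ᶠ[nhds w] fun _ => 0 := by
  filter_upwards [hχ.shifted_eventually_eq_zero ht hw] with w' hw'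
  have h1 : χ w'.1 (w'.2.1 - a.1) (w'.2.2 - a.2) = 0 := hw'
  simp [cutoffWKB, h1]

theorem inhomogeneity_eq_zero {r ε t₀ M : ℝ} {χ : ℝ → E d → E d → ℝ}
    (hχ : IsCutoff r ε t₀ M χ) (C : ℝ → ℝ) (h : ℝ) {a : E d × E d} {w : ℝ × E d × E d}
    (ht : 0 < w.1) (hw : r < dist (posDilation w.1 w.2) (posDilation w.1 a)) :
    inhomogeneity g U X.δ C χ h a.1 a.2 w.1 w.2.1 w.2.2 = 0 := by
  have h0 := cutoffWKB_eventually_eq_zero (X := X) hχ C h ht hw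
  have h1 : ContDiffAt ℝ 2 (fun w : ℝ × E d × E d =>
      cutoffWKB g U X.δ C χ h a.1 a.2 w.1 w.2.1 w.2.2) w := contDiffAt_const.congr_of_eventuallyEq h0
  obtain ⟨h2, h3⟩ := IsCutoff.fderiv_of_eventuallyEq_const h0
  rw [inhomogeneity, parabolicOp_eq g h _ h1, frozenOp, h2, h3]
  simp [contract]

/-- The gap between `r` and `X.r₀` lets the two cases overlap: outside the polydisc of radius
`X.r₀`, where phase and amplitude carry no information, the function vanishes in a whole
neighbourhood. -/
theorem contDiffAt_cutoffWKB_of_lt (hm : IsMetric U g) {r ε t₀ M : ℝ} (hr : r < X.r₀)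
    {χ : ℝ → E d → E d → ℝ} (hχ : IsCutoff r ε t₀ M χ) (C : ℝ → ℝ) (h : ℝ) {a : E d × E d}
    (ha : a.1 ∈ K) {w : ℝ × E d × E d} (ht : 0 < w.1) (hc : w.1 * ‖a.2‖ < X.c₀) :
    ContDiffAt ℝ ∞
      (fun w : ℝ × E d × E d => cutoffWKB g U X.δ C χ h a.1 a.2 w.1 w.2.1 w.2.2) w := by
  by_cases hw : w.2 ∈ polydisc X.r₀ w.1 a.1 a.2
  · exact contDiffAt_cutoffWKB hm hχ C h (mem_timeDom ha ht hc hw)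
  · rw [mem_polydisc_iff_dist ht, not_lt] at hw
    exact contDiffAt_const.congr_of_eventuallyEq
      (cutoffWKB_eventually_eq_zero (X := X) hχ C h ht (hr.trans_le hw))

/-- The order of magnitude of the inhomogeneity, given a lower bound `Ω` of the action in the
boundary layer and a bound `B` of the coefficients. -/
theorem abs_inhomogeneity_le (hm : IsMetric U g) {r ε c Ω B t₀ h₀ M A : ℝ} (hr0 : 0 < r)
    (hr : r < X.r₀) (hc : c < X.c₀)
    (hΩ : ∀ w ∈ tubeSet K c r, r - ε ≤ dist w.2 w.1 → Ω ≤ X.action₁ w)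
    (hB1 : 1 ≤ B) (hB : ∀ w ∈ tubeSet K c r, IsBound X B w)
    (hA : ∀ h ∈ Set.Ioc 0 h₀, ∀ t ∈ Set.Ioc 0 t₀,
      h⁻¹ * (t ^ (2 * d + 2))⁻¹ * Real.exp (-Ω / (h * t ^ 3)) ≤
        A * Real.exp (-(Ω / 2) / (h * t ^ 3)))
    {χ : ℝ → E d → E d → ℝ} (hχ : IsCutoff r ε t₀ M χ) {C : ℝ → ℝ} {h : ℝ} (hC : 0 < C h)
    (hh : h ∈ Set.Ioc 0 h₀) {a : E d × E d} (ha : a.1 ∈ K) {w : ℝ × E d × E d}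
    (ht : w.1 ∈ Set.Ioc 0 t₀) (hwc : w.1 * ‖a.2‖ < c) :
    |inhomogeneity g U X.δ C χ h a.1 a.2 w.1 w.2.1 w.2.2| ≤
      B ^ 3 * w.1 ^ 2 * (cutoffWKB g U X.δ C χ h a.1 a.2 w.1 w.2.1 w.2.2 / C h) +
      M * (B ^ 2 * h₀ * t₀ ^ 2 + B ^ 2 * h₀ * t₀ ^ 3 + B * (t₀ + B * t₀ + B + B ^ 2)) * A *
        Real.exp (-(Ω / 2) / (h * w.1 ^ 3)) *
        (boundaryLayer r ε w.1 a.1 a.2).indicator (fun _ => (1 : ℝ)) w.2 := by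
  set N := M * (B ^ 2 * h₀ * t₀ ^ 2 + B ^ 2 * h₀ * t₀ ^ 3 + B * (t₀ + B * t₀ + B + B ^ 2)) with hN
  have ht₀ : 0 < t₀ := ht.1.trans_le ht.2
  have hh₀ : 0 < h₀ := hh.1.trans_le hh.2
  have hM := hχ.nonneg ht₀
  have hB0 : 0 < B := by linarith
  have hN0 : 0 ≤ N := by positivity
  have hsub : (w - (0, a)).1 = w.1 := by simp
  have hsub2 : (w - (0, a)).2 = w.2 - a := by simp
  -- Strictly outside, all terms vanish locally. The remaining closed polydisc consists of the
  -- layer, the inner polydisc and the boundary.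
  rcases lt_or_ge r (dist (posDilation w.1 w.2) (posDilation w.1 a)) with hout | hin
  · have h1 := (hχ.shifted_eventually_eq_zero ht.1 hout).eq_of_nhds
    have h2 : χ w.1 (w.2.1 - a.1) (w.2.2 - a.2) = 0 := h1
    have h3 : w.2 ∉ boundaryLayer r ε w.1 a.1 a.2 := fun h4 =>
      absurd ((mem_polydisc_iff_dist ht.1).1 h4.1) hout.le.not_gt
    rw [inhomogeneity_eq_zero (X := X) hχ C h ht.1 hout, Set.indicator_of_notMem h3]
    simp [cutoffWKB, h2]
  have htube := rescale_mem_tubeSet ht.1 ha hwc hin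
  have hw : w ∈ X.timeDom a := mem_timeDom ha ht.1 (hwc.trans hc)
    ((mem_polydisc_iff_dist ht.1).2 (hin.trans_lt hr))
  have hBw := hB _ htube
  have hs : 0 ≤ shifted χ a w := (hχ.mem_Icc _ ht.1 _ _).1
  have hu : cutoffWKB g U X.δ C χ h a.1 a.2 w.1 w.2.1 w.2.2 / C h =
      Real.exp (-X.phase a w / h) * (shifted χ a w * X.amp a w) := by
    rw [div_eq_iff hC.ne']
    change C h * shifted χ a w * X.amp a w * Real.exp (-X.phase a w / h) = _
    ring
  have hmain := abs_main_le hm hw hB1 hBw hs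
  have hbd := abs_boundary_le hm hw hB1 hBw hχ ht hh
  have hexp := Real.exp_pos (-X.phase a w / h)
  rw [hu, inhomogeneity_eq hm hχ hh.1.ne' hC.ne' hw, abs_mul, abs_of_pos hexp]
  by_cases hlayer : w.2 ∈ boundaryLayer r ε w.1 a.1 a.2
  · rw [Set.indicator_of_mem hlayer, mul_one]
    have hdist : r - ε ≤ dist (rescale a w).2 (rescale a w).1 := by
      have := hlayer.2
      rwa [mem_polydisc_iff_dist ht.1, not_lt] at this
    have hact := hΩ _ htube hdist
    -- In the layer the rescaled positions are at least `r - ε` apart, so the unit-time action is at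
    -- least `Ω`, and `S` at least `Ω t⁻³`.
    have hle : Real.exp (-X.phase a w / h) ≤ Real.exp (-Ω / (h * w.1 ^ 3)) := by
      have ht1 := ht.1
      have hh1 := hh.1
      refine Real.exp_le_exp.2 ?_
      rw [phase_eq hm hw, neg_div, neg_div, neg_le_neg_iff]
      have : (w.1 ^ 3)⁻¹ * X.action₁ (rescale a w) / h = X.action₁ (rescale a w) / (h * w.1 ^ 3) := by
        field_simp
      rw [this]
      gcongr
    have habs := hA h hh w.1 ht
    calc _ ≤ Real.exp (-X.phase a w / h) * (B ^ 3 * w.1 ^ 2 * (shifted χ a w * X.amp a w) +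
          N * (h⁻¹ * (w.1 ^ (2 * d + 2))⁻¹)) :=
          mul_le_mul_of_nonneg_left ((abs_add_le _ _).trans (add_le_add hmain hbd)) hexp.le
      _ = B ^ 3 * w.1 ^ 2 * (Real.exp (-X.phase a w / h) * (shifted χ a w * X.amp a w)) +
          N * ((h⁻¹ * (w.1 ^ (2 * d + 2))⁻¹) * Real.exp (-X.phase a w / h)) := by ring
      _ ≤ B ^ 3 * w.1 ^ 2 * (Real.exp (-X.phase a w / h) * (shifted χ a w * X.amp a w)) +
          N * (A * Real.exp (-(Ω / 2) / (h * w.1 ^ 3))) := by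
          refine add_le_add_right (mul_le_mul_of_nonneg_left (le_trans ?_ habs) hN0) _
          have ht1 := ht.1
          have hh1 := hh.1
          exact mul_le_mul_of_nonneg_left hle (by positivity)
      _ = _ := by ring
  · rw [Set.indicator_of_notMem hlayer, mul_zero, add_zero]
    -- Off the layer the point lies in the inner polydisc, where `χ` is constant, or on the boundary
    -- of the outer one. The boundary does not belong to the layer, so the derivatives must vanish
    -- there exactly.
    have hzero : fderiv ℝ (shifted χ a) w = 0 ∧ fderiv ℝ (fderiv ℝ (shifted χ a)) w = 0 := by
      rw [fderiv_fderiv_shifted, fderiv_shifted]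
      by_cases hD : w.2 ∈ polydisc r w.1 a.1 a.2
      · have h1 : w.2 ∈ polydisc (r - ε) w.1 a.1 a.2 := by
          by_contra h2
          exact hlayer ⟨hD, h2⟩
        refine hχ.fderiv_eq_zero_of_mem (by rw [hsub]; exact ht.1) ?_
        rw [hsub, hsub2, mem_polydisc_sub_iff]
        exact h1
      · refine hχ.fderiv_eq_zero_of_notMem hr0 (by rw [hsub]; exact ht.1) ?_
        rw [hsub, hsub2, mem_polydisc_sub_iff]
        exact hD
    rw [hzero.1, hzero.2]
    simp only [zero_apply, zero_mul, contract, mul_zero, Finset.sum_const_zero, add_zero, sub_zero]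
    refine (mul_le_mul_of_nonneg_left hmain hexp.le).trans_eq ?_
    ring

end Chart

end StochGeodesic

end

/-! ### The theorem. -/

open StochGeodesic in
theorem mainTheorem5 {d : ℕ} (U : Set (E d)) (hU : IsOpen U)
    (g : E d → Matrix (Fin d) (Fin d) ℝ)
    (hg_smooth : ∀ i j, ContDiffOn ℝ ∞ (fun x => g x i j) U)
    (hg_pos : ∀ x ∈ U, (g x).PosDef)
    (K : Set (E d)) (hK : IsCompact K) (hKU : K ⊆ U) :
    ∃ δ > 0, ∃ r₀ > 0, ∃ c₀ > 0,
      -- `S` and `φ` are well defined and smooth on the polydisc of radius `r₀`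
      (∀ x₀ ∈ K, ∀ y₀ : E d,
        (∀ t > 0, t * ‖y₀‖ < c₀ → ∀ x y, (x, y) ∈ polydisc r₀ t x₀ y₀ →
          (∃! ζ, IsConnecting g U δ t x y x₀ y₀ ζ) ∧ 0 < jacobian g U δ t x y x₀ y₀) ∧
        ContDiffOn ℝ ∞ (fun w : ℝ × E d × E d => phaseS g U δ w.1 w.2.1 w.2.2 x₀ y₀)
          {w | 0 < w.1 ∧ w.1 * ‖y₀‖ < c₀ ∧ w.2 ∈ polydisc r₀ w.1 x₀ y₀} ∧
        ContDiffOn ℝ ∞ (fun w : ℝ × E d × E d => amplitude g U δ w.1 w.2.1 w.2.2 x₀ y₀)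
          {w | 0 < w.1 ∧ w.1 * ‖y₀‖ < c₀ ∧ w.2 ∈ polydisc r₀ w.1 x₀ y₀}) ∧
      -- the order of magnitude of the inhomogeneity
      ∀ r, 0 < r → r < r₀ → ∀ ε, 0 < ε → ε < r →
        ∃ c, 0 < c ∧ c ≤ c₀ ∧ ∃ Ω > 0, ∀ t₀ > 0, ∀ h₀ > 0, ∀ M : ℝ, ∃ A : ℝ,
          ∀ χ : ℝ → E d → E d → ℝ, IsCutoff r ε t₀ M χ →
          ∀ C : ℝ → ℝ, (∀ h > 0, 0 < C h) →
          ∀ h ∈ Set.Ioc 0 h₀, ∀ x₀ ∈ K, ∀ y₀ : E d,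
            ContDiffOn ℝ ∞
              (fun w : ℝ × E d × E d => cutoffWKB g U δ C χ h x₀ y₀ w.1 w.2.1 w.2.2)
              {w | 0 < w.1 ∧ w.1 * ‖y₀‖ < c} ∧
            ∀ t ∈ Set.Ioc 0 t₀, t * ‖y₀‖ < c → ∀ x y : E d,
              |inhomogeneity g U δ C χ h x₀ y₀ t x y| ≤
                A * t ^ 2 * (cutoffWKB g U δ C χ h x₀ y₀ t x y / C h) +
                A * Real.exp (-Ω / (h * t ^ 3)) *
                  (boundaryLayer r ε t x₀ y₀).indicator (fun _ => (1 : ℝ)) (x, y) := by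
  have hm : IsMetric U g := ⟨hU, hg_smooth, hg_pos⟩
  obtain ⟨X⟩ := hm.nonempty_chart hK hKU
  refine ⟨X.δ, X.δ_pos, X.r₀, X.r₀_pos, X.c₀, X.c₀_pos, fun x₀ hx₀ y₀ => ⟨?_, ?_, ?_⟩, ?_⟩
  · intro t ht hty x y hxy
    have hw := Chart.mem_timeDom (X := X) hx₀ (w := (t, x, y)) ht hty hxy
    exact ⟨Chart.existsUnique_isConnecting hm hw, Chart.jacobian_pos hm hw⟩
  · exact (Chart.contDiffOn_phaseS hm (x₀, y₀)).mono fun w hw =>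
      Chart.mem_timeDom hx₀ hw.1 hw.2.1 hw.2.2
  · exact (Chart.contDiffOn_amplitude hm (x₀, y₀)).mono fun w hw =>
      Chart.mem_timeDom hx₀ hw.1 hw.2.1 hw.2.2
  · intro r hr0 hr ε hε hεr
    -- The inner radius `r - ε` of the layer is the distance beyond which the action is bounded
    -- below; it fixes `c` and `Ω` before `t₀`, `h₀` and `M` are given.
    obtain ⟨c, hc0, hc, Ω, hΩ0, hΩ⟩ := Chart.exists_action_bound hm hK hr (sub_pos.2 hεr)
    obtain ⟨B, hB1, hB⟩ := Chart.exists_isBound hm (isCompact_tubeSet hK c r)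
      (Chart.tubeSet_subset_dom hc hr)
    -- The other half of the exponent is spent on absorbing the negative powers of `h` and `t`.
    refine ⟨c, hc0, hc.le, Ω / 2, half_pos hΩ0, fun t₀ ht₀ h₀ hh₀ M => ?_⟩
    obtain ⟨A, -, hA⟩ := exists_exp_absorb d hΩ0 ht₀ hh₀
    set N := M * (B ^ 2 * h₀ * t₀ ^ 2 + B ^ 2 * h₀ * t₀ ^ 3 + B * (t₀ + B * t₀ + B + B ^ 2)) * A
      with hN
    -- One constant serves both terms of the bound: `B ^ 3` for the interior term and `N` for the
    -- layer.
    refine ⟨max (B ^ 3) N, fun χ hχ C hC h hh x₀ hx₀ y₀ => ⟨fun w hw => ?_, ?_⟩⟩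
    · exact (Chart.contDiffAt_cutoffWKB_of_lt hm hr hχ C h (a := (x₀, y₀)) hx₀ hw.1
        (hw.2.trans hc)).contDiffWithinAt
    · intro t ht hty x y
      refine (Chart.abs_inhomogeneity_le hm hr0 hr hc hΩ hB1 hB hA hχ (hC h hh.1) hh
        (a := (x₀, y₀)) hx₀ (w := (t, x, y)) ht hty).trans (add_le_add ?_ ?_)
      · rw [mul_assoc, mul_assoc]
        refine mul_le_mul_of_nonneg_right (le_max_left _ _) (mul_nonneg (sq_nonneg t) ?_)
        refine div_nonneg (mul_nonneg (mul_nonneg (mul_nonneg (hC h hh.1).le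
          (hχ.mem_Icc t ht.1 _ _).1) ?_) (Real.exp_pos _).le) (hC h hh.1).le
        exact inv_nonneg.2 (Real.sqrt_nonneg _)
      · exact mul_le_mul_of_nonneg_right (mul_le_mul_of_nonneg_right (le_max_right _ _)
          (Real.exp_pos _).le) (Set.indicator_nonneg (fun _ _ => zero_le_one) _)
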